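/- Let $F$ be a non-Archimedean local field whose residue field has odd characteristic, and let $D$ be a quaternion division algebra over $F$ (a central division algebra of dimension $4$), with its natural topology; $D^\times$ is given the topology of a unit group. For a topological abelian group $A$ with trivial action, let $H^i(D^\times,A)$, $i=1,2$, denote continuous cohomology: $H^1$ is the group of continuous homomorphisms $D^\times\to A$, and $H^2$ is the group of continuous $2$-cocycles modulo coboundaries of continuous $1$-cochains. For an abelian group $B$ let $B[2]=\{b\in B: 2b=0\}$. Here $\mathbb{Z}/2$ is discrete, $\mathbb{C}^\times$ has its usual topology, and $\mathbb{Z}/2\hookrightarrow\mathbb{C}^\times$ sends $1$ to $-1$. Then: (1) $H^2(D^\times,\mathbb{Z}/2)\cong \mathbb{Z}/2\oplus\mathbb{Z}/2$. (2) $H^2(D^\times,\mathbb{C}^\times)[2]\cong\mathbb{Z}/2$. (3) There is a short exact sequence $$0\to \frac{H^1(D^\times,\mathbb{C}^\times)}{2H^1(D^\times,\mathbb{C}^\times)}\to H^2(D^\times,\mathbb{Z}/2)\to H^2(D^\times,\mathbb{C}^\times)[2]\to 0,$$ in which the first map is induced by the connecting map of $0\to\mathbb{Z}/2\to\mathbb{C}^\times\xrightarrow{\,z\mapsto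 z^2\,}\mathbb{C}^\times\to 0$ and the second by the inclusion $\mathbb{Z}/2\hookrightarrow\mathbb{C}^\times$; moreover $H^1(D^\times,\mathbb{C}^\times)/2H^1(D^\times,\mathbb{C}^\times)\cong\mathbb{Z}/2$. (4) Let $M/F$ be the unramified quadratic extension, with an $F$-embedding $M\hookrightarrow D$. Let $1\to\mathbb{Z}/2\to E\to D^\times\to1$ be a two-fold cover, that is, a locally compact topological central extension, and let $(E\times\mathbb{C}^\times)/\langle(-1,-1)\rangle\to D^\times$ be the $\mathbb{C}^\times$-cover obtained from it, where the first $-1$ is the image in $E$ of the non-trivial element of $\mathbb{Z}/2$. Say that a cover of $D^\times$ splits over a subgroup $H$ if it has a section over $H$ that is a continuous homomorphism. If the $\mathbb{C}^\times$-cover is non-trivial, i.e. does not split over $D^\times$, then neither $E$ nor the $\mathbb{C}^\times$-cover splits over $M^\times\subset D^\times$. -/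

import Mathlib

open scoped ValuativeRel

/-! Continuous cohomology, in degrees one and two, of a topological group `G` with coefficients in a
topological abelian group `A` on which `G` acts trivially. -/

namespace ContCoh

section Groups

variable (G : Type*) [Group G] [TopologicalSpace G]
variable (A : Type*) [AddCommGroup A] [TopologicalSpace A] [IsTopologicalAddGroup A]

/-- `H¹(G, A)` for the trivial action: the continuous homomorphisms from `G` to `A` (there are no
non-zero coboundaries in degree one). -/
def H1 : AddSubgroup (G → A) where
  carrier := {f | Continuous f ∧ ∀ g h, f (g * h) = f g + f h}
  zero_mem' := ⟨continuous_const, fun _ _ => by simp⟩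
  add_mem' := fun {a b} ha hb =>
    ⟨ha.1.add hb.1, fun g h => by simp only [Pi.add_apply, ha.2, hb.2]; abel⟩
  neg_mem' := fun {a} ha =>
    ⟨ha.1.neg, fun g h => by simp only [Pi.neg_apply, ha.2]; abel⟩

/-- Continuous 2-cocycles. -/
def Z2 : AddSubgroup (G × G → A) where
  carrier := {f | Continuous f ∧
    ∀ g h k, f (h, k) + f (g, h * k) = f (g * h, k) + f (g, h)}
  zero_mem' := ⟨continuous_const, fun _ _ _ => by simp⟩
  add_mem' := fun {a b} ha hb => ⟨ha.1.add hb.1, fun g h k => by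
    simp only [Pi.add_apply]
    rw [add_add_add_comm, ha.2, hb.2, add_add_add_comm]⟩
  neg_mem' := fun {a} ha => ⟨ha.1.neg, fun g h k => by
    simp only [Pi.neg_apply]
    rw [← neg_add, ha.2, neg_add]⟩

/-- Coboundaries of continuous 1-cochains. -/
def B2 : AddSubgroup (G × G → A) where
  carrier := {f | ∃ c : G → A, Continuous c ∧ ∀ g h, f (g, h) = c h - c (g * h) + c g}
  zero_mem' := ⟨0, continuous_const, fun _ _ => by simp⟩
  add_mem' := by
    rintro a b ⟨c, hc, hac⟩ ⟨d, hd, hbd⟩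
    refine ⟨c + d, hc.add hd, fun g h => ?_⟩
    simp only [Pi.add_apply, hac, hbd]; abel
  neg_mem' := by
    rintro a ⟨c, hc, hac⟩
    refine ⟨-c, hc.neg, fun g h => ?_⟩
    simp only [Pi.neg_apply, hac]; abel

/-- `H²(G, A)`: continuous 2-cocycles modulo coboundaries of continuous 1-cochains. -/
abbrev H2 : Type _ := Z2 G A ⧸ (B2 G A).addSubgroupOf (Z2 G A)

end Groups

section Maps

variable (G : Type*) [Group G] [TopologicalSpace G]
variable {A B : Type*} [AddCommGroup A] [TopologicalSpace A] [IsTopologicalAddGroup A]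
  [AddCommGroup B] [TopologicalSpace B] [IsTopologicalAddGroup B]

/-- Composition of 2-cocycles with a continuous homomorphism of coefficients. -/
def Z2.map (φ : A →ₜ+ B) : Z2 G A →+ Z2 G B where
  toFun f := ⟨fun x => φ (f.1 x), φ.continuous.comp f.2.1, fun g h k => by
    rw [← map_add, ← map_add, f.2.2]⟩
  map_zero' := Subtype.ext (funext fun _ => map_zero φ)
  map_add' _ _ := Subtype.ext (funext fun _ => map_add φ _ _)

/-- The map `H²(G, A) → H²(G, B)` induced by a continuous homomorphism `A → B`. -/
def H2.map (φ : A →ₜ+ B) : H2 G A →+ H2 G B :=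
  QuotientAddGroup.map _ _ (Z2.map G φ) (by
    rintro ⟨f, hf⟩ ⟨c, hc, hfc⟩
    exact ⟨fun g => φ (c g), φ.continuous.comp hc, fun g h => by
      have := hfc g h
      simp only [AddSubgroup.subtype_apply] at this
      simp [Z2.map, this]⟩)

end Maps

/-- The inclusion of `ℤ/2` in `ℂˣ`, with `1 ↦ -1`; the group `ℂˣ` is written additively. -/
def signHom : ZMod 2 →ₜ+ Additive ℂˣ where
  toAddMonoidHom := ZMod.lift 2 ⟨zmultiplesHom (Additive ℂˣ) (Additive.ofMul (-1)), by
    rw [zmultiplesHom_apply, ← ofMul_zpow]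
    norm_num⟩
  continuous_toFun := continuous_of_discreteTopology

/-- `c ∈ H²(G, ℤ/2)` is the image of the character `χ ∈ H¹(G, ℂˣ)` under the connecting map of
`0 → ℤ/2 → ℂˣ → ℂˣ → 0` (second map: squaring): the coboundary of some continuous square root of
`χ` is the image of a continuous `ℤ/2`-valued cocycle that represents `c`. -/
def IsConnectingImage {G : Type*} [Group G] [TopologicalSpace G]
    (χ : H1 G (Additive ℂˣ)) (c : H2 G (ZMod 2)) : Prop :=
  ∃ s : G → Additive ℂˣ, Continuous s ∧ (∀ g, 2 • s g = χ.1 g) ∧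
    ∃ β : Z2 G (ZMod 2), (∀ g h, signHom (β.1 (g, h)) = s h - s (g * h) + s g) ∧
      QuotientAddGroup.mk β = c

end ContCoh

/-! Two-fold covers of topological groups. -/

/-- `ι` and `p` make `E` a two-fold cover of `G`: a locally compact topological central extension
of `G` by `ℤ/2`. -/
structure IsTwofoldCover {E G : Type*} [Group E] [TopologicalSpace E] [Group G]
    [TopologicalSpace G] (ι : Multiplicative (ZMod 2) →* E) (p : E →* G) : Prop where
  isTopologicalGroup : IsTopologicalGroup E
  locallyCompactSpace : LocallyCompactSpace E
  isSES : TopologicalGroup.IsSES ι p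
  central : ι.range ≤ Subgroup.center E

/-- An extension `p : E → G` splits over the subgroup `H` of `G`: there is a continuous
homomorphism `H → E` which is a section of `p` over `H`. -/
def SplitsOver {E G : Type*} [Group E] [TopologicalSpace E] [Group G] [TopologicalSpace G]
    (p : E →* G) (H : Subgroup G) : Prop :=
  ∃ s : H →* E, Continuous s ∧ ∀ h : H, p (s h) = h

/-- The group `(E × ℂˣ) / ⟨(-1, -1)⟩`, with the quotient topology, where the first `-1` is the image
in `E` of the non-trivial element of `ℤ/2`. When this image is central of order two, the normal
closure is just the subgroup with the two elements `1` and `(-1, -1)`. -/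
abbrev ComplexCover {E : Type*} [Group E] (ι : Multiplicative (ZMod 2) →* E) : Type _ :=
  (E × ℂˣ) ⧸ Subgroup.normalClosure {(ι (Multiplicative.ofAdd 1), (-1 : ℂˣ))}

/-- The projection to `G` of the `ℂˣ`-cover obtained from a two-fold cover `E → G`. -/
def ComplexCover.proj {E G : Type*} [Group E] [TopologicalSpace E] [Group G] [TopologicalSpace G]
    {ι : Multiplicative (ZMod 2) →* E} {p : E →* G} (h : IsTwofoldCover ι p) :
    ComplexCover ι →* G :=
  QuotientGroup.lift _ (p.comp (MonoidHom.fst E ℂˣ)) (by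
    intro x hx
    have hle : Subgroup.normalClosure {(ι (Multiplicative.ofAdd 1), (-1 : ℂˣ))} ≤
        (p.comp (MonoidHom.fst E ℂˣ)).ker := by
      refine Subgroup.normalClosure_le_normal ?_
      rintro _ rfl
      exact (h.isSES.mulExact _).2 ⟨_, rfl⟩
    exact hle hx)

/-! Only the tame structure of Dˣ matters, and `TameGroup` records it. Let q be the order of the
residue field of F and n = q² - 1. Modulo the principal units U, the group Dˣ is ℤ/n ⋊ ℤ: the factor
ℤ/n is the multiplicative group of the residue field of D, and a uniformizer P acts on it by
Frobenius, x ↦ q x. The square of P can be taken central. The group U is compact with arbitrarily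
small open normal subgroups of odd index, so ℤ/2 does not see it.

Given a ℤ/2-valued cocycle, averaging splits its extension over U, and the lifted copy of U is
normal because the obstruction is a continuous homomorphism from U to ℤ/2. Two signs remain: `comm`,
the commutator of lifts of P² and of z (a generator of ℤ/n), and `defect`, the sign by which lifts
violate P z = z^q y² P. If both vanish then, modulo U, conjugating the lift of z twice by P gives z
= z^(q²), so z^n = 1 holds for the lifts as well and they generate a complement of ℤ/2
(`mem_B2_of_comm_of_defect`). Both signs are realised: `defect` by the connecting image of the tame
character of order q - 1 (`exists_tameCocycle`), `comm` by lifting the crossed homomorphism `lam`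
from ℤ/n to ℤ/2n (`exists_commCocycle`). This gives (1).

The sign `comm` vanishes on coboundaries with any coefficients, so it survives in ℂˣ, while the tame
class dies there. Hence the kernel of H²(ℤ/2) → H²(ℂˣ) is the locus `comm` = 0, of order two. The
exact sequence (3) needs only that continuous functions to ℂˣ have continuous square roots, which
holds since small cosets are open; (2) and the order of H¹/2H¹ follow.

For (4), a splitting over Mˣ makes lifts of commuting elements of Mˣ commute in E. The element P²
lies in Fˣ, and Mˣ contains a unit with the same leading coefficient as z, because M and D have the
same residue field. So `comm` vanishes and the ℂˣ-cover is trivial.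

The tame structure comes from a presentation of D by anticommuting i, j with i² a non-square unit
and j² a uniformizer; the maximal order is then explicit, with residue field generated by i and with
P = j. -/

namespace ContCoh

open Topology Filter

/-! ### Compact subgroups that are pro-(odd order) -/

section OddCompact

variable {G : Type*} [Group G] [TopologicalSpace G]

/-- The compact subgroup `U` of `G` has, as a basis of neighbourhoods of `1` in `G`, open normal
subgroups of `G` of odd index in `U`. -/
structure IsCompactOdd (U : Subgroup G) : Prop where
  isCompact : IsCompact (U : Set G)
  exists_subgroup : ∀ W ∈ 𝓝 (1 : G), ∃ V : Subgroup G, V.Normal ∧ IsOpen (V : Set G) ∧ V ≤ U ∧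
    (V : Set G) ⊆ W ∧ Odd (V.relIndex U)

namespace IsCompactOdd

variable {U : Subgroup G}

/-- By continuity f vanishes on some open V of odd index m in U. Since u ^ m lies in V, m • f u = 0,
and m is odd. -/
theorem eq_zero_of_map_mul (hU : IsCompactOdd U) {f : G → ZMod 2} (hf : ContinuousAt f 1)
    (hmul : ∀ u ∈ U, ∀ w ∈ U, f (u * w) = f u + f w) {u : G} (hu : u ∈ U) : f u = 0 := by
  have h1 : f 1 = 0 := by simpa using hmul 1 U.one_mem 1 U.one_mem
  have hW : f ⁻¹' {0} ∈ 𝓝 (1 : G) := hf (by rw [h1]; exact (isOpen_discrete _).mem_nhds rfl)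
  obtain ⟨V, hVn, -, -, hVW, hodd⟩ := hU.exists_subgroup _ hW
  have hpow : ∀ k : ℕ, f (u ^ k) = k • f u := by
    intro k
    induction k with
    | zero => simp [h1]
    | succ k ih => rw [pow_succ, hmul _ (U.pow_mem hu k) _ hu, ih, succ_nsmul]
  have h0 : f (u ^ V.relIndex U) = 0 := hVW (Subgroup.pow_relIndex_mem _ hu)
  rw [hpow] at h0
  obtain ⟨m, hm⟩ := hodd
  rw [hm] at h0
  have h2 : (2 : ZMod 2) = 0 := rfl
  simpa [h2] using h0

variable [IsTopologicalGroup G]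

theorem isOpen (hU : IsCompactOdd U) : IsOpen (U : Set G) := by
  obtain ⟨V, -, hV, hVU, -, -⟩ := hU.exists_subgroup Set.univ univ_mem
  exact Subgroup.isOpen_mono hVU hV

/-- The squares form a compact, hence closed, set. They are also dense: for V of odd index 2m + 1,
the element w * w ^ (2m + 1) is the square of w ^ (m + 1) and is congruent to w modulo V. -/
theorem exists_sq_eq [T2Space G] (hU : IsCompactOdd U) {w : G} (hw : w ∈ U) :
    ∃ y ∈ U, y ^ 2 = w := by
  have hc : IsClosed ((fun y : G => y ^ 2) '' U) :=
    (hU.isCompact.image (continuous_pow 2)).isClosed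
  have : w ∈ closure ((fun y : G => y ^ 2) '' U) := by
    rw [mem_closure_iff_nhds]
    intro W hW
    have hW' : (fun x : G => w * x) ⁻¹' W ∈ 𝓝 (1 : G) :=
      (continuous_const_mul w).continuousAt (by simpa using hW)
    obtain ⟨V, hVn, -, -, hVW, m, hm⟩ := hU.exists_subgroup _ hW'
    refine ⟨w * w ^ V.relIndex U, hVW (Subgroup.pow_relIndex_mem _ hw), w ^ (m + 1), U.pow_mem hw _, ?_⟩
    simp only [hm]
    rw [← pow_mul, ← pow_succ']
    congr 1
    ring
  rw [hc.closure_eq] at this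
  obtain ⟨y, hy, h⟩ := this
  exact ⟨y, hy, h⟩

/-- Averaging: a continuous `ℤ/2`-valued cocycle is a coboundary on `U`. -/
theorem exists_coboundary (hU : IsCompactOdd U) (β : Z2 G (ZMod 2)) :
    ∃ c : G → ZMod 2, Continuous c ∧
      ∀ g ∈ U, ∀ h ∈ U, β.1 (g, h) = c h - c (g * h) + c g := by
  -- Compactness of U × U makes β uniformly locally constant in its second argument: one V serves
  -- for all pairs.
  have hcont : Continuous fun p : (G × G) × G => β.1 (p.1.1, p.1.2 * p.2) - β.1 p.1 := by
    have := β.2.1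
    fun_prop
  obtain ⟨W, W', -, hW', hUW, h1W', hprod⟩ := generalized_tube_lemma
    (hU.isCompact.prod hU.isCompact) (isCompact_singleton (x := (1 : G)))
    ((isOpen_discrete ({0} : Set (ZMod 2))).preimage hcont) (by
      rintro ⟨⟨a, b⟩, x⟩ ⟨-, rfl : x = 1⟩
      simp)
  obtain ⟨V, hVn, -, hVU, hVW, hodd⟩ :=
    hU.exists_subgroup W' (hW'.mem_nhds (h1W' rfl))
  have hinv : ∀ a ∈ U, ∀ b ∈ U, ∀ x ∈ V, β.1 (a, b * x) = β.1 (a, b) := fun a ha b hb x hx => by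
    have : ((a, b), x) ∈ W ×ˢ W' := ⟨hUW ⟨ha, hb⟩, hVW hx⟩
    simpa [sub_eq_zero] using hprod this
  set V' := V.subgroupOf U
  have hV' : Odd V'.index := hodd
  have : V'.FiniteIndex := ⟨fun h => by simp [h] at hV'⟩
  let := Fintype.ofFinite (U ⧸ V')
  have hrep : ∀ a ∈ U, ∀ b : U,
      β.1 (a, ((QuotientGroup.mk b : U ⧸ V').out : U)) = β.1 (a, (b : G)) := by
    intro a ha b
    obtain ⟨x, hx⟩ := QuotientGroup.mk_out_eq_mul V' b
    rw [hx]
    exact hinv a ha b b.2 x x.2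
  -- The cochain sums β(g, ·) over U / V. Summing the cocycle identity over all cosets, left
  -- translation by h permutes them, and β(g, h) occurs an odd number of times.
  refine ⟨fun g => ∑ κ : U ⧸ V', β.1 (g, (κ.out : U)), ?_, ?_⟩
  · have := β.2.1
    fun_prop
  intro g hg h hh
  have key : ∀ κ : U ⧸ V', β.1 (h, (κ.out : U)) + β.1 (g, (((⟨h, hh⟩ : U) • κ).out : U)) =
      β.1 (g * h, (κ.out : U)) + β.1 (g, h) := by
    intro κ
    rw [← β.2.2 g h]
    congr 1
    have : (⟨h, hh⟩ : U) • κ = QuotientGroup.mk ((⟨h, hh⟩ : U) * κ.out) := by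
      conv_lhs => rw [← QuotientGroup.out_eq' κ]
      rfl
    rw [this, hrep g hg]
    rfl
  have hs := Finset.sum_congr rfl fun κ (_ : κ ∈ Finset.univ) => key κ
  have hperm : ∑ κ : U ⧸ V', β.1 (g, (((⟨h, hh⟩ : U) • κ).out : U)) =
      ∑ κ : U ⧸ V', β.1 (g, (κ.out : U)) :=
    Equiv.sum_comp (MulAction.toPerm (⟨h, hh⟩ : U)) (fun κ : U ⧸ V' => β.1 (g, (κ.out : U)))
  rw [Finset.sum_add_distrib, Finset.sum_add_distrib, hperm, Finset.sum_const,
    Finset.card_univ] at hs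
  obtain ⟨m, hm⟩ := hV'
  rw [Subgroup.index, Nat.card_eq_fintype_card] at hm
  have h2 : (2 : ZMod 2) = 0 := rfl
  rw [hm] at hs
  simp only [nsmul_eq_mul, Nat.cast_add, Nat.cast_mul, Nat.cast_ofNat, h2, zero_mul, zero_add,
    Nat.cast_one, one_mul] at hs
  linear_combination -hs

end IsCompactOdd

end OddCompact

end ContCoh

namespace ContCoh

open Topology Filter

/-! ### The group extension of a cocycle -/

section WordSum

variable {G A : Type*} [Group G] [AddCommGroup A]

/-- The second component of a product of the lifts `(g, 0)` in a normalised extension. -/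
def wordSum (f : G × G → A) : List G → A
  | [] => 0
  | g :: l => f (g, l.prod) + wordSum f l

theorem wordSum_add (f₁ f₂ : G × G → A) (l : List G) :
    wordSum (f₁ + f₂) l = wordSum f₁ l + wordSum f₂ l := by
  induction l with
  | nil => simp [wordSum]
  | cons g l ih => simp only [wordSum, ih, Pi.add_apply]; abel

theorem map_wordSum {B : Type*} [AddCommGroup B] (φ : A →+ B) (f : G × G → A) (l : List G) :
    φ (wordSum f l) = wordSum (fun x => φ (f x)) l := by
  induction l with
  | nil => simp [wordSum]
  | cons g l ih => simp [wordSum, ih]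

/-- The sum telescopes: it depends on the letters and the product only, so two words with equal
product differ by the sums of c over their letters. -/
theorem wordSum_coboundary {f : G × G → A} {c : G → A}
    (h : ∀ g h, f (g, h) = c h - c (g * h) + c g) (l : List G) :
    wordSum f l = (l.map c).sum - c l.prod + c 1 := by
  induction l with
  | nil => simp [wordSum]
  | cons g l ih => simp only [wordSum, ih, h, List.prod_cons, List.map_cons, List.sum_cons]; abel

end WordSum

section Ext

variable {G : Type*} [Group G] [TopologicalSpace G]
variable {A : Type*} [AddCommGroup A] [TopologicalSpace A] [IsTopologicalAddGroup A]

theorem Z2.apply_one_left (β : Z2 G A) (g : G) : β.1 (1, g) = β.1 (1, 1) := by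
  have := β.2.2 1 1 g
  simpa using this

theorem Z2.apply_one_right (β : Z2 G A) (g : G) : β.1 (g, 1) = β.1 (1, 1) := by
  have := β.2.2 g 1 1
  simpa using this.symm

/-- The extension of `G` by `A` given by a 2-cocycle. -/
@[ext]
structure CocycleExt (β : Z2 G A) where
  /-- the component in the group -/
  fst : G
  /-- the component in the coefficients -/
  snd : A

namespace CocycleExt

variable {β : Z2 G A}

instance : Mul (CocycleExt β) := ⟨fun x y => ⟨x.fst * y.fst, x.snd + y.snd + β.1 (x.fst, y.fst)⟩⟩

instance : One (CocycleExt β) := ⟨⟨1, -β.1 (1, 1)⟩⟩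

instance : Inv (CocycleExt β) :=
  ⟨fun x => ⟨x.fst⁻¹, -x.snd - β.1 (x.fst⁻¹, x.fst) - β.1 (1, 1)⟩⟩

@[simp] theorem mul_fst (x y : CocycleExt β) : (x * y).fst = x.fst * y.fst := rfl

@[simp] theorem mul_snd (x y : CocycleExt β) :
    (x * y).snd = x.snd + y.snd + β.1 (x.fst, y.fst) := rfl

@[simp] theorem one_fst : (1 : CocycleExt β).fst = 1 := rfl

@[simp] theorem one_snd : (1 : CocycleExt β).snd = -β.1 (1, 1) := rfl

@[simp] theorem inv_fst (x : CocycleExt β) : (x⁻¹).fst = x.fst⁻¹ := rfl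

theorem inv_snd (x : CocycleExt β) :
    (x⁻¹).snd = -x.snd - β.1 (x.fst⁻¹, x.fst) - β.1 (1, 1) := rfl

instance : Group (CocycleExt β) :=
  Group.ofLeftAxioms
    (fun x y z => by
      ext
      · simp [mul_assoc]
      · have := β.2.2 x.fst y.fst z.fst
        simp only [mul_snd, mul_fst]
        rw [add_assoc (x.snd + y.snd + _), add_comm (z.snd), ← add_assoc,
          add_assoc (x.snd + y.snd), add_comm (β.1 (x.fst, y.fst)), ← this]
        abel)
    (fun x => by
      ext
      · simp
      · simp [Z2.apply_one_left])
    (fun x => by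
      ext
      · simp
      · simp only [mul_snd, inv_snd, inv_fst, one_snd]
        abel)

/-- The projection of the extension to the group. -/
@[simps]
def proj (β : Z2 G A) : CocycleExt β →* G where
  toFun := fst
  map_one' := rfl
  map_mul' _ _ := rfl

end CocycleExt

theorem CocycleExt.prod_map_mk {β : Z2 G A} (h1 : β.1 (1, 1) = 0) (l : List G) :
    (l.map fun g => (⟨g, 0⟩ : CocycleExt β)).prod = ⟨l.prod, wordSum β.1 l⟩ := by
  induction l with
  | nil => ext <;> simp [wordSum, h1]
  | cons g l ih =>
    rw [List.map_cons, List.prod_cons, ih]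
    ext <;> simp [wordSum, add_comm]

end Ext

/-- In a group where `P z = z ^ q P` and `z` has finite order, the products `z ^ i P ^ j` form a
subgroup. -/
theorem exists_subgroup_of_mul_eq {Q : Type*} [Group Q] {z P : Q} {q n : ℕ} (hn : q ^ 2 = n + 1)
    (hz : z ^ n = 1) (hP : P * z = z ^ q * P) :
    ∃ S : Subgroup Q, ∀ x, x ∈ S ↔ ∃ i j : ℤ, x = z ^ i * P ^ j := by
  have hconj : P * z * P⁻¹ = z ^ q := by rw [hP]; simp
  -- Conjugation by P⁻¹ is also the q-th power on z, since q² is 1 modulo n. This handles negative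
  -- powers of P below.
  have hconj' : P⁻¹ * z * P = z ^ q := by
    have h : P * z ^ q * P⁻¹ = z := by
      rw [← conj_pow, hconj, ← pow_mul, ← sq, hn, pow_succ, hz, one_mul]
    rw [mul_inv_eq_iff_eq_mul] at h
    rw [mul_assoc, ← h, inv_mul_cancel_left]
  have key : ∀ j k : ℤ, ∃ k' : ℤ, P ^ j * z ^ k = z ^ k' * P ^ j := by
    intro j
    induction j using Int.induction_on with
    | zero => exact fun k => ⟨k, by simp⟩
    | succ j ih =>
      intro k
      obtain ⟨k', hk'⟩ := ih (q * k)
      refine ⟨k', ?_⟩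
      have h2 : (P * z * P⁻¹) ^ k = P * z ^ k * P⁻¹ := conj_zpow
      rw [hconj, eq_mul_inv_iff_mul_eq] at h2
      rw [zpow_add_one, mul_assoc, ← h2, ← mul_assoc, ← mul_assoc, ← hk', zpow_mul, zpow_natCast z]
    | pred j ih =>
      intro k
      obtain ⟨k', hk'⟩ := ih (q * k)
      refine ⟨k', ?_⟩
      have h2 : (P⁻¹ * z * P⁻¹⁻¹) ^ k = P⁻¹ * z ^ k * P⁻¹⁻¹ := conj_zpow
      rw [eq_mul_inv_iff_mul_eq, inv_inv, hconj'] at h2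
      rw [zpow_sub_one, mul_assoc, ← h2, ← mul_assoc, ← mul_assoc, ← hk', zpow_mul, zpow_natCast z]
  refine ⟨⟨⟨⟨{x | ∃ i j : ℤ, x = z ^ i * P ^ j}, ?_⟩, ⟨0, 0, by simp⟩⟩, ?_⟩, fun x => Iff.rfl⟩
  · rintro _ _ ⟨i, j, rfl⟩ ⟨i', j', rfl⟩
    obtain ⟨k', hk'⟩ := key j i'
    refine ⟨i + k', j + j', ?_⟩
    rw [zpow_add, zpow_add, mul_assoc, ← mul_assoc (P ^ j), hk']
    group
  · rintro _ ⟨i, j, rfl⟩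
    obtain ⟨k', hk'⟩ := key (-j) (-i)
    exact ⟨k', -j, by rw [← hk']; group⟩

end ContCoh

namespace ContCoh

open Topology Filter

/-! ### Tame groups -/

/-- A topological group with the structure of `Dˣ` at the tame level: it is an extension of
`ℤ/n ⋊ ℤ`, where `n = q² - 1` and the generator of `ℤ` acts on `ℤ/n` as multiplication by `q`,
by a compact pro-(odd order) group, and the square of some lift of the generator of `ℤ` is
central. -/
structure TameGroup (G : Type*) [Group G] [TopologicalSpace G] where
  /-- the order of the residue field of the centre -/
  q : ℕ
  /-- the order of the tame inertia group -/
  n : ℕ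
  odd_q : Odd q
  one_lt_q : 1 < q
  sq_q : q ^ 2 = n + 1
  /-- the valuation -/
  v : G → ℤ
  v_mul : ∀ g h, v (g * h) = v g + v h
  /-- `q` as a unit modulo `n` -/
  qu : (ZMod n)ˣ
  qu_val : (qu : ZMod n) = q
  /-- the discrete logarithm of the leading coefficient -/
  lam : G → ZMod n
  lam_mul : ∀ g h, lam (g * h) = lam g + ((qu ^ v g : (ZMod n)ˣ) : ZMod n) * lam h
  /-- a uniformizer -/
  P : G
  v_P : v P = 1
  lam_P : lam P = 0
  P_central : ∀ g, P * P * g = g * (P * P)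
  /-- a lift of a generator of the multiplicative group of the residue field -/
  z : G
  v_z : v z = 0
  lam_z : lam z = 1
  /-- the principal units -/
  U : Subgroup G
  mem_U : ∀ g, g ∈ U ↔ v g = 0 ∧ lam g = 0
  odd_U : IsCompactOdd U

namespace TameGroup

variable {G : Type*} [Group G] [TopologicalSpace G] (T : TameGroup G)

theorem one_lt_n : 1 < T.n := by
  have h1 := T.sq_q
  have h2 := T.one_lt_q
  nlinarith

theorem v_one : T.v 1 = 0 := by simpa using T.v_mul 1 1

theorem lam_one : T.lam 1 = 0 := by simpa [T.v_one] using T.lam_mul 1 1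

theorem v_zpow (g : G) (k : ℤ) : T.v (g ^ k) = k * T.v g := by
  let f : G →* Multiplicative ℤ :=
    ⟨⟨fun g => Multiplicative.ofAdd (T.v g), by simp [T.v_one]⟩, fun a b => by simp [T.v_mul]⟩
  have h : Multiplicative.toAdd (f (g ^ k)) = k • Multiplicative.toAdd (f g) := by
    rw [map_zpow, toAdd_zpow]
  exact h.trans (smul_eq_mul _ _)

theorem v_inv (g : G) : T.v g⁻¹ = -T.v g := by simpa using T.v_zpow g (-1)

theorem lam_mul_of_v_eq_zero {g : G} (hg : T.v g = 0) (h : G) :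
    T.lam (g * h) = T.lam g + T.lam h := by simp [T.lam_mul, hg]

theorem inv_mul_mem_U {g h : G} (hv : T.v g = T.v h) (hl : T.lam g = T.lam h) :
    h⁻¹ * g ∈ T.U := by
  rw [T.mem_U]
  refine ⟨by rw [T.v_mul, T.v_inv, hv]; ring, ?_⟩
  have := T.lam_mul h (h⁻¹ * g)
  rw [mul_inv_cancel_left, hl] at this
  simpa using this

theorem v_mul_mem (g : G) {u : G} (hu : u ∈ T.U) : T.v (g * u) = T.v g := by
  rw [T.v_mul, ((T.mem_U u).1 hu).1, add_zero]

theorem lam_mul_mem (g : G) {u : G} (hu : u ∈ T.U) : T.lam (g * u) = T.lam g := by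
  rw [T.lam_mul, ((T.mem_U u).1 hu).2, mul_zero, add_zero]

theorem normal_U : T.U.Normal := ⟨fun u hu g => by
  have h := T.inv_mul_mem_U (g := u * g⁻¹) (h := g⁻¹) ?_ ?_
  · simpa [mul_assoc] using h
  · rw [T.v_mul, ((T.mem_U u).1 hu).1, zero_add]
  · rw [T.lam_mul_of_v_eq_zero ((T.mem_U u).1 hu).1, ((T.mem_U u).1 hu).2, zero_add]⟩

theorem v_z_zpow (k : ℤ) : T.v (T.z ^ k) = 0 := by simp [T.v_zpow, T.v_z]

theorem lam_z_zpow (k : ℤ) : T.lam (T.z ^ k) = k := by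
  induction k using Int.induction_on with
  | zero => simp [T.lam_one]
  | succ k ih => rw [zpow_add_one, T.lam_mul_of_v_eq_zero (T.v_z_zpow _), ih, T.lam_z]; push_cast; rfl
  | pred k ih =>
    have h := T.lam_mul_of_v_eq_zero (T.v_z_zpow (-k - 1)) T.z
    rw [← zpow_add_one, sub_add_cancel, ih, T.lam_z] at h
    push_cast at h ⊢
    linear_combination -h

theorem lam_P_zpow (k : ℤ) : T.lam (T.P ^ k) = 0 := by
  induction k using Int.induction_on with
  | zero => simp [T.lam_one]
  | succ k ih => rw [zpow_add_one, T.lam_mul, ih, T.lam_P]; simp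
  | pred k ih =>
    have h := T.lam_mul (T.P ^ (-k - 1 : ℤ)) T.P
    rw [← zpow_add_one, sub_add_cancel, ih, T.lam_P] at h
    simpa using h.symm

theorem v_zPow (i j : ℤ) : T.v (T.z ^ i * T.P ^ j) = j := by
  rw [T.v_mul, T.v_z_zpow, T.v_zpow, T.v_P]; ring

theorem lam_zPow (i j : ℤ) : T.lam (T.z ^ i * T.P ^ j) = i := by
  rw [T.lam_mul_of_v_eq_zero (T.v_z_zpow _), T.lam_z_zpow, T.lam_P_zpow, add_zero]

theorem exists_eq (g : G) : ∃ (i j : ℤ) (u : G), u ∈ T.U ∧ g = T.z ^ i * T.P ^ j * u := by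
  obtain ⟨i, hi⟩ := ZMod.intCast_surjective (T.lam g)
  refine ⟨i, T.v g, _, T.inv_mul_mem_U (g := g) (h := T.z ^ i * T.P ^ T.v g) ?_ ?_, by group⟩
  · rw [T.v_zPow]
  · rw [T.lam_zPow, hi]

/-- The commutator of the central element `P ^ 2` with lifts of elements of `G`. -/
def comm (A : Type*) [AddCommGroup A] (g : G) : (G × G → A) →+ A where
  toFun f := f (T.P * T.P, g) - f (g, T.P * T.P)
  map_zero' := by simp
  map_add' f f' := by simp only [Pi.add_apply]; abel

theorem comm_apply {A : Type*} [AddCommGroup A] (g : G) (f : G × G → A) :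
    T.comm A g f = f (T.P * T.P, g) - f (g, T.P * T.P) := rfl

/-- A coboundary is symmetric on commuting pairs. No condition on A is needed, which is why this
invariant persists in H²(G, ℂˣ). -/
theorem comm_coboundary {A : Type*} [AddCommGroup A] {f : G × G → A} {c : G → A}
    (h : ∀ g h, f (g, h) = c h - c (g * h) + c g) (g : G) : T.comm A g f = 0 := by
  rw [comm_apply, h, h, T.P_central]; abel

variable [IsTopologicalGroup G]

/-- The elements P z and z ^ q P have the same valuation and leading coefficient, so they differ by
an element of U. It is written as a square so that a change of cochain alters the defect by 2 c(y),
which is zero in ℤ/2. -/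
theorem exists_P_mul_z [T2Space G] : ∃ y ∈ T.U, T.P * T.z = T.z ^ T.q * (y * (y * T.P)) := by
  have h := T.inv_mul_mem_U (g := T.P * T.z) (h := T.z ^ (T.q : ℤ) * T.P ^ (1 : ℤ)) ?_ ?_
  · obtain ⟨y, hy, hy2⟩ := T.odd_U.exists_sq_eq (T.normal_U.conj_mem _ h T.P)
    refine ⟨y, hy, ?_⟩
    rw [← mul_assoc y, ← sq, hy2]
    simp [mul_assoc]
  · rw [T.v_zPow, T.v_mul, T.v_P, T.v_z, add_zero]
  · rw [T.lam_zPow, T.lam_mul, T.v_P, T.lam_P, T.lam_z]; simp [T.qu_val]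

/-- A square root in `U` of the commutation defect of `P` and `z`. -/
noncomputable def y [T2Space G] : G := T.exists_P_mul_z.choose

theorem y_mem [T2Space G] : T.y ∈ T.U := T.exists_P_mul_z.choose_spec.1

theorem P_mul_z [T2Space G] : T.P * T.z = T.z ^ T.q * (T.y * (T.y * T.P)) :=
  T.exists_P_mul_z.choose_spec.2

/-- The defect of the relation `P z = z ^ q y ^ 2 P` in the extension of a cocycle. -/
noncomputable def defect [T2Space G] (A : Type*) [AddCommGroup A] : (G × G → A) →+ A :=
  AddMonoidHom.mk' (fun f => wordSum f [T.P, T.z] -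
    wordSum f (List.replicate T.q T.z ++ [T.y, T.y, T.P])) (fun f f' => by
      simp only [wordSum_add]; abel)

theorem defect_apply [T2Space G] {A : Type*} [AddCommGroup A] (f : G × G → A) :
    T.defect A f = wordSum f [T.P, T.z] -
      wordSum f (List.replicate T.q T.z ++ [T.y, T.y, T.P]) := rfl

/-- With values in ℤ/2 this is zero, as q is odd, so the defect is a class invariant. In ℂˣ it need
not vanish, and it then evaluates the defect of a connecting image. -/
theorem defect_coboundary [T2Space G] {A : Type*} [AddCommGroup A] {f : G × G → A} {c : G → A}
    (h : ∀ g h, f (g, h) = c h - c (g * h) + c g) :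
    T.defect A f = c T.z - T.q • c T.z - 2 • c T.y := by
  have : [T.P, T.z].prod = (List.replicate T.q T.z ++ [T.y, T.y, T.P]).prod := by
    simp [T.P_mul_z]
  rw [defect_apply, wordSum_coboundary h, wordSum_coboundary h, this]
  simp [two_nsmul]
  abel

/-- A complement S of ℤ/2 is built in the extension of β: the preimage of the subgroup generated by
lifts of z and P in the quotient by the lifted copy N of U. The second coordinate of the resulting
section is a cochain bounding β. -/
theorem mem_B2_of_normalised [T2Space G] (β : Z2 G (ZMod 2))
    (hU : ∀ u ∈ T.U, ∀ w ∈ T.U, β.1 (u, w) = 0)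
    (hcomm : T.comm _ T.z β.1 = 0) (hdef : T.defect _ β.1 = 0) :
    β.1 ∈ B2 G (ZMod 2) := by
  have h1 : β.1 (1, 1) = 0 := hU 1 T.U.one_mem 1 T.U.one_mem
  have hl : ∀ g, β.1 (1, g) = 0 := fun g => by rw [Z2.apply_one_left, h1]
  have hr : ∀ g, β.1 (g, 1) = 0 := fun g => by rw [Z2.apply_one_right, h1]
  let N : Subgroup (CocycleExt β) :=
    { carrier := {x | x.fst ∈ T.U ∧ x.snd = 0}
      mul_mem' := fun {a b} ha hb => ⟨T.U.mul_mem ha.1 hb.1, by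
        simp [ha.2, hb.2, hU _ ha.1 _ hb.1]⟩
      one_mem' := ⟨T.U.one_mem, by simp [h1]⟩
      inv_mem' := fun {a} ha => ⟨T.U.inv_mem ha.1, by
        simp [CocycleExt.inv_snd, ha.2, hU _ (T.U.inv_mem ha.1) _ ha.1, h1]⟩ }
  have hNn : N.Normal := ⟨by
    intro x hx g
    refine ⟨T.normal_U.conj_mem _ hx.1 _, ?_⟩
    -- The ℤ/2-component of the conjugate of the lift of u is a continuous homomorphism in u on U,
    -- hence zero: N is normal.
    have hf := T.odd_U.eq_zero_of_map_mul
      (f := fun u => (g * (⟨u, 0⟩ : CocycleExt β) * g⁻¹).snd) ?_ ?_ hx.1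
    · rw [← hf]
      congr 3
      ext
      · rfl
      · exact hx.2
    · have := β.2.1
      apply Continuous.continuousAt
      simp only [CocycleExt.mul_snd, CocycleExt.mul_fst]
      fun_prop
    · intro u hu w hw
      have h : g * (⟨u * w, 0⟩ : CocycleExt β) * g⁻¹ =
          (g * (⟨u, 0⟩ : CocycleExt β) * g⁻¹) * (g * (⟨w, 0⟩ : CocycleExt β) * g⁻¹) := by
        rw [conj_mul]
        congr 2
        ext
        · rfl
        · simp [hU u hu w hw]
      simp only [h]
      rw [CocycleExt.mul_snd, hU, add_zero]
      · exact T.normal_U.conj_mem _ hu _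
      · exact T.normal_U.conj_mem _ hw _⟩
  have hNval : ∀ x : CocycleExt β, x ∈ N ↔ x.fst ∈ T.U ∧ x.snd = 0 := fun _ => Iff.rfl
  let ε : CocycleExt β := ⟨1, 1⟩
  have hε : ε ∉ N := fun h => by simpa [ε] using h.2
  have hεε : ε * ε = 1 := by
    ext
    · simp [ε]
    · simp [ε, h1]; rfl
  have hεc : ∀ x : CocycleExt β, x * ε = ε * x := fun x => by
    ext
    · simp [ε]
    · simp [ε, hl, hr, add_comm]
  have hsnd : ∀ x : CocycleExt β, x.snd = 0 ∨ x.snd = 1 := fun x => by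
    have : ∀ a : ZMod 2, a = 0 ∨ a = 1 := by decide
    exact this _
  have hmk : ∀ g (x : CocycleExt β), x.fst = g → x = ⟨g, 0⟩ ∨ x = ⟨g, 0⟩ * ε := by
    rintro g x rfl
    rcases hsnd x with h | h
    · exact Or.inl (by ext; · rfl
                       · exact h)
    · refine Or.inr ?_
      ext
      · simp [ε]
      · simp [ε, hr, h]
  let zt : CocycleExt β := ⟨T.z, 0⟩
  let Pt : CocycleExt β := ⟨T.P, 0⟩
  let yt : CocycleExt β := ⟨T.y, 0⟩
  let π := QuotientGroup.mk' N
  have hyt : π yt = 1 := (QuotientGroup.eq_one_iff yt).2 ⟨T.y_mem, rfl⟩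
  have hrel : π Pt * π zt = π zt ^ T.q * π Pt := by
    have h := CocycleExt.prod_map_mk h1 [T.P, T.z]
    have h' := CocycleExt.prod_map_mk h1 (List.replicate T.q T.z ++ [T.y, T.y, T.P])
    have heq : (⟨[T.P, T.z].prod, wordSum β.1 [T.P, T.z]⟩ : CocycleExt β) =
        ⟨(List.replicate T.q T.z ++ [T.y, T.y, T.P]).prod,
          wordSum β.1 (List.replicate T.q T.z ++ [T.y, T.y, T.P])⟩ := by
      ext
      · simp [T.P_mul_z]
      · exact sub_eq_zero.1 hdef
    rw [← h, ← h'] at heq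
    have h2 := congrArg π heq
    simp only [List.map_cons, List.map_nil, List.prod_cons, List.prod_nil, mul_one, List.map_append,
      List.map_replicate, List.prod_append, List.prod_replicate, map_mul, map_pow] at h2
    rw [show π (⟨T.y, 0⟩ : CocycleExt β) = 1 from hyt, one_mul, one_mul] at h2
    exact h2
  have hcomm' : Pt * Pt * zt = zt * (Pt * Pt) := by
    ext
    · exact T.P_central _
    · have := sub_eq_zero.1 hcomm
      simp [Pt, zt, this]
  -- Conjugating z twice by P gives z ^ (q²) by the relation and z by commutation with P².
  have hzn : π zt ^ T.n = 1 := by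
    have h2 : π Pt * (π Pt * π zt) = π zt * (π Pt * π Pt) := by
      rw [← mul_assoc, ← map_mul, ← map_mul, hcomm', map_mul, map_mul]
    have hconj : π Pt * π zt * (π Pt)⁻¹ = π zt ^ T.q := by rw [hrel]; simp
    rw [hrel, ← mul_assoc, ← mul_assoc, mul_left_inj] at h2
    have h3 : π Pt * π zt ^ T.q * (π Pt)⁻¹ = π zt := by rw [h2]; simp
    rw [← conj_pow, hconj, ← pow_mul, ← sq, T.sq_q, pow_succ] at h3
    simpa using h3
  obtain ⟨S', hS'⟩ := exists_subgroup_of_mul_eq T.sq_q hzn hrel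
  let S := S'.comap π
  have hS : ∀ x, x ∈ S ↔ ∃ i j : ℤ, π x = π zt ^ i * π Pt ^ j := fun x => hS' (π x)
  have hNS : ∀ x ∈ N, x ∈ S := fun x hx => (hS x).2 ⟨0, 0, by
    rw [zpow_zero, zpow_zero, one_mul]
    exact (QuotientGroup.eq_one_iff x).2 hx⟩
  -- If ε were z ^ i P ^ j modulo N, valuation and leading coefficient would force j = 0 and n ∣ i;
  -- then z ^ i is trivial modulo N and ε would lie in N.
  have hεS : ε ∉ S := by
    intro h
    obtain ⟨i, j, hij⟩ := (hS ε).1 h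
    have hmem : (zt ^ i * Pt ^ j)⁻¹ * ε ∈ N := by
      rw [← QuotientGroup.eq]
      simpa [π] using hij.symm
    have hfst : T.z ^ i * T.P ^ j ∈ T.U := by
      have h3 := T.U.inv_mem hmem.1
      have h4 : CocycleExt.proj β (zt ^ i * Pt ^ j) = T.z ^ i * T.P ^ j := by
        rw [map_mul, map_zpow, map_zpow]; rfl
      rw [← h4]
      simpa [ε] using h3
    rw [T.mem_U, T.v_zPow, T.lam_zPow] at hfst
    obtain ⟨rfl, hi⟩ := hfst
    obtain ⟨k, rfl⟩ := (ZMod.intCast_zmod_eq_zero_iff_dvd _ _).1 hi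
    rw [zpow_mul, zpow_natCast, hzn] at hij
    apply hε
    rw [← QuotientGroup.eq_one_iff]
    simpa [π] using hij
  have hSsurj : ∀ g, (⟨g, 0⟩ : CocycleExt β) ∈ S ∨ (⟨g, 0⟩ : CocycleExt β) * ε ∈ S := by
    intro g
    obtain ⟨i, j, u, hu, rfl⟩ := T.exists_eq g
    have hx : zt ^ i * Pt ^ j * ⟨u, 0⟩ ∈ S := by
      refine S.mul_mem ((hS _).2 ⟨i, j, by simp⟩) (hNS _ ⟨hu, rfl⟩)
    have h4 : (zt ^ i * Pt ^ j * ⟨u, 0⟩ : CocycleExt β).fst = T.z ^ i * T.P ^ j * u := by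
      change CocycleExt.proj β (zt ^ i * Pt ^ j * ⟨u, 0⟩) = _
      rw [map_mul, map_mul, map_zpow, map_zpow]; rfl
    rcases hmk _ _ h4 with h | h
    · exact Or.inl (h ▸ hx)
    · exact Or.inr (h ▸ hx)
  have hSuniq : ∀ x y : CocycleExt β, x ∈ S → y ∈ S → x.fst = y.fst → x = y := by
    intro x y hx hy hxy
    rcases hmk _ x hxy with h | h <;> rcases hmk _ y rfl with h' | h'
    · rw [h, ← h']
    · refine absurd ?_ hεS
      have : ε = x⁻¹ * y := by rw [h', ← h]; group
      exact this ▸ S.mul_mem (S.inv_mem hx) hy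
    · refine absurd ?_ hεS
      have : ε = y⁻¹ * x := by rw [h, ← h']; group
      exact this ▸ S.mul_mem (S.inv_mem hy) hx
    · rw [h, ← h']
  have hex : ∀ g, ∃ a : ZMod 2, (⟨g, a⟩ : CocycleExt β) ∈ S := by
    intro g
    rcases hSsurj g with h | h
    · exact ⟨_, h⟩
    · refine ⟨1, ?_⟩
      convert h using 1
      ext
      · simp [ε]
      · simp [ε, hr]
  choose c hc using hex
  have hcmul : ∀ g h, c (g * h) = c g + c h + β.1 (g, h) := by
    intro g h
    exact congrArg CocycleExt.snd (hSuniq _ _ (hc (g * h)) (S.mul_mem (hc g) (hc h)) rfl)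
  have hcU : ∀ u ∈ T.U, c u = 0 := fun u hu =>
    congrArg CocycleExt.snd (hSuniq _ ⟨u, 0⟩ (hc u) (hNS _ ⟨hu, rfl⟩) rfl)
  refine ⟨c, ?_, fun g h => ?_⟩
  · rw [continuous_iff_continuousAt]
    intro g
    -- As c vanishes on the open subgroup U, near g it is determined by β and c g.
    have h3 : c =ᶠ[𝓝 g] fun x => c g + β.1 (g, g⁻¹ * x) := by
      have : (fun x => g⁻¹ * x) ⁻¹' (T.U : Set G) ∈ 𝓝 g :=
        (continuous_const_mul g⁻¹).continuousAt (by
          simpa using T.odd_U.isOpen.mem_nhds T.U.one_mem)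
      filter_upwards [this] with x hx
      have h4 := hcmul g (g⁻¹ * x)
      rwa [mul_inv_cancel_left, hcU _ hx, add_zero] at h4
    have h5 : Continuous fun x => c g + β.1 (g, g⁻¹ * x) := by
      have := β.2.1
      fun_prop
    exact h5.continuousAt.congr h3.symm
  · have h2 : (2 : ZMod 2) = 0 := rfl
    rw [hcmul]
    have : ∀ a b d : ZMod 2, d = b - (a + b + d) + a := by decide
    exact this _ _ _

/-- The averaging cochain, extended by zero off the clopen subgroup U, makes β zero on U × U after
subtracting its coboundary, which neither invariant sees. -/
theorem mem_B2_of_comm_of_defect [T2Space G] (β : Z2 G (ZMod 2))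
    (hcomm : T.comm _ T.z β.1 = 0) (hdef : T.defect _ β.1 = 0) :
    β.1 ∈ B2 G (ZMod 2) := by
  classical
  obtain ⟨c, hc, hβ⟩ := T.odd_U.exists_coboundary β
  let c' : G → ZMod 2 := fun g => if g ∈ T.U then c g else 0
  have hc' : Continuous c' := by
    have hcl : IsClopen (T.U : Set G) := ⟨T.U.isClosed_of_isOpen T.odd_U.isOpen, T.odd_U.isOpen⟩
    refine continuous_if (fun a ha => ?_) hc.continuousOn continuousOn_const
    have : a ∈ frontier (T.U : Set G) := ha
    simp [hcl.frontier_eq] at this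
  let d : G × G → ZMod 2 := fun x => c' x.2 - c' (x.1 * x.2) + c' x.1
  have hd : d ∈ B2 G (ZMod 2) := ⟨c', hc', fun _ _ => rfl⟩
  have hdZ : d ∈ Z2 G (ZMod 2) := ⟨by fun_prop, fun g h k => by
    simp only [d, mul_assoc]; abel⟩
  have key := T.mem_B2_of_normalised (β - ⟨d, hdZ⟩) ?_ ?_ ?_
  · have := (B2 G (ZMod 2)).add_mem key hd
    simpa using this
  · intro u hu w hw
    have : β.1 (u, w) = d (u, w) := by
      simp [d, c', hu, hw, T.U.mul_mem hu hw, hβ u hu w hw]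
    simp [this]
  · simp only [AddSubgroup.coe_sub, map_sub, hcomm]
    rw [T.comm_coboundary (c := c') (fun _ _ => rfl), sub_zero]
  · have h2 : (2 : ZMod 2) = 0 := rfl
    obtain ⟨m, hm⟩ := T.odd_q
    have h3 : T.defect _ d = 0 := by
      rw [T.defect_coboundary (c := c') (fun _ _ => rfl), hm]
      simp [h2]
    rw [AddSubgroup.coe_sub, map_sub, hdef, h3, sub_zero]

end TameGroup

end ContCoh

namespace ContCoh

open Topology Filter

/-! ### Continuous square roots -/

/-- A square root on `ℂˣ`, continuous on the slit plane. -/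
noncomputable def unitsSqrt (w : ℂˣ) : ℂˣ :=
  Units.mk0 (Complex.exp (Complex.log w / 2)) (Complex.exp_ne_zero _)

theorem unitsSqrt_sq (w : ℂˣ) : unitsSqrt w ^ 2 = w := by
  ext
  rw [Units.val_pow_eq_pow_val, unitsSqrt, Units.val_mk0, ← Complex.exp_nat_mul]
  push_cast
  rw [mul_div_cancel₀ _ two_ne_zero, Complex.exp_log w.ne_zero]

theorem continuousAt_unitsSqrt {w : ℂˣ} (hw : (w : ℂ) ∈ Complex.slitPlane) :
    ContinuousAt unitsSqrt w := by
  rw [Units.isEmbedding_val₀.continuousAt_iff]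
  change ContinuousAt (fun w : ℂˣ => Complex.exp (Complex.log w / 2)) w
  have : ContinuousAt (fun w : ℂˣ => Complex.log w) w :=
    (continuousAt_clog hw).comp Units.continuous_val.continuousAt
  exact Complex.continuous_exp.continuousAt.comp (this.div_const 2)

/-- On a small coset of an open subgroup, f divided by its value at a base point stays in the slit
plane, where the principal square root is continuous. Such cosets are open and partition G, so the
local roots need no compatibility. -/
theorem IsCompactOdd.exists_continuous_sqrt {G : Type*} [Group G] [TopologicalSpace G]
    [IsTopologicalGroup G] {U : Subgroup G} (hU : IsCompactOdd U) (f : G → ℂˣ)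
    (hf : Continuous f) : ∃ s : G → ℂˣ, Continuous s ∧ ∀ g, s g ^ 2 = f g := by
  have hloc : ∀ g : G, ∃ V : Subgroup G, IsOpen (V : Set G) ∧ V ≤ U ∧ ∀ u ∈ U, ∀ w ∈ V,
      ((f (g * u) / f (g * u * w) : ℂˣ) : ℂ) ∈ Complex.slitPlane := by
    intro g
    have hcont : Continuous fun p : G × G => ((f (g * p.1) / f (g * p.1 * p.2) : ℂˣ) : ℂ) :=
      Units.continuous_val.comp (by fun_prop)
    obtain ⟨W, W', -, hW', hUW, h1W', hprod⟩ := generalized_tube_lemma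
      hU.isCompact (isCompact_singleton (x := (1 : G)))
      (Complex.isOpen_slitPlane.preimage hcont) (by
        rintro ⟨a, x⟩ ⟨-, rfl : x = 1⟩
        simp)
    obtain ⟨V, -, hV, hVU, hVW, -⟩ := hU.exists_subgroup W' (hW'.mem_nhds (h1W' rfl))
    refine ⟨V, hV, hVU, fun u hu w hw => ?_⟩
    have : (u, w) ∈ W ×ˢ W' := ⟨hUW hu, hVW hw⟩
    exact hprod this
  choose V hVo hVU hVs using hloc
  -- The subgroup V is uniform only over one coset of U, by compactness. Hence two stages: a
  -- representative modulo U selects V, then a representative modulo that V.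
  let base : G → G := fun x => (QuotientGroup.mk x : G ⧸ U).out
  let rep : G → G := fun x => (QuotientGroup.mk x : G ⧸ V (base x)).out
  have hbase : ∀ x, ∃ u ∈ U, x = base x * u := fun x => by
    obtain ⟨u, hu⟩ := QuotientGroup.mk_out_eq_mul U x
    exact ⟨u⁻¹, U.inv_mem u.2, by simp [base, hu]⟩
  have hrep : ∀ x, ∃ w ∈ V (base x), rep x = x * w := fun x => by
    obtain ⟨u, hu⟩ := QuotientGroup.mk_out_eq_mul (V (base x)) x
    exact ⟨u, u.2, hu⟩
  have hslit : ∀ x, ((f x / f (rep x) : ℂˣ) : ℂ) ∈ Complex.slitPlane := fun x => by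
    obtain ⟨u, hu, hx⟩ := hbase x
    obtain ⟨w, hw, hx'⟩ := hrep x
    have := hVs (base x) u hu w hw
    rwa [← hx, ← hx'] at this
  refine ⟨fun x => unitsSqrt (f (rep x)) * unitsSqrt (f x / f (rep x)), ?_, fun x => ?_⟩
  · rw [continuous_iff_continuousAt]
    intro x
    have hev : ∀ᶠ x' in 𝓝 x, rep x' = rep x := by
      have : (fun y => x⁻¹ * y) ⁻¹' (V (base x) : Set G) ∈ 𝓝 x :=
        (continuous_const_mul x⁻¹).continuousAt (by
          simpa using (hVo (base x)).mem_nhds (one_mem (V (base x))))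
      filter_upwards [this] with x' hx'
      have h1 : base x' = base x := by
        have : (QuotientGroup.mk x : G ⧸ U) = QuotientGroup.mk x' :=
          QuotientGroup.eq.2 (hVU _ hx')
        simp only [base, this]
      have h2 : (QuotientGroup.mk x : G ⧸ V (base x)) = QuotientGroup.mk x' :=
        QuotientGroup.eq.2 hx'
      simp only [rep]
      rw [h1, h2]
    have h3 : ContinuousAt (fun y => unitsSqrt (f (rep x)) * unitsSqrt (f y / f (rep x))) x := by
      refine continuousAt_const.mul ?_
      refine ContinuousAt.comp (g := unitsSqrt) (continuousAt_unitsSqrt (hslit x)) ?_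
      fun_prop
    refine h3.congr ?_
    filter_upwards [hev] with x' hx'
    rw [hx']
  · rw [mul_pow, unitsSqrt_sq, unitsSqrt_sq, mul_div_cancel]

/-! ### The connecting map -/

theorem signHom_one : signHom 1 = Additive.ofMul (-1 : ℂˣ) := by
  change ZMod.lift 2 _ 1 = _
  have := ZMod.lift_coe 2 (A := Additive ℂˣ)
    ⟨zmultiplesHom (Additive ℂˣ) (Additive.ofMul (-1)), by
      rw [zmultiplesHom_apply, ← ofMul_zpow]; norm_num⟩ 1
  rw [Int.cast_one] at this
  rw [this]
  simp

theorem signHom_injective : Function.Injective signHom := by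
  rw [injective_iff_map_eq_zero]
  intro a
  have : ∀ a : ZMod 2, a = 0 ∨ a = 1 := by decide
  rcases this a with rfl | rfl
  · simp
  · rw [signHom_one]
    intro h
    have h2 : (-1 : ℂˣ) = 1 := h
    have h3 := congrArg Units.val h2
    norm_num at h3

theorem exists_signHom_eq {a : Additive ℂˣ} (h : 2 • a = 0) : ∃ b, signHom b = a := by
  have h1 : (Additive.toMul a) ^ 2 = 1 := h
  have h2 : ((Additive.toMul a : ℂˣ) : ℂ) ^ 2 = 1 := by
    rw [← Units.val_pow_eq_pow_val, h1, Units.val_one]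
  rcases sq_eq_one_iff.1 h2 with h3 | h3
  · exact ⟨0, by rw [map_zero]; exact (congrArg Additive.ofMul (Units.ext h3)).symm⟩
  · exact ⟨1, by rw [signHom_one]; exact (congrArg Additive.ofMul (Units.ext h3)).symm⟩

theorem two_nsmul_signHom (b : ZMod 2) : 2 • signHom b = 0 := by
  rw [← map_nsmul, two_nsmul, CharTwo.add_self_eq_zero, map_zero]

instance : T2Space (Additive ℂˣ) := inferInstanceAs (T2Space ℂˣ)

section Lift

variable {A : Type*} [AddCommGroup A] [TopologicalSpace A] [T2Space A] {φ : ZMod 2 →ₜ+ A}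

theorem exists_continuous_lift (hφ : Function.Injective φ) {X : Type*} [TopologicalSpace X]
    {f : X → A} (hf : Continuous f) (hr : ∀ x, ∃ b, φ b = f x) :
    ∃ b : X → ZMod 2, Continuous b ∧ ∀ x, φ (b x) = f x := by
  choose b hb using hr
  refine ⟨b, ?_, hb⟩
  rw [(φ.continuous.isClosedEmbedding hφ).isInducing.continuous_iff]
  convert hf
  exact funext hb

theorem exists_Z2_lift {G : Type*} [Group G] [TopologicalSpace G] (hφ : Function.Injective φ)
    {f : G × G → A} (hf : Continuous f) (hr : ∀ x, ∃ b, φ b = f x)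
    (hcoc : ∀ g h k, f (h, k) + f (g, h * k) = f (g * h, k) + f (g, h)) :
    ∃ β : Z2 G (ZMod 2), ∀ x, φ (β.1 x) = f x := by
  obtain ⟨b, hb, hbf⟩ := exists_continuous_lift hφ hf hr
  refine ⟨⟨b, hb, fun g h k => hφ ?_⟩, hbf⟩
  simp only [map_add, hbf, hcoc]

end Lift

section Connecting

variable {G : Type*} [Group G] [TopologicalSpace G]

theorem mem_torsionBy_two {B : Type*} [AddCommGroup B] {x : B} :
    x ∈ AddSubgroup.torsionBy B 2 ↔ 2 • x = 0 := by
  exact AddSubgroup.torsionBy.nsmul_iff (n := 2)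

theorem two_nsmul_eq_zero (c : H2 G (ZMod 2)) : 2 • c = 0 := by
  obtain ⟨β⟩ := c
  change ((2 • β : Z2 G (ZMod 2)) : H2 G (ZMod 2)) = 0
  have : 2 • β = 0 := Subtype.ext (funext fun x => by
    change 2 • β.1 x = 0
    rw [two_nsmul, CharTwo.add_self_eq_zero])
  rw [this]
  rfl

theorem mk_eq_mk_iff {A : Type*} [AddCommGroup A] [TopologicalSpace A] [IsTopologicalAddGroup A]
    {β β' : Z2 G A} : (QuotientAddGroup.mk β : H2 G A) = QuotientAddGroup.mk β' ↔
      β'.1 - β.1 ∈ B2 G A := by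
  rw [QuotientAddGroup.eq, AddSubgroup.mem_addSubgroupOf]
  simp [neg_add_eq_sub]

theorem mk_eq_zero_iff {A : Type*} [AddCommGroup A] [TopologicalSpace A] [IsTopologicalAddGroup A]
    {β : Z2 G A} : (QuotientAddGroup.mk β : H2 G A) = 0 ↔ β.1 ∈ B2 G A := by
  rw [QuotientAddGroup.eq_zero_iff, AddSubgroup.mem_addSubgroupOf]

theorem IsConnectingImage.add {χ χ' : H1 G (Additive ℂˣ)} {c c' : H2 G (ZMod 2)}
    (h : IsConnectingImage χ c) (h' : IsConnectingImage χ' c') :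
    IsConnectingImage (χ + χ') (c + c') := by
  obtain ⟨s, hs, hsχ, β, hβ, rfl⟩ := h
  obtain ⟨s', hs', hsχ', β', hβ', rfl⟩ := h'
  refine ⟨s + s', hs.add hs', fun g => ?_, β + β', fun g h => ?_, rfl⟩
  · simp [hsχ, hsχ', nsmul_add]
  · have : signHom ((β + β').1 (g, h)) = signHom (β.1 (g, h)) + signHom (β'.1 (g, h)) := by
      rw [← map_add]; rfl
    rw [this, hβ, hβ']
    simp only [Pi.add_apply]
    abel

/-- If c bounds β, correcting the square root s of χ by the sign c gives a character whose square is
χ. Conversely, if χ = 2ψ, then s - ψ is a sign and bounds β. -/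
theorem IsConnectingImage.eq_zero_iff {χ : H1 G (Additive ℂˣ)} {c : H2 G (ZMod 2)}
    (h : IsConnectingImage χ c) : c = 0 ↔ ∃ ψ : H1 G (Additive ℂˣ), 2 • ψ = χ := by
  obtain ⟨s, hs, hsχ, β, hβ, rfl⟩ := h
  rw [mk_eq_zero_iff]
  constructor
  · rintro ⟨c, hc, hβc⟩
    refine ⟨⟨fun g => s g - signHom (c g), hs.sub (signHom.continuous.comp hc), fun g h => ?_⟩, ?_⟩
    · have := hβ g h
      rw [hβc, map_add, map_sub] at this
      have h2 : s (g * h) = s h + s g - (signHom (c h) - signHom (c (g * h)) + signHom (c g)) := by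
        rw [this]; abel
      simp only [h2]; abel
    · ext g
      have : 2 • (s g - signHom (c g)) = χ.1 g := by
        rw [nsmul_sub, two_nsmul_signHom, sub_zero, hsχ]
      exact congrArg (fun a : Additive ℂˣ => ((Additive.toMul a : ℂˣ) : ℂ)) this
  · rintro ⟨ψ, rfl⟩
    obtain ⟨b, hb, hbs⟩ := exists_continuous_lift signHom_injective
      (f := fun g => s g - ψ.1 g) (hs.sub ψ.2.1) (fun g => exists_signHom_eq (by
        rw [nsmul_sub, hsχ]; exact sub_self _))
    refine ⟨b, hb, fun g h => signHom_injective ?_⟩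
    rw [map_add, map_sub, hbs, hbs, hbs, hβ, ψ.2.2]
    abel

theorem IsConnectingImage.zero : IsConnectingImage (0 : H1 G (Additive ℂˣ)) 0 :=
  ⟨0, continuous_const, fun _ => by simp, 0, fun _ _ => by simp, rfl⟩

theorem IsConnectingImage.neg {χ : H1 G (Additive ℂˣ)} {c : H2 G (ZMod 2)}
    (h : IsConnectingImage χ c) : IsConnectingImage (-χ) (-c) := by
  obtain ⟨s, hs, hsχ, β, hβ, rfl⟩ := h
  refine ⟨-s, hs.neg, fun g => ?_, -β, fun g h => ?_, rfl⟩
  · simp [hsχ]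
  · have : signHom ((-β).1 (g, h)) = -signHom (β.1 (g, h)) := by
      rw [← map_neg]; rfl
    rw [this, hβ]
    simp only [Pi.neg_apply]
    abel

theorem IsConnectingImage.unique {χ : H1 G (Additive ℂˣ)} {c c' : H2 G (ZMod 2)}
    (h : IsConnectingImage χ c) (h' : IsConnectingImage χ c') : c = c' := by
  have := h.add h'.neg
  rw [add_neg_cancel, ← sub_eq_add_neg] at this
  exact sub_eq_zero.1 (this.eq_zero_iff.2 ⟨0, by simp⟩)

/-- If β is the coboundary of s in ℂˣ, then 2β = 0 says that 2s is a character, and s is a square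
root of it. -/
theorem map_signHom_mk_eq_zero_iff {β : Z2 G (ZMod 2)} :
    H2.map G signHom (QuotientAddGroup.mk β) = 0 ↔
      ∃ χ : H1 G (Additive ℂˣ), IsConnectingImage χ (QuotientAddGroup.mk β) := by
  have hmk : H2.map G signHom (QuotientAddGroup.mk β) = QuotientAddGroup.mk (Z2.map G signHom β) :=
    rfl
  rw [hmk, mk_eq_zero_iff]
  constructor
  · rintro ⟨s, hs, hβ⟩
    refine ⟨⟨fun g => 2 • s g, hs.const_smul 2, fun g h => ?_⟩, s, hs, fun _ => rfl, β, hβ, rfl⟩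
    have h2 : 2 • (s h - s (g * h) + s g) = 0 := by
      rw [← hβ]; exact two_nsmul_signHom _
    rw [nsmul_add, nsmul_sub] at h2
    have h3 : 2 • s (g * h) = 2 • s h + 2 • s g - (2 • s h - 2 • s (g * h) + 2 • s g) := by abel
    change 2 • s (g * h) = 2 • s g + 2 • s h
    rw [h3, h2]; abel
  · rintro ⟨χ, s, hs, -, β', hβ', h⟩
    obtain ⟨c, hc, hcβ⟩ := mk_eq_mk_iff.1 h
    refine ⟨fun g => s g + signHom (c g), hs.add (signHom.continuous.comp hc), fun g h => ?_⟩
    have h1 : β.1 (g, h) = β'.1 (g, h) + (β.1 - β'.1) (g, h) := by simp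
    change signHom (β.1 (g, h)) = _
    rw [h1, map_add, hβ', hcβ, map_add, map_sub]
    have : ∀ {B : Type} [AddCommGroup B] (a b c a' b' c' : B),
        a - b + c + (a' - b' + c') = a + a' - (b + b') + (c + c') := by
      intros; abel
    exact this _ _ _ _ _ _

variable [ContinuousMul G]
  (hsqrt : ∀ f : G → ℂˣ, Continuous f → ∃ s : G → ℂˣ, Continuous s ∧ ∀ g, s g ^ 2 = f g)

include hsqrt

theorem exists_isConnectingImage (χ : H1 G (Additive ℂˣ)) : ∃ c, IsConnectingImage χ c := by
  obtain ⟨s, hs, hsχ⟩ := hsqrt (fun g => Additive.toMul (χ.1 g)) χ.2.1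
  let s' : G → Additive ℂˣ := fun g => Additive.ofMul (s g)
  have hs' : Continuous s' := hs
  have hsχ' : ∀ g, 2 • s' g = χ.1 g := fun g => congrArg Additive.ofMul (hsχ g)
  have hds : Continuous fun x : G × G => s' x.2 - s' (x.1 * x.2) + s' x.1 := by fun_prop
  have hr : ∀ x : G × G, ∃ b, signHom b = s' x.2 - s' (x.1 * x.2) + s' x.1 := by
    rintro ⟨g, h⟩
    refine exists_signHom_eq ?_
    simp only [nsmul_add, nsmul_sub, hsχ', χ.2.2]
    abel
  obtain ⟨β, hβ⟩ := exists_Z2_lift signHom_injective hds hr (fun g h k => by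
    simp only [mul_assoc]
    abel)
  exact ⟨_, s', hs', hsχ', β, fun g h => hβ (g, h), rfl⟩

theorem exists_connectingHom :
    ∃ δ : H1 G (Additive ℂˣ) ⧸ (nsmulAddMonoidHom 2 :
          H1 G (Additive ℂˣ) →+ H1 G (Additive ℂˣ)).range →+ H2 G (ZMod 2),
      (∀ χ : H1 G (Additive ℂˣ), IsConnectingImage χ (δ (QuotientAddGroup.mk χ))) ∧
      Function.Injective δ ∧
      Function.Exact δ (H2.map G signHom) ∧
      (H2.map G signHom).range = AddSubgroup.torsionBy (H2 G (Additive ℂˣ)) 2 := by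
  choose d hd using exists_isConnectingImage hsqrt
  let d' : H1 G (Additive ℂˣ) →+ H2 G (ZMod 2) :=
    { toFun := d
      map_zero' := (hd 0).unique .zero
      map_add' := fun χ χ' => (hd _).unique ((hd χ).add (hd χ')) }
  have hker : d'.ker = (nsmulAddMonoidHom 2 :
          H1 G (Additive ℂˣ) →+ H1 G (Additive ℂˣ)).range := by
    ext χ
    exact (hd χ).eq_zero_iff
  refine ⟨QuotientAddGroup.lift _ d' hker.ge, hd, ?_, ?_, ?_⟩
  · rw [injective_iff_map_eq_zero]
    rintro ⟨χ⟩ h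
    exact (QuotientAddGroup.eq_zero_iff χ).2 (hker.le h)
  · rintro ⟨β⟩
    refine map_signHom_mk_eq_zero_iff.trans ?_
    constructor
    · rintro ⟨χ, hχ⟩
      exact ⟨QuotientAddGroup.mk χ, (hd χ).unique hχ⟩
    · rintro ⟨⟨χ⟩, hχ⟩
      exact ⟨χ, (show d χ = QuotientAddGroup.mk β from hχ) ▸ hd χ⟩
  · ext x
    constructor
    · rintro ⟨⟨β⟩, rfl⟩
      rw [mem_torsionBy_two]
      refine (map_nsmul (H2.map G signHom) 2 (QuotientAddGroup.mk β)).symm.trans ?_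
      rw [two_nsmul_eq_zero, map_zero]
    · obtain ⟨β⟩ := x
      intro h
      have h1 : 2 • (QuotientAddGroup.mk β : H2 G (Additive ℂˣ)) = 0 := mem_torsionBy_two.1 h
      rw [← QuotientAddGroup.mk_nsmul, mk_eq_zero_iff] at h1
      obtain ⟨c, hc, hβc⟩ := h1
      -- With 2β the coboundary of c and 2s = c, the difference of β and the coboundary of s is
      -- killed by 2, so it takes values in ±1.
      obtain ⟨s, hs, hsc⟩ := hsqrt (fun g => Additive.toMul (c g)) hc
      let s' : G → Additive ℂˣ := fun g => Additive.ofMul (s g)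
      have hs' : Continuous s' := hs
      have hsc' : ∀ g, 2 • s' g = c g := fun g => congrArg Additive.ofMul (hsc g)
      have hds : Continuous fun x : G × G => s' x.2 - s' (x.1 * x.2) + s' x.1 := by fun_prop
      have hr : ∀ x : G × G, ∃ b, signHom b = β.1 x - (s' x.2 - s' (x.1 * x.2) + s' x.1) := by
        rintro ⟨g, h⟩
        refine exists_signHom_eq ?_
        have h2 : 2 • β.1 (g, h) = c h - c (g * h) + c g := hβc g h
        simp only [nsmul_add, nsmul_sub, hsc', h2]
        abel
      obtain ⟨β', hβ'⟩ := exists_Z2_lift signHom_injective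
          (f := fun x => β.1 x - (s' x.2 - s' (x.1 * x.2) + s' x.1)) (β.2.1.sub hds) hr
          (fun g h k => by
        have h2 : β.1 (g, h * k) = β.1 (g * h, k) + β.1 (g, h) - β.1 (h, k) := by
          rw [← β.2.2]; abel
        simp only [mul_assoc, h2]
        abel)
      refine ⟨QuotientAddGroup.mk β', ?_⟩
      refine mk_eq_mk_iff.2 ⟨s', hs', fun g h => ?_⟩
      change β.1 (g, h) - signHom (β'.1 (g, h)) = _
      rw [hβ', sub_sub_cancel]

end Connecting

end ContCoh

namespace ContCoh

open Topology Filter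

namespace TameGroup

variable {G : Type*} [Group G] [TopologicalSpace G] (T : TameGroup G)

/-! ### The tame character -/

/-- A primitive root of unity of order `q - 1`. -/
noncomputable def root : Additive ℂˣ :=
  Additive.ofMul (Units.mk0 (Complex.exp (2 * Real.pi * Complex.I / (T.q - 1 : ℕ)))
    (Complex.exp_ne_zero _))

theorem exists_q_eq : ∃ k : ℕ, 0 < k ∧ T.q = 2 * k + 1 := by
  obtain ⟨k, hk⟩ := T.odd_q
  exact ⟨k, by have := T.one_lt_q; omega, hk⟩

theorem nsmul_root {k : ℕ} (hk : T.q = 2 * k + 1) : k • T.root = signHom 1 := by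
  have hk0 : (k : ℂ) ≠ 0 := by
    have := T.one_lt_q
    exact_mod_cast (by omega : k ≠ 0)
  rw [signHom_one]
  change Additive.ofMul (_ ^ k) = _
  congr 1
  ext
  change Complex.exp (2 * Real.pi * Complex.I / (T.q - 1 : ℕ)) ^ k = _
  rw [← Complex.exp_nat_mul, hk]
  have : (k : ℂ) * (2 * Real.pi * Complex.I / ((2 * k + 1 - 1 : ℕ) : ℂ)) = Real.pi * Complex.I := by
    rw [Nat.add_sub_cancel]
    push_cast
    field_simp
  rw [this, Complex.exp_pi_mul_I]
  simp

theorem q_nsmul_root : T.q • T.root = T.root := by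
  obtain ⟨k, -, hk⟩ := T.exists_q_eq
  have h := T.nsmul_root hk
  conv_lhs => rw [hk]
  rw [succ_nsmul, mul_comm, mul_nsmul, h, two_nsmul_signHom, zero_add]

theorem n_nsmul_root : T.n • T.root = 0 := by
  have h : (T.n + 1) • T.root = T.root := by
    rw [← T.sq_q, sq, mul_nsmul, T.q_nsmul_root, T.q_nsmul_root]
  rwa [succ_nsmul, add_eq_right] at h

/-- The additive character of `ℤ/n` that sends `1` to the root of unity of order `q - 1`. -/
noncomputable def rootHom : ZMod T.n →+ Additive ℂˣ :=
  ZMod.lift T.n ⟨zmultiplesHom (Additive ℂˣ) T.root, by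
    rw [zmultiplesHom_apply, natCast_zsmul, T.n_nsmul_root]⟩

theorem rootHom_intCast (k : ℤ) : T.rootHom k = k • T.root := by
  simp [rootHom]

/-- The root is fixed by multiplication by q, being killed by q - 1. This turns the crossed
homomorphism `lam` into a genuine character. -/
theorem rootHom_qu_zpow (k : ℤ) : ∀ x, T.rootHom ((T.qu ^ k : (ZMod T.n)ˣ) * x) = T.rootHom x := by
  have h1 : ∀ x, T.rootHom (T.qu * x) = T.rootHom x := by
    intro x
    obtain ⟨i, rfl⟩ := ZMod.intCast_surjective x
    rw [T.qu_val, ← nsmul_eq_mul, map_nsmul, rootHom_intCast, ← natCast_zsmul, smul_comm,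
      natCast_zsmul, T.q_nsmul_root]
  induction k using Int.induction_on with
  | zero => simp
  | succ k ih => intro x; rw [zpow_add_one, Units.val_mul, mul_assoc, ih, h1]
  | pred k ih =>
    intro x
    rw [zpow_sub_one, Units.val_mul, mul_assoc, ih, ← h1, ← mul_assoc, ← Units.val_mul,
      mul_inv_cancel, Units.val_one, one_mul]

/-- A connecting image becomes a coboundary in ℂˣ, where `comm` vanishes, and `signHom` is
injective. -/
theorem comm_eq_zero_of_isConnectingImage {χ : H1 G (Additive ℂˣ)} {β : Z2 G (ZMod 2)}
    (h : IsConnectingImage χ (QuotientAddGroup.mk β)) (g : G) : T.comm _ g β.1 = 0 := by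
  obtain ⟨s, -, hβ⟩ := mk_eq_zero_iff.1 (map_signHom_mk_eq_zero_iff.2 ⟨χ, h⟩)
  apply signHom_injective
  have := T.comm_coboundary hβ g
  rw [comm_apply] at this ⊢
  rw [map_sub, map_zero]
  exact this

theorem continuous_of_mul_mem [IsTopologicalGroup G] {X : Type*} [TopologicalSpace X] {f : G → X}
    (hf : ∀ g, ∀ u ∈ T.U, f (g * u) = f g) : Continuous f := by
  rw [continuous_iff_continuousAt]
  intro g
  have : (fun x => g⁻¹ * x) ⁻¹' (T.U : Set G) ∈ 𝓝 g :=
    (continuous_const_mul g⁻¹).continuousAt (by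
      simpa using T.odd_U.isOpen.mem_nhds T.U.one_mem)
  refine continuousAt_const.congr (f := fun _ => f g) ?_
  filter_upwards [this] with x hx
  rw [← hf g _ hx, mul_inv_cancel_left]

variable [IsTopologicalGroup G]

/-- The tamely ramified character of order `q - 1`. -/
noncomputable def tameChar : H1 G (Additive ℂˣ) :=
  ⟨fun g => T.rootHom (T.lam g),
    T.continuous_of_mul_mem fun g u hu => by rw [T.lam_mul_mem g hu],
    fun g h => by simp only [T.lam_mul, map_add, T.rootHom_qu_zpow]⟩

/-- With s a square root of the tame character χ and q = 2k + 1, the defect is s(z) - q s(z) - 2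
s(y) = -k χ(z) - χ(y). Here χ(y) is trivial and k χ(z) is the sign -1. -/
theorem exists_tameCocycle [T2Space G] : ∃ β : Z2 G (ZMod 2),
    IsConnectingImage T.tameChar (QuotientAddGroup.mk β) ∧ T.comm _ T.z β.1 = 0 ∧
      T.defect _ β.1 = 1 := by
  obtain ⟨c, hc⟩ := exists_isConnectingImage T.odd_U.exists_continuous_sqrt T.tameChar
  obtain ⟨s, hs, hsχ, β, hβ, rfl⟩ := hc
  refine ⟨β, ⟨s, hs, hsχ, β, hβ, rfl⟩,
    T.comm_eq_zero_of_isConnectingImage ⟨s, hs, hsχ, β, hβ, rfl⟩ T.z, signHom_injective ?_⟩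
  have h := T.defect_coboundary (f := fun x => signHom (β.1 x)) hβ
  obtain ⟨k, -, hk⟩ := T.exists_q_eq
  have hy : T.tameChar.1 T.y = 0 := by
    change T.rootHom (T.lam T.y) = 0
    rw [((T.mem_U _).1 T.y_mem).2, map_zero]
  have hz : T.tameChar.1 T.z = T.root := by
    change T.rootHom (T.lam T.z) = _
    rw [T.lam_z]
    simpa using T.rootHom_intCast 1
  rw [hsχ, hy, sub_zero, hk, succ_nsmul, mul_nsmul, hsχ, hz, T.nsmul_root hk] at h
  have h2 : signHom (T.defect _ β.1) = T.defect _ (fun x => signHom (β.1 x)) := by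
    have h3 := map_wordSum signHom.toAddMonoidHom β.1
    rw [defect_apply, defect_apply, map_sub]
    exact congrArg₂ _ (h3 _) (h3 _)
  rw [h2, h, ← sub_sub, sub_right_comm, sub_self, zero_sub, neg_eq_iff_add_eq_zero, ← two_nsmul,
    two_nsmul_signHom]

/-! ### The cocycle that pairs the uniformizer with the units -/

/-- The inclusion of `ℤ/2` in `ℤ/2n`. -/
def halfHom (n : ℕ) : ZMod 2 →ₜ+ ZMod (2 * n) where
  toAddMonoidHom := ZMod.lift 2 ⟨zmultiplesHom (ZMod (2 * n)) (n : ZMod (2 * n)), by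
    rw [zmultiplesHom_apply]
    have := ZMod.natCast_self (2 * n)
    push_cast at this
    simpa using this⟩
  continuous_toFun := continuous_of_discreteTopology

theorem halfHom_intCast (n : ℕ) (k : ℤ) : halfHom n (k : ZMod 2) = (k * n : ℤ) := by
  have : halfHom n (k : ZMod 2) = ZMod.lift 2 _ (k : ZMod 2) := rfl
  rw [this, ZMod.lift_coe]
  simp

theorem halfHom_injective {n : ℕ} (hn : n ≠ 0) : Function.Injective (halfHom n) := by
  rw [injective_iff_map_eq_zero]
  intro a h
  obtain ⟨k, rfl⟩ := ZMod.intCast_surjective a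
  rw [halfHom_intCast, ZMod.intCast_zmod_eq_zero_iff_dvd] at h
  rw [ZMod.intCast_zmod_eq_zero_iff_dvd]
  push_cast at h ⊢
  exact (mul_dvd_mul_iff_right (by exact_mod_cast hn)).1 h

theorem exists_halfHom_eq {n : ℕ} {x : ZMod (2 * n)}
    (hx : ZMod.castHom (dvd_mul_left n 2) (ZMod n) x = 0) : ∃ a, halfHom n a = x := by
  obtain ⟨k, rfl⟩ := ZMod.intCast_surjective x
  rw [map_intCast, ZMod.intCast_zmod_eq_zero_iff_dvd] at hx
  obtain ⟨c, rfl⟩ := hx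
  exact ⟨(c : ℤ), by rw [halfHom_intCast, mul_comm c]⟩

/-- The crossed homomorphism `lam` is lifted set-theoretically to ℤ/2n, where q is still a unit. Its
failure F to be crossed takes values in nℤ/2n, a copy of ℤ/2. The invariant is q² - 1 = n in ℤ/2n,
the image of 1. -/
theorem exists_commCocycle : ∃ β : Z2 G (ZMod 2), T.comm _ T.z β.1 = 1 := by
  have hn := T.one_lt_n
  have : NeZero T.n := ⟨by omega⟩
  let R := ZMod (2 * T.n)
  let κ : R →+* ZMod T.n := ZMod.castHom (dvd_mul_left T.n 2) (ZMod T.n)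
  -- q is odd, and q² = n + 1 is prime to n.
  have hcop : Nat.Coprime T.q (2 * T.n) := by
    refine Nat.Coprime.mul_right (Nat.coprime_two_right.2 T.odd_q) ?_
    have h1 : Nat.Coprime (T.n + 1) T.n := by simp
    rw [← T.sq_q] at h1
    exact Nat.Coprime.coprime_mul_left (k := T.q) (by rwa [sq] at h1)
  let Q : Rˣ := ZMod.unitOfCoprime T.q hcop
  have hQ : (Q : R) = T.q := ZMod.coe_unitOfCoprime _ _
  have hκQ : Units.map (κ : R →* ZMod T.n) Q = T.qu := by
    ext
    rw [Units.coe_map, T.qu_val, hQ]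
    simp
  let lift : ZMod T.n → R := fun x => (x.val : R)
  have hlift : ∀ x, κ (lift x) = x := fun x => by simp [lift, κ]
  let f : G → R := fun g => lift (T.lam g)
  let F : G × G → R := fun x => f x.1 + (Q ^ T.v x.1 : Rˣ) * f x.2 - f (x.1 * x.2)
  have hF : ∀ x, ∃ a, halfHom T.n a = F x := by
    rintro ⟨g, h⟩
    refine exists_halfHom_eq ?_
    change κ _ = 0
    have h1 : κ ((Q ^ T.v g : Rˣ) : R) = ((T.qu ^ T.v g : (ZMod T.n)ˣ) : ZMod T.n) := by
      rw [← hκQ, ← map_zpow]; rfl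
    simp only [F, map_sub, map_add, map_mul, f, hlift, T.lam_mul, h1]
    ring
  -- The odd number q acts trivially on the copy of ℤ/2, so the twisted cocycle F is a cocycle for
  -- the trivial action.
  have hQF : ∀ (k : ℤ) x, ((Q ^ k : Rˣ) : R) * F x = F x := by
    intro k x
    obtain ⟨a, ha⟩ := hF x
    have h1 : (Q : R) * F x = F x := by
      obtain ⟨m, hm⟩ := T.odd_q
      rw [← ha, hQ, ← nsmul_eq_mul, ← map_nsmul, hm, succ_nsmul, mul_nsmul', two_nsmul,
        CharTwo.add_self_eq_zero, zero_add]
    induction k using Int.induction_on with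
    | zero => simp
    | succ k ih => rw [zpow_add_one, Units.val_mul, mul_assoc, h1, ih]
    | pred k ih =>
      rw [zpow_sub_one, Units.val_mul, mul_assoc]
      have h2 : ((Q⁻¹ : Rˣ) : R) * F x = F x := by
        conv_lhs => rw [← h1]
        rw [Units.inv_mul_cancel_left]
      rw [h2, ih]
  have hfc : Continuous f := T.continuous_of_mul_mem fun g u hu => by
    simp only [f, T.lam_mul_mem g hu]
  have hvc : Continuous fun g => ((Q ^ T.v g : Rˣ) : R) := T.continuous_of_mul_mem fun g u hu => by
    simp only [T.v_mul_mem g hu]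
  have hFc : Continuous F := ((hfc.comp continuous_fst).add ((hvc.comp continuous_fst).mul
    (hfc.comp continuous_snd))).sub (hfc.comp continuous_mul)
  obtain ⟨β, hβ⟩ := exists_Z2_lift (halfHom_injective (by omega)) hFc hF (by
    intro g h k
    rw [← hQF (T.v g) (h, k)]
    simp only [F, T.v_mul, zpow_add, Units.val_mul, mul_assoc]
    ring)
  refine ⟨β, halfHom_injective (n := T.n) (by omega) ?_⟩
  have hv2 : T.v (T.P * T.P) = 2 := by rw [T.v_mul, T.v_P]; rfl
  have hl2 : T.lam (T.P * T.P) = 0 := by rw [T.lam_mul, T.lam_P]; simp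
  have hfP : f (T.P * T.P) = 0 := by simp [f, lift, hl2]
  have hfz : f T.z = 1 := by
    have : Fact (1 < T.n) := ⟨hn⟩
    simp only [f, lift, T.lam_z]
    rw [ZMod.val_one, Nat.cast_one]
  rw [comm_apply, map_sub, hβ, hβ]
  simp only [F, hv2, T.v_z, hfP, hfz, T.P_central]
  have h1 := halfHom_intCast T.n 1
  rw [Int.cast_one] at h1
  rw [h1]
  have h2 : ((Q ^ (2 : ℤ) : Rˣ) : R) = T.n + 1 := by
    rw [show (2 : ℤ) = ((2 : ℕ) : ℤ) from rfl, zpow_natCast, Units.val_pow_eq_pow_val, hQ]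
    exact_mod_cast congrArg (Nat.cast : ℕ → R) T.sq_q
  rw [h2]
  push_cast
  simp

/-! ### Computation of the cohomology -/

variable [T2Space G]

/-- The two invariants of a class in `H²(G, ℤ/2)`. -/
noncomputable def invariants : H2 G (ZMod 2) →+ ZMod 2 × ZMod 2 :=
  QuotientAddGroup.lift _
    (((T.comm (ZMod 2) T.z).prod (T.defect (ZMod 2))).comp (Z2 G (ZMod 2)).subtype) (by
      rintro ⟨f, hf⟩ ⟨c, hc, hfc⟩
      have h2 : (2 : ZMod 2) = 0 := rfl
      obtain ⟨m, hm⟩ := T.odd_q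
      refine Prod.ext (T.comm_coboundary hfc T.z) ((T.defect_coboundary hfc).trans ?_)
      rw [hm]
      simp [h2])

theorem invariants_mk (β : Z2 G (ZMod 2)) :
    T.invariants (QuotientAddGroup.mk β) = (T.comm _ T.z β.1, T.defect _ β.1) := rfl

theorem invariants_injective : Function.Injective T.invariants := by
  rw [injective_iff_map_eq_zero]
  rintro ⟨β⟩ h
  have h' : (T.comm _ T.z β.1, T.defect _ β.1) = ((0, 0) : ZMod 2 × ZMod 2) := h
  exact mk_eq_zero_iff.2 (T.mem_B2_of_comm_of_defect β (congrArg Prod.fst h') (congrArg Prod.snd h'))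

theorem invariants_surjective : Function.Surjective T.invariants := by
  obtain ⟨β, -, h1, h2⟩ := T.exists_tameCocycle
  obtain ⟨β', h3⟩ := T.exists_commCocycle
  -- The defect d of the second cocycle is unknown, but (0, 1) and (1, d) generate for either value.
  have key : ∀ d a b : ZMod 2, ∃ m m' : ℕ, m • ((0, 1) : ZMod 2 × ZMod 2) + m' • ((1, d)) = (a, b) := by
    intro d a b
    refine ⟨(b - a * d).val, a.val, ?_⟩
    revert d a b
    decide
  rintro ⟨a, b⟩
  obtain ⟨m, m', h⟩ := key (T.defect _ β'.1) a b
  refine ⟨m • QuotientAddGroup.mk β + m' • QuotientAddGroup.mk β', ?_⟩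
  rw [map_add, map_nsmul, map_nsmul, invariants_mk, invariants_mk, h1, h2, h3, h]

/-- Among classes with `comm` zero, injectivity of the invariants leaves only 0 and the tame class,
and the latter is a connecting image. -/
theorem map_signHom_eq_zero_iff (c : H2 G (ZMod 2)) :
    H2.map G signHom c = 0 ↔ (T.invariants c).1 = 0 := by
  constructor
  · obtain ⟨β⟩ := c
    intro h
    obtain ⟨χ, hχ⟩ := map_signHom_mk_eq_zero_iff.1 h
    exact T.comm_eq_zero_of_isConnectingImage hχ T.z
  · intro h
    obtain ⟨β, hβ, h1, h2⟩ := T.exists_tameCocycle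
    have h01 : ∀ a : ZMod 2, a = 0 ∨ a = 1 := by decide
    rcases h01 (T.invariants c).2 with h0 | h0
    · have : c = 0 := T.invariants_injective (by rw [map_zero]; exact Prod.ext h h0)
      rw [this, map_zero]
    · have : c = QuotientAddGroup.mk β := T.invariants_injective (by
        rw [invariants_mk, h1, h2]; exact Prod.ext h h0)
      rw [this, map_signHom_mk_eq_zero_iff]
      exact ⟨_, hβ⟩

theorem cohomology (T : TameGroup G) :
    Nonempty (H2 G (ZMod 2) ≃+ ZMod 2 × ZMod 2) ∧
    Nonempty (AddSubgroup.torsionBy (H2 G (Additive ℂˣ)) 2 ≃+ ZMod 2) ∧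
    (∃ δ : H1 G (Additive ℂˣ) ⧸ (nsmulAddMonoidHom 2 :
          H1 G (Additive ℂˣ) →+ H1 G (Additive ℂˣ)).range →+ H2 G (ZMod 2),
      (∀ χ : H1 G (Additive ℂˣ), IsConnectingImage χ (δ (QuotientAddGroup.mk χ))) ∧
      Function.Injective δ ∧
      Function.Exact δ (H2.map G signHom) ∧
      (H2.map G signHom).range = AddSubgroup.torsionBy (H2 G (Additive ℂˣ)) 2) ∧
    Nonempty (H1 G (Additive ℂˣ) ⧸ (nsmulAddMonoidHom 2 :
        H1 G (Additive ℂˣ) →+ H1 G (Additive ℂˣ)).range ≃+ ZMod 2) := by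
  obtain ⟨δ, hδ, hinj, hexact, hrange⟩ :=
    exists_connectingHom (G := G) T.odd_U.exists_continuous_sqrt
  refine ⟨⟨AddEquiv.ofBijective T.invariants ⟨T.invariants_injective, T.invariants_surjective⟩⟩,
    ?_, ⟨δ, hδ, hinj, hexact, hrange⟩, ?_⟩
  -- The 2-torsion is the image of H²(ℤ/2), that is, its quotient by the kernel of the first
  -- invariant. The second bullet identifies H¹/2H¹ with that kernel, by means of the second
  -- invariant.
  · let φ : H2 G (ZMod 2) →+ ZMod 2 := (AddMonoidHom.fst _ _).comp T.invariants
    have hφ : Function.Surjective φ := Prod.fst_surjective.comp T.invariants_surjective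
    have hker : (H2.map G signHom).ker = φ.ker := by
      ext c
      exact T.map_signHom_eq_zero_iff c
    rw [← hrange]
    exact ⟨(QuotientAddGroup.quotientKerEquivRange _).symm.trans
      ((QuotientAddGroup.quotientAddEquivOfEq hker).trans
        (QuotientAddGroup.quotientKerEquivOfSurjective φ hφ))⟩
  · let φ := ((AddMonoidHom.snd _ _).comp T.invariants).comp δ
    have h0 : ∀ x, (T.invariants (δ x)).1 = 0 := fun x =>
      (T.map_signHom_eq_zero_iff _).1 (hexact.apply_apply_eq_zero x)
    refine ⟨AddEquiv.ofBijective φ ⟨?_, ?_⟩⟩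
    · rw [injective_iff_map_eq_zero]
      intro x hx
      refine hinj (T.invariants_injective ?_)
      rw [map_zero, map_zero]
      exact Prod.ext (h0 x) hx
    · obtain ⟨β, hβ, h1, h2⟩ := T.exists_tameCocycle
      intro a
      refine ⟨a.val • QuotientAddGroup.mk T.tameChar, ?_⟩
      have h3 : φ (QuotientAddGroup.mk T.tameChar) = 1 := by
        change (T.invariants (δ _)).2 = 1
        rw [(hδ T.tameChar).unique hβ, invariants_mk, h2]
      rw [map_nsmul, h3]
      simp

/-- The class of a cocycle in `H²(G, ℂˣ)` is trivial as soon as lifts of `P ^ 2` and of some unit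
with leading coefficient a generator commute. -/
theorem map_signHom_eq_zero_of_comm (β : Z2 G (ZMod 2)) {m : G} (hv : T.v m = 0)
    (hl : T.lam m = 1) (h : β.1 (T.P * T.P, m) = β.1 (m, T.P * T.P)) :
    H2.map G signHom (QuotientAddGroup.mk β) = 0 := by
  -- As P² is central, the commutator with its lift is additive in g. It is then trivial on U, so it
  -- agrees at z and m.
  have hmul : ∀ g h, T.comm _ (g * h) β.1 = T.comm _ g β.1 + T.comm _ h β.1 := by
    intro g h
    have h1 := β.2.2 (T.P * T.P) g h
    have h2 := β.2.2 g (T.P * T.P) h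
    have h3 := β.2.2 g h (T.P * T.P)
    rw [T.P_central g] at h1
    rw [T.P_central h] at h2
    simp only [comm_apply]
    linear_combination h1 - h2 + h3
  have hU : T.z⁻¹ * m ∈ T.U := T.inv_mul_mem_U (hv.trans T.v_z.symm) (hl.trans T.lam_z.symm)
  have h0 : T.comm _ (T.z⁻¹ * m) β.1 = 0 := by
    refine T.odd_U.eq_zero_of_map_mul (f := fun g => T.comm _ g β.1) ?_ ?_ hU
    · have := β.2.1
      apply Continuous.continuousAt
      simp only [comm_apply]
      fun_prop
    · exact fun u _ w _ => hmul u w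
  rw [T.map_signHom_eq_zero_iff]
  have h1 := hmul T.z (T.z⁻¹ * m)
  rw [mul_inv_cancel_left, h0, add_zero, comm_apply, h, sub_self] at h1
  exact h1.symm

end TameGroup

end ContCoh

open Topology Filter

/-! ### Two-fold covers and their complex covers -/

namespace IsTwofoldCover

/-- The diagonal `ℤ/2` in `E × ℂˣ`. -/
noncomputable def diag {E : Type*} [Group E] (ι : Multiplicative (ZMod 2) →* E) : Multiplicative (ZMod 2) →* E × ℂˣ :=
  ι.prod (AddMonoidHom.toMultiplicativeLeft ContCoh.signHom.toAddMonoidHom)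

theorem diag_apply {E : Type*} [Group E] {ι : Multiplicative (ZMod 2) →* E} (t : ZMod 2) : diag ι (Multiplicative.ofAdd t) =
    (ι (Multiplicative.ofAdd t), Additive.toMul (ContCoh.signHom t)) := rfl

variable {E G : Type*} [Group E] [TopologicalSpace E] [Group G] [TopologicalSpace G]
  {ι : Multiplicative (ZMod 2) →* E} {p : E →* G}

theorem exists_of_map_eq (hE : IsTwofoldCover ι p) {x y : E} (h : p x = p y) :
    ∃ t : ZMod 2, x = ι (Multiplicative.ofAdd t) * y := by
  have : p (x * y⁻¹) = 1 := by rw [map_mul, map_inv, h, mul_inv_cancel]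
  obtain ⟨t, ht⟩ := (hE.isSES.mulExact _).1 this
  exact ⟨Multiplicative.toAdd t, by rw [ofAdd_toAdd, ht, inv_mul_cancel_right]⟩

theorem ι_comm (hE : IsTwofoldCover ι p) (t : Multiplicative (ZMod 2)) (x : E) :
    ι t * x = x * ι t :=
  ((Subgroup.mem_center_iff.1 (hE.central ⟨t, rfl⟩)) x).symm

theorem normalClosure_eq (hE : IsTwofoldCover ι p) :
    Subgroup.normalClosure {(ι (Multiplicative.ofAdd 1), (-1 : ℂˣ))} = (diag ι).range := by
  have h1 : diag ι (Multiplicative.ofAdd 1) = (ι (Multiplicative.ofAdd 1), (-1 : ℂˣ)) := by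
    rw [diag_apply, ContCoh.signHom_one]; rfl
  apply le_antisymm
  · have : (diag ι).range.Normal := ⟨by
      rintro _ ⟨t, rfl⟩ ⟨x, z⟩
      refine ⟨t, ?_⟩
      refine Prod.ext ?_ ?_
      · change ι t = x * ι t * x⁻¹
        rw [← hE.ι_comm, mul_inv_cancel_right]
      · change _ = z * _ * z⁻¹
        rw [mul_comm z, mul_inv_cancel_right]⟩
    refine Subgroup.normalClosure_le_normal ?_
    rintro _ rfl
    exact ⟨_, h1⟩
  · rintro _ ⟨t, rfl⟩
    have h01 : ∀ t : Multiplicative (ZMod 2), t = 1 ∨ t = Multiplicative.ofAdd 1 := by decide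
    rcases h01 t with h | rfl
    · rw [h, map_one (diag ι)]; exact one_mem _
    · exact Subgroup.subset_normalClosure h1

theorem mk_diag (hE : IsTwofoldCover ι p) (t : ZMod 2) :
    (QuotientGroup.mk (ι (Multiplicative.ofAdd t), Additive.toMul (ContCoh.signHom t)) :
      ComplexCover ι) = 1 := by
  rw [QuotientGroup.eq_one_iff, hE.normalClosure_eq]
  exact ⟨_, diag_apply t⟩

theorem eq_one_of_mk (hE : IsTwofoldCover ι p) {x : E}
    (h : (QuotientGroup.mk (x, 1) : ComplexCover ι) = 1) : x = 1 := by
  rw [QuotientGroup.eq_one_iff, hE.normalClosure_eq] at h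
  obtain ⟨t, ht⟩ := h
  have h2 : ContCoh.signHom (Multiplicative.toAdd t) = 0 := congrArg Prod.snd ht
  have h3 : Multiplicative.toAdd t = 0 := ContCoh.signHom_injective (h2.trans (map_zero _).symm)
  have h4 : t = 1 := h3
  rw [h4, map_one] at ht
  exact (congrArg Prod.fst ht).symm

theorem splitsOver_proj (hE : IsTwofoldCover ι p) {H : Subgroup G} (h : SplitsOver p H) :
    SplitsOver (ComplexCover.proj hE) H := by
  obtain ⟨s, hs, hps⟩ := h
  refine ⟨(QuotientGroup.mk' _).comp ((MonoidHom.inl E ℂˣ).comp s), ?_, hps⟩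
  exact continuous_quot_mk.comp (hs.prodMk continuous_const)

/-- The commutator of lifts does not depend on the lifts, since ι has central image, nor on the
commutative factor ℂˣ. It can therefore be computed on the images of the splitting, which commute,
and E embeds in the ℂˣ-cover. -/
theorem commute_of_splitsOver (hE : IsTwofoldCover ι p) {H : Subgroup G}
    (h : SplitsOver (ComplexCover.proj hE) H) {a b : G} (ha : a ∈ H) (hb : b ∈ H)
    (hab : a * b = b * a) {x y : E} (hx : p x = a) (hy : p y = b) : x * y = y * x := by
  obtain ⟨s, -, hps⟩ := h
  obtain ⟨⟨x', z⟩, hx'⟩ := QuotientGroup.mk_surjective (s ⟨a, ha⟩)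
  obtain ⟨⟨y', w⟩, hy'⟩ := QuotientGroup.mk_surjective (s ⟨b, hb⟩)
  have hpx : p x' = a := by
    have := hps ⟨a, ha⟩
    rwa [← hx'] at this
  have hpy : p y' = b := by
    have := hps ⟨b, hb⟩
    rwa [← hy'] at this
  have hcomm : s ⟨a, ha⟩ * s ⟨b, hb⟩ = s ⟨b, hb⟩ * s ⟨a, ha⟩ := by
    rw [← map_mul, ← map_mul]
    exact congrArg s (Subtype.ext hab)
  rw [← hx', ← hy', ← QuotientGroup.mk_mul, ← QuotientGroup.mk_mul, ← inv_mul_eq_one,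
    ← QuotientGroup.mk_inv, ← QuotientGroup.mk_mul] at hcomm
  have h2 : (x' * y')⁻¹ * (y' * x') = 1 := by
    refine hE.eq_one_of_mk ?_
    convert hcomm using 2
    refine Prod.ext rfl ?_
    change 1 = (z * w)⁻¹ * (w * z)
    rw [mul_comm w, inv_mul_cancel]
  rw [inv_mul_eq_one] at h2
  obtain ⟨t, rfl⟩ := hE.exists_of_map_eq (hx.trans hpx.symm)
  obtain ⟨r, rfl⟩ := hE.exists_of_map_eq (hy.trans hpy.symm)
  have h3 := hE.ι_comm (Multiplicative.ofAdd r) x'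
  have h4 := hE.ι_comm (Multiplicative.ofAdd t) y'
  have h5 := hE.ι_comm (Multiplicative.ofAdd t) (ι (Multiplicative.ofAdd r))
  calc ι (Multiplicative.ofAdd t) * x' * (ι (Multiplicative.ofAdd r) * y')
      = ι (Multiplicative.ofAdd t) * (x' * ι (Multiplicative.ofAdd r)) * y' := by group
    _ = ι (Multiplicative.ofAdd t) * ι (Multiplicative.ofAdd r) * (x' * y') := by rw [← h3]; group
    _ = ι (Multiplicative.ofAdd r) * (ι (Multiplicative.ofAdd t) * y') * x' := by
      rw [h5, h2]; group
    _ = ι (Multiplicative.ofAdd r) * y' * (ι (Multiplicative.ofAdd t) * x') := by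
      rw [h4]; group

/-- If β is the coboundary of s in ℂˣ, then g ↦ (σ g, s(g)⁻¹) is multiplicative modulo the diagonal
ℤ/2. -/
theorem splitsOver_top_of_map_eq_zero (hE : IsTwofoldCover ι p) {σ : G → E} (hσ : Continuous σ)
    (hpσ : ∀ g, p (σ g) = g) {β : ContCoh.Z2 G (ZMod 2)}
    (hβ : ∀ g h, σ g * σ h = ι (Multiplicative.ofAdd (β.1 (g, h))) * σ (g * h))
    (h : ContCoh.H2.map G ContCoh.signHom (QuotientAddGroup.mk β) = 0) :
    SplitsOver (ComplexCover.proj hE) ⊤ := by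
  obtain ⟨s, hs, hβs⟩ := ContCoh.mk_eq_zero_iff.1 h
  have hmul : ∀ g h, Additive.toMul (s g) * Additive.toMul (s h) =
      Additive.toMul (ContCoh.signHom (β.1 (g, h))) * Additive.toMul (s (g * h)) := by
    intro g h
    have h1 : ContCoh.signHom (β.1 (g, h)) = s h - s (g * h) + s g := hβs g h
    have h2 : s g + s h = ContCoh.signHom (β.1 (g, h)) + s (g * h) := by rw [h1]; abel
    exact h2
  have hsign : ∀ b, (Additive.toMul (ContCoh.signHom b))⁻¹ = Additive.toMul (ContCoh.signHom b) := by
    intro b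
    have h1 := ContCoh.two_nsmul_signHom b
    rw [two_nsmul, ← neg_eq_iff_add_eq_zero] at h1
    exact h1
  let f : G → ComplexCover ι := fun g => QuotientGroup.mk (σ g, (Additive.toMul (s g))⁻¹)
  have hf : ∀ g h, f (g * h) = f g * f h := by
    intro g h
    have h1 : ((σ g, (Additive.toMul (s g))⁻¹) * (σ h, (Additive.toMul (s h))⁻¹) : E × ℂˣ) =
        (ι (Multiplicative.ofAdd (β.1 (g, h))), Additive.toMul (ContCoh.signHom (β.1 (g, h)))) *
          (σ (g * h), (Additive.toMul (s (g * h)))⁻¹) := by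
      refine Prod.ext (hβ g h) ?_
      change (Additive.toMul (s g))⁻¹ * (Additive.toMul (s h))⁻¹ =
        Additive.toMul (ContCoh.signHom (β.1 (g, h))) * (Additive.toMul (s (g * h)))⁻¹
      rw [← mul_inv, hmul, mul_inv, hsign]
    change QuotientGroup.mk _ = QuotientGroup.mk _ * QuotientGroup.mk _
    rw [← QuotientGroup.mk_mul, h1, QuotientGroup.mk_mul, hE.mk_diag, one_mul]
  have hfc : Continuous f := by
    refine continuous_quot_mk.comp (hσ.prodMk ?_)
    have : Continuous fun g => Additive.toMul (s g) := hs
    exact this.inv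
  refine ⟨(MonoidHom.mk' f hf).comp (Subgroup.subtype ⊤), hfc.comp continuous_subtype_val,
    fun g => hpσ g⟩

variable [IsTopologicalGroup G]

/-- A two-fold cover of a group with arbitrarily small open subgroups has a continuous section. -/
theorem exists_continuous_section [T2Space G] (hE : IsTwofoldCover ι p)
    (hG : ∀ W ∈ 𝓝 (1 : G), ∃ V : Subgroup G, IsOpen (V : Set G) ∧ (V : Set G) ⊆ W) :
    ∃ σ : G → E, Continuous σ ∧ ∀ g, p (σ g) = g := by
  have := hE.isTopologicalGroup
  have hpc : Continuous p := hE.isSES.isOpenQuotientMap.continuous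
  have hclosed : IsClosed ({ι (Multiplicative.ofAdd 1)} : Set E) := by
    have := hE.isSES.isClosedEmbedding.isClosedMap _ (isClosed_discrete {Multiplicative.ofAdd 1})
    rwa [Set.image_singleton] at this
  have hne : (1 : E) ≠ ι (Multiplicative.ofAdd 1) := by
    rw [← map_one ι]
    intro h
    exact absurd (hE.isSES.isClosedEmbedding.injective h) (by decide)
  -- On a neighbourhood W of 1 with W W⁻¹ avoiding the non-trivial kernel element, p is injective.
  -- Being open, it has a continuous inverse there.
  have hnhds : {x : E × E | x.1 * x.2⁻¹ ≠ ι (Multiplicative.ofAdd 1)} ∈ 𝓝 ((1, 1) : E × E) := by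
    have hc : Continuous fun x : E × E => x.1 * x.2⁻¹ := by fun_prop
    exact (hclosed.isOpen_compl.preimage hc).mem_nhds (by simpa using hne)
  rw [nhds_prod_eq, mem_prod_self_iff] at hnhds
  obtain ⟨W₀, hW₀, hsub⟩ := hnhds
  obtain ⟨W, hWsub, hWo, h1W⟩ := mem_nhds_iff.1 hW₀
  have hinj : Set.InjOn p W := by
    intro x hx y hy hxy
    obtain ⟨t, ht⟩ := hE.exists_of_map_eq hxy
    have hne : x * y⁻¹ ≠ ι (Multiplicative.ofAdd 1) :=
      hsub (Set.mk_mem_prod (hWsub hx) (hWsub hy))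
    have h01 : ∀ t : ZMod 2, t = 0 ∨ t = 1 := by decide
    rcases h01 t with rfl | rfl
    · rw [ht, ofAdd_zero, map_one, one_mul]
    · exact absurd (by rw [ht, mul_inv_cancel_right]) hne
  have hpW : p '' W ∈ 𝓝 (1 : G) :=
    (hE.isSES.isOpenQuotientMap.isOpenMap W hWo).mem_nhds ⟨1, h1W, map_one p⟩
  obtain ⟨V, hVo, hVW⟩ := hG _ hpW
  have hloc : ∀ v : G, ∃ x : E, v ∈ V → x ∈ W ∧ p x = v := fun v => by
    by_cases hv : v ∈ V
    · obtain ⟨x, hx, hpx⟩ := hVW hv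
      exact ⟨x, fun _ => ⟨hx, hpx⟩⟩
    · exact ⟨1, fun h => absurd h hv⟩
  choose τ hτ using hloc
  have hτc : ContinuousOn τ V := by
    intro v hv
    rw [ContinuousWithinAt, nhdsWithin_eq_nhds.2 (hVo.mem_nhds hv)]
    intro N hN
    obtain ⟨N', hN'N, hN'o, hvN'⟩ := mem_nhds_iff.1 hN
    have h1 : p '' (N' ∩ W) ∈ 𝓝 v :=
      (hE.isSES.isOpenQuotientMap.isOpenMap _ (hN'o.inter hWo)).mem_nhds
        ⟨τ v, ⟨hvN', (hτ v hv).1⟩, (hτ v hv).2⟩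
    rw [mem_map]
    filter_upwards [h1, hVo.mem_nhds hv] with w hw hwV
    obtain ⟨x, ⟨hxN, hxW⟩, hpx⟩ := hw
    have : τ w = x := hinj (hτ w hwV).1 hxW ((hτ w hwV).2.trans hpx.symm)
    rw [Set.mem_preimage, this]
    exact hN'N hxN
  choose lift hlift using hE.isSES.isOpenQuotientMap.surjective
  -- The local section on V is carried to each coset of V by an arbitrary lift of a representative.
  let rep : G → G := fun g => (QuotientGroup.mk g : G ⧸ V).out
  have hrep : ∀ g, (rep g)⁻¹ * g ∈ V := fun g => by
    rw [← QuotientGroup.eq]; exact QuotientGroup.out_eq' _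
  refine ⟨fun g => lift (rep g) * τ ((rep g)⁻¹ * g), ?_, fun g => ?_⟩
  · rw [continuous_iff_continuousAt]
    intro g
    have hev : ∀ᶠ g' in 𝓝 g, rep g' = rep g := by
      have : (fun y => g⁻¹ * y) ⁻¹' (V : Set G) ∈ 𝓝 g :=
        (continuous_const_mul g⁻¹).continuousAt (by
          simpa using hVo.mem_nhds V.one_mem)
      filter_upwards [this] with g' hg'
      have : (QuotientGroup.mk g : G ⧸ V) = QuotientGroup.mk g' := QuotientGroup.eq.2 hg'
      simp only [rep, this]
    have h3 : ContinuousAt (fun g' => lift (rep g) * τ ((rep g)⁻¹ * g')) g := by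
      refine continuousAt_const.mul ?_
      refine ContinuousAt.comp (g := τ) ?_ (continuous_const_mul _).continuousAt
      exact (hτc _ (hrep g)).continuousAt (hVo.mem_nhds (hrep g))
    refine h3.congr ?_
    filter_upwards [hev] with g' hg'
    rw [hg']
  · rw [map_mul, hlift, (hτ _ (hrep g)).2, mul_inv_cancel_left]

/-- The cocycle of a continuous section of a two-fold cover. -/
theorem exists_cocycle (hE : IsTwofoldCover ι p) {σ : G → E} (hσ : Continuous σ)
    (hpσ : ∀ g, p (σ g) = g) : ∃ β : ContCoh.Z2 G (ZMod 2),
      ∀ g h, σ g * σ h = ι (Multiplicative.ofAdd (β.1 (g, h))) * σ (g * h) := by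
  have := hE.isTopologicalGroup
  have hex : ∀ x : G × G, ∃ t : ZMod 2,
      σ x.1 * σ x.2 = ι (Multiplicative.ofAdd t) * σ (x.1 * x.2) := fun x =>
    hE.exists_of_map_eq (by rw [map_mul, hpσ, hpσ, hpσ])
  choose β hβ using hex
  have hβc : Continuous β := by
    have h1 : Continuous fun x => ι (Multiplicative.ofAdd (β x)) := by
      have h2 : (fun x => ι (Multiplicative.ofAdd (β x))) =
          fun x : G × G => σ x.1 * σ x.2 * (σ (x.1 * x.2))⁻¹ := by
        funext x
        rw [hβ, mul_inv_cancel_right]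
      rw [h2]
      fun_prop
    exact (hE.isSES.isClosedEmbedding.isInducing.continuous_iff
      (f := fun x => Multiplicative.ofAdd (β x))).2 h1
  refine ⟨⟨β, hβc, fun g h k => ?_⟩, fun g h => hβ (g, h)⟩
  have h1 := mul_assoc (σ g) (σ h) (σ k)
  rw [hβ (g, h), hβ (h, k)] at h1
  simp only at h1
  rw [mul_assoc, hβ (g * h, k), ← mul_assoc (σ g), ← hE.ι_comm, mul_assoc (ι _) (σ g),
    hβ (g, h * k), ← mul_assoc, ← mul_assoc, ← map_mul ι, ← map_mul ι] at h1
  simp only [mul_assoc g] at h1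
  have h2 := hE.isSES.isClosedEmbedding.injective (mul_right_cancel h1)
  have h3 : β (g, h) + β (g * h, k) = β (h, k) + β (g, h * k) := h2
  rw [← h3, add_comm]

end IsTwofoldCover

/-- A splitting over H would make lifts of P² and m commute. That already kills the class in H²(G,
ℂˣ), hence would split the ℂˣ-cover over all of G. -/
theorem ContCoh.TameGroup.not_splitsOver {G : Type*} [Group G] [TopologicalSpace G]
    [IsTopologicalGroup G] [T2Space G] (T : ContCoh.TameGroup G)
    {E : Type*} [Group E] [TopologicalSpace E]
    {ι : Multiplicative (ZMod 2) →* E} {p : E →* G} (hE : IsTwofoldCover ι p) {H : Subgroup G}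
    (hP : T.P * T.P ∈ H) {m : G} (hm : m ∈ H) (hv : T.v m = 0) (hl : T.lam m = 1)
    (hns : ¬ SplitsOver (ComplexCover.proj hE) ⊤) :
    ¬ SplitsOver p H ∧ ¬ SplitsOver (ComplexCover.proj hE) H := by
  have key : ¬ SplitsOver (ComplexCover.proj hE) H := by
    intro hsplit
    obtain ⟨σ, hσ, hpσ⟩ := hE.exists_continuous_section fun W hW => by
      obtain ⟨V, -, hV, -, hVW, -⟩ := T.odd_U.exists_subgroup W hW
      exact ⟨V, hV, hVW⟩
    obtain ⟨β, hβ⟩ := hE.exists_cocycle hσ hpσ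
    refine hns (hE.splitsOver_top_of_map_eq_zero hσ hpσ hβ
      (T.map_signHom_eq_zero_of_comm β hv hl ?_))
    have h1 := hE.commute_of_splitsOver hsplit hP hm (T.P_central m) (hpσ _) (hpσ _)
    rw [hβ, hβ, T.P_central, mul_left_inj] at h1
    exact hE.isSES.isClosedEmbedding.injective h1
  exact ⟨fun h => key (hE.splitsOver_proj h), key⟩

/-! ### Squares in local fields of odd residue characteristic -/

namespace OddLocalField

open ValuativeRel IsLocalRing

variable {F : Type*} [Field F] [ValuativeRel F] [TopologicalSpace F] [IsNonarchimedeanLocalField F]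

theorem isAdicComplete : IsAdicComplete 𝓂[F] 𝒪[F] := by
  let := IsTopologicalAddGroup.rightUniformSpace F
  have := isUniformAddGroup_of_addCommGroup (G := F)
  infer_instance

/-- Hensel's lemma for X² - a: the approximate root r is simple because 2 r is a unit. -/
theorem isSquare_of_residue (h2 : (2 : 𝓀[F]) ≠ 0) {a : 𝒪[F]} (ha : residue 𝒪[F] a ≠ 0)
    (hsq : IsSquare (residue 𝒪[F] a)) : IsSquare a := by
  have := isAdicComplete (F := F)
  obtain ⟨r, hr⟩ := hsq
  obtain ⟨r, rfl⟩ := residue_surjective r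
  have hr0 : residue 𝒪[F] r ≠ 0 := fun h => ha (by rw [hr, h, mul_zero])
  obtain ⟨s, hs, -⟩ := HenselianRing.is_henselian (I := 𝓂[F])
    (Polynomial.X ^ 2 - Polynomial.C a) (Polynomial.monic_X_pow_sub_C a two_ne_zero) r (by
      rw [← residue_eq_zero_iff]
      simp [hr, sq]) (by
      refine IsUnit.map _ ((residue_ne_zero_iff_isUnit _).1 ?_)
      have h3 : residue 𝒪[F] 2 ≠ 0 := by rwa [map_ofNat]
      simpa [hr0, one_add_one_eq_two] using h3)
  exact ⟨s, by simpa [Polynomial.IsRoot, sub_eq_zero, sq, eq_comm] using hs⟩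

theorem exists_eq_sq_mul {x : F} (hx : x ≠ 0) :
    ∃ (c : F) (d : 𝒪[F]), c ≠ 0 ∧ (IsUnit d ∨ Irreducible d) ∧ x = c ^ 2 * d := by
  obtain ⟨ϖ, hϖ⟩ := IsDiscreteValuationRing.exists_irreducible 𝒪[F]
  obtain ⟨a, b, hb, rfl⟩ := IsFractionRing.div_surjective (A := 𝒪[F]) x
  have hb0 : b ≠ 0 := nonZeroDivisors.ne_zero hb
  have hb0' : (b : F) ≠ 0 := by simpa using hb0
  have ha0 : a ≠ 0 := by rintro rfl; simp at hx
  obtain ⟨n, w, hw⟩ := IsDiscreteValuationRing.eq_unit_mul_pow_irreducible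
    (mul_ne_zero ha0 hb0) hϖ
  have hϖ0 : (ϖ : F) ≠ 0 := by simpa using hϖ.ne_zero
  -- Since a / b = a b / b², the parity of the exponent of ϖ in a b decides the case.
  have key : (algebraMap 𝒪[F] F a / algebraMap 𝒪[F] F b) = ((w : 𝒪[F]) * ϖ ^ n : F) / b ^ 2 := by
    have : (a : F) * b = (w : 𝒪[F]) * ϖ ^ n := by exact_mod_cast congrArg Subtype.val hw
    rw [← this]
    change (a : F) / b = _
    field_simp
  rcases Nat.even_or_odd' n with ⟨m, rfl | rfl⟩
  · refine ⟨ϖ ^ m / b, w, by positivity, Or.inl w.isUnit, ?_⟩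
    rw [key]; ring
  · refine ⟨ϖ ^ m / b, w * ϖ, by positivity, Or.inr ((irreducible_units_mul w).2 hϖ), ?_⟩
    rw [key]; push_cast; ring

theorem two_ne_zero_of_residue (h2 : (2 : 𝓀[F]) ≠ 0) : (2 : F) ≠ 0 := fun h => h2 (by
  have : (2 : 𝒪[F]) = 0 := Subtype.ext h
  rw [← map_ofNat (residue 𝒪[F]) 2, this, map_zero])

end OddLocalField

/-! ### Quaternion division algebras -/

section Quadratic

variable {F A : Type*} [Field F] [Ring A] [Algebra F A]

theorem exists_sub_sq_eq {x : A} (h2 : (2 : F) ≠ 0) (hx : IsIntegral F x)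
    (hdeg : (minpoly F x).natDegree = 2) :
    ∃ t d : F, (x - algebraMap F A t) * (x - algebraMap F A t) = algebraMap F A d := by
  have h := minpoly.aeval F x
  have hm := minpoly.monic hx
  rw [Polynomial.aeval_eq_sum_range, hdeg] at h
  simp only [Finset.sum_range_succ, Finset.range_zero, Finset.sum_empty, zero_add, pow_zero,
    pow_one] at h
  rw [← hdeg, hm.coeff_natDegree, hdeg, one_smul] at h
  set a := (minpoly F x).coeff 1
  set b := (minpoly F x).coeff 0
  refine ⟨-a / 2, (a / 2) ^ 2 - b, ?_⟩
  have h1 : x * x = -(b • (1 : A) + a • x) := by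
    rw [← sq]; exact eq_neg_of_add_eq_zero_right h
  simp only [Algebra.algebraMap_eq_smul_one]
  rw [sub_mul, mul_sub, mul_sub, h1]
  simp only [smul_mul_assoc, mul_smul_comm, one_mul, mul_one, smul_smul]
  match_scalars
  · field_simp; ring
  · field_simp; ring

theorem mem_range_of_mul_self [IsDomain A] {x : A} {s : F} (h : x * x = algebraMap F A (s * s)) :
    x ∈ (algebraMap F A).range := by
  have hc := Algebra.commutes s x
  have : (x - algebraMap F A s) * (x + algebraMap F A s) = 0 := by
    rw [sub_mul, mul_add, mul_add, h, hc, map_mul]; abel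
  rcases mul_eq_zero.1 this with h | h
  · exact ⟨s, (sub_eq_zero.1 h).symm⟩
  · exact ⟨-s, by rw [map_neg]; exact (eq_neg_of_add_eq_zero_left h).symm⟩

end Quadratic

namespace QuaternionDivision

variable {F D : Type*} [Field F] [DivisionRing D] [Algebra F D]

theorem exists_not_mem_range (hD : Module.finrank F D = 4) : ∃ x : D, x ∉ (algebraMap F D).range := by
  by_contra! h
  have : (⊥ : Subalgebra F D) = ⊤ := by
    rw [eq_top_iff]
    rintro x -
    exact Algebra.mem_bot.2 (h x)
  have h1 := Subalgebra.finrank_bot (F := F) (E := D)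
  rw [this, subalgebra_top_finrank_eq_submodule_top_finrank, finrank_top] at h1
  omega

section Central

variable [Algebra.IsCentral F D]

theorem exists_ne_commute {x : D} (hx : x ∉ (algebraMap F D).range) : ∃ y, y * x - x * y ≠ 0 := by
  by_contra! h
  apply hx
  have : x ∈ Subalgebra.center F D :=
    Subalgebra.mem_center_iff.2 fun y => sub_eq_zero.1 (h y)
  have h2 := Algebra.IsCentral.out this
  exact Algebra.mem_bot.1 h2

/-- The field K = F(x) acts on D by left multiplication, so its degree divides 4. Degree 1 puts x in
F, and degree 4 would make D equal to K, hence commutative, contradicting centrality. -/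
theorem natDegree_minpoly (hD : Module.finrank F D = 4) {x : D}
    (hx : x ∉ (algebraMap F D).range) :
    IsIntegral F x ∧ (minpoly F x).natDegree = 2 := by
  have : FiniteDimensional F D := Module.finite_of_finrank_pos (by omega)
  have hint : IsIntegral F x := Algebra.IsIntegral.isIntegral x
  refine ⟨hint, ?_⟩
  have hirr := minpoly.irreducible hint
  have : Fact (Irreducible (minpoly F x)) := ⟨hirr⟩
  let K := AdjoinRoot (minpoly F x)
  let φ : K →+* D := Ideal.Quotient.lift (Ideal.span {minpoly F x})
    (Polynomial.aeval x : Polynomial F →ₐ[F] D).toRingHom (by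
      intro a ha
      obtain ⟨b, rfl⟩ := Ideal.mem_span_singleton'.1 ha
      change Polynomial.aeval x (b * minpoly F x) = 0
      rw [map_mul, minpoly.aeval, mul_zero])
  have hφ : ∀ a : F, φ (algebraMap F K a) = algebraMap F D a := fun a =>
    Polynomial.aeval_C x a
  let : Module K D := Module.compHom D φ
  have hsmul : ∀ (k : K) (d : D), k • d = φ k * d := fun _ _ => rfl
  have : IsScalarTower F K D := ⟨fun a k d => by
    rw [hsmul, hsmul, Algebra.smul_def, map_mul, hφ, mul_assoc, ← Algebra.smul_def]⟩
  have hK : Module.finrank F K = (minpoly F x).natDegree := by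
    rw [(AdjoinRoot.powerBasis hirr.ne_zero).finrank, AdjoinRoot.powerBasis_dim]
  have hmul := Module.finrank_mul_finrank F K D
  rw [hK, hD] at hmul
  have hdvd : (minpoly F x).natDegree ∣ 4 := ⟨_, hmul.symm⟩
  have hle := Nat.le_of_dvd (by norm_num) hdvd
  have hpos := minpoly.natDegree_pos hint
  have h1 : (minpoly F x).natDegree ≠ 1 := fun h => hx (by
    have := minpoly.mem_range_of_degree_eq_one F x (by
      rw [Polynomial.degree_eq_natDegree hirr.ne_zero, h]; rfl)
    exact this)
  have h4 : (minpoly F x).natDegree ≠ 4 := fun h => by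
    rw [h] at hmul
    have hone : Module.finrank K D = 1 := by omega
    have hsurj : ∀ d, ∃ k, φ k = d := fun d => by
      obtain ⟨k, hk⟩ := (finrank_eq_one_iff_of_nonzero' (1 : D) one_ne_zero).1 hone d
      exact ⟨k, by rw [← hk, hsmul, mul_one]⟩
    obtain ⟨y, hy⟩ := exists_ne_commute hx
    obtain ⟨k, hk⟩ := hsurj x
    obtain ⟨l, hl⟩ := hsurj y
    exact hy (by rw [← hk, ← hl, ← map_mul, ← map_mul, mul_comm, sub_self])
  interval_cases (minpoly F x).natDegree <;> omega

/-- Non-central elements that are square roots of central elements exist. -/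
theorem exists_mul_self_eq (hD : Module.finrank F D = 4) (h2 : (2 : F) ≠ 0) {x : D}
    (hx : x ∉ (algebraMap F D).range) :
    ∃ t d : F, (x - algebraMap F D t) * (x - algebraMap F D t) = algebraMap F D d :=
  exists_sub_sq_eq h2 (natDegree_minpoly hD hx).1 (natDegree_minpoly hD hx).2

end Central

/-- The elements `i`, `j` anticommute and have central non-zero squares `a`, `b`. -/
structure IsStandard (a b : F) (i j : D) : Prop where
  ne_left : a ≠ 0
  ne_right : b ≠ 0
  i_mul_i : i * i = algebraMap F D a
  j_mul_j : j * j = algebraMap F D b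
  i_mul_j : i * j = -(j * i)

namespace IsStandard

variable {a b : F} {i j : D}

theorem symm (h : IsStandard a b i j) : IsStandard b a j i :=
  ⟨h.ne_right, h.ne_left, h.j_mul_j, h.i_mul_i, by rw [h.i_mul_j, neg_neg]⟩

theorem i_ne_zero (h : IsStandard a b i j) : i ≠ 0 := by
  rintro rfl
  have := h.i_mul_i
  rw [zero_mul, eq_comm, map_eq_zero] at this
  exact h.ne_left this

theorem i_notMem (h2 : (2 : F) ≠ 0) (h : IsStandard a b i j) : i ∉ (algebraMap F D).range := by
  rintro ⟨s, rfl⟩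
  have h1 := h.i_mul_j
  rw [← Algebra.commutes s j, eq_neg_iff_add_eq_zero, ← two_mul] at h1
  have h3 : (2 : D) ≠ 0 := by
    rw [← map_ofNat (algebraMap F D) 2]
    simpa using h2
  exact mul_ne_zero h3 (mul_ne_zero h.i_ne_zero h.symm.i_ne_zero) h1

theorem smul (h : IsStandard a b i j) {c : F} (hc : c ≠ 0) : IsStandard (c ^ 2 * a) b (c • i) j where
  ne_left := mul_ne_zero (pow_ne_zero _ hc) h.ne_left
  ne_right := h.ne_right
  i_mul_i := by
    rw [smul_mul_smul_comm, h.i_mul_i, Algebra.smul_def, ← map_mul, sq]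
  j_mul_j := h.j_mul_j
  i_mul_j := by rw [smul_mul_assoc, h.i_mul_j, mul_smul_comm, smul_neg]

theorem mul (h : IsStandard a b i j) : IsStandard (-(a * b)) b (i * j) j where
  ne_left := neg_ne_zero.2 (mul_ne_zero h.ne_left h.ne_right)
  ne_right := h.ne_right
  i_mul_i := by
    have : i * j * (i * j) = -(i * i * (j * j)) := by
      calc i * j * (i * j) = i * (j * i) * j := by simp only [mul_assoc]
        _ = i * (-(i * j)) * j := by rw [h.i_mul_j, neg_neg]
        _ = _ := by simp only [mul_neg, neg_mul, mul_assoc]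
    rw [this, h.i_mul_i, h.j_mul_j, map_neg, map_mul]
  j_mul_j := h.j_mul_j
  i_mul_j := by
    have : j * (i * j) = -(i * j * j) := by
      rw [← mul_assoc, ← neg_mul, h.i_mul_j, neg_neg]
    rw [this, neg_neg]

theorem not_square (h2 : (2 : F) ≠ 0) (h : IsStandard a b i j) (s : F) : a ≠ s * s := fun hs =>
  h.i_notMem h2 (mem_range_of_mul_self (s := s) (by rw [h.i_mul_i, hs]))

/-- A sum of a multiple of `i` and a multiple of `j` does not have a central square root of its
square. -/
theorem not_square_add (h2 : (2 : F) ≠ 0) (h : IsStandard a b i j) {x y : F}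
    (hxy : x ≠ 0 ∨ y ≠ 0) (s : F) : a * x ^ 2 + b * y ^ 2 ≠ s * s := by
  wlog hx : x ≠ 0 generalizing a b i j x y
  · have hy := hxy.resolve_left hx
    rw [add_comm]
    exact this h.symm hxy.symm hy
  intro hs
  have hsq : (x • i + y • j) * (x • i + y • j) = algebraMap F D (s * s) := by
    have h1 : (x • i + y • j) * (x • i + y • j) =
        (x * x) • (i * i) + (x * y) • (i * j + j * i) + (y * y) • (j * j) := by
      simp only [add_mul, mul_add, smul_mul_smul_comm, smul_add, mul_comm y x]
      abel
    rw [h1, h.i_mul_j, neg_add_cancel, h.i_mul_i, h.j_mul_j, ← hs, map_add, map_mul, map_mul,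
      smul_zero, add_zero, Algebra.smul_def, Algebra.smul_def, ← map_mul, ← map_mul, ← map_mul,
      ← map_mul]
    congr 2 <;> ring
  obtain ⟨t, ht⟩ := mem_range_of_mul_self hsq
  have hc := Algebra.commutes t j
  rw [ht, add_mul, mul_add, smul_mul_assoc, smul_mul_assoc, mul_smul_comm, mul_smul_comm,
    add_left_inj, h.i_mul_j, smul_neg, neg_eq_iff_add_eq_zero, ← two_smul F] at hc
  exact smul_ne_zero h2 (smul_ne_zero hx (mul_ne_zero h.symm.i_ne_zero h.i_ne_zero)) hc

end IsStandard

/-- Completing the square gives a non-central i with i² in F. Any non-zero commutator j = y i - i y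
anticommutes with i because i² is central. -/
theorem exists_isStandard [Algebra.IsCentral F D] (hD : Module.finrank F D = 4)
    (h2 : (2 : F) ≠ 0) : ∃ (a b : F) (i j : D), IsStandard a b i j := by
  obtain ⟨x, hx⟩ := exists_not_mem_range hD
  obtain ⟨t, a, ha⟩ := exists_mul_self_eq hD h2 hx
  obtain ⟨i, hi⟩ : ∃ i, i = x - algebraMap F D t := ⟨_, rfl⟩
  rw [← hi] at ha
  have hiF : i ∉ (algebraMap F D).range := by
    rintro ⟨s, hs⟩
    exact hx ⟨s + t, by rw [map_add, hs, hi, sub_add_cancel]⟩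
  obtain ⟨y, hy⟩ := exists_ne_commute hiF
  obtain ⟨j, hj⟩ : ∃ j, j = y * i - i * y := ⟨_, rfl⟩
  rw [← hj] at hy
  have hij : i * j = -(j * i) := by
    have hc := Algebra.commutes a y
    rw [← ha] at hc
    have h1 : i * (i * y) = y * (i * i) := by rw [← hc, mul_assoc]
    rw [hj, mul_sub, sub_mul, h1, mul_assoc, mul_assoc, neg_sub]
  have hjF : j ∉ (algebraMap F D).range := by
    rintro ⟨s, hs⟩
    have h1 := hij
    rw [← hs, Algebra.commutes s i, eq_comm, neg_eq_iff_add_eq_zero, ← Algebra.commutes s i,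
      ← two_smul F] at h1
    refine smul_ne_zero h2 (mul_ne_zero (hs ▸ hy) ?_) h1
    rintro h0
    exact hiF ⟨0, by rw [map_zero, h0]⟩
  have hi0 : i ≠ 0 := fun h0 => hiF ⟨0, by rw [map_zero, h0]⟩
  obtain ⟨s, b, hb⟩ := exists_mul_self_eq hD h2 hjF
  have hjj : i * (j * j) = (j * j) * i := by
    rw [← mul_assoc, hij, neg_mul, mul_assoc, hij, mul_neg, neg_neg, mul_assoc]
  -- j² is a scalar plus 2 s j. It commutes with i whereas j anticommutes, so the linear term
  -- vanishes.
  have hs : s = 0 := by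
    have hexp : j * j = algebraMap F D (b - s * s) + (2 * s) • j := by
      rw [map_sub, ← hb, Algebra.smul_def, map_mul, map_mul, map_ofNat, sub_mul, mul_sub, mul_sub,
        ← Algebra.commutes s j]
      noncomm_ring
    rw [hexp, mul_add, add_mul, ← Algebra.commutes _ i, add_right_inj, mul_smul_comm, smul_mul_assoc,
      hij, smul_neg, neg_eq_iff_add_eq_zero, ← two_smul F] at hjj
    by_contra hs
    exact smul_ne_zero h2 (smul_ne_zero (mul_ne_zero h2 hs) (mul_ne_zero hy hi0)) hjj
  rw [hs, map_zero, sub_zero] at hb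
  refine ⟨a, b, i, j, ?_, ?_, ha, hb, hij⟩
  · rintro rfl
    rw [map_zero] at ha
    exact hi0 (mul_self_eq_zero.1 ha)
  · rintro rfl
    rw [map_zero] at hb
    exact hy (mul_self_eq_zero.1 hb)

open ValuativeRel IsLocalRing

/-- A quaternion division algebra over a local field of odd residue characteristic is generated by
square roots of a non-square unit and of a uniformizer, which anticommute. -/
theorem exists_isStandard_unit_uniformizer [ValuativeRel F] [TopologicalSpace F]
    [IsNonarchimedeanLocalField F] [Algebra.IsCentral F D] (hD : Module.finrank F D = 4)
    (h2 : (2 : 𝓀[F]) ≠ 0) :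
    ∃ (u ϖ : 𝒪[F]) (i j : D), ¬ IsSquare (residue 𝒪[F] u) ∧ Irreducible ϖ ∧
      IsStandard (u : F) (ϖ : F) i j := by
  have h2F : (2 : F) ≠ 0 := OddLocalField.two_ne_zero_of_residue h2
  have hns : ∀ (u : 𝒪[F]) (b : F) (i j : D), IsUnit u → IsStandard (u : F) b i j →
      ¬ IsSquare (residue 𝒪[F] u) := by
    intro u b i j hu h hsq
    obtain ⟨s, hs⟩ := OddLocalField.isSquare_of_residue h2
      ((residue_ne_zero_iff_isUnit _).2 hu) hsq
    exact h.not_square h2F s (by rw [hs]; rfl)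
  obtain ⟨a, b, i, j, h⟩ := exists_isStandard hD h2F
  obtain ⟨c, d, hc, hd, rfl⟩ := OddLocalField.exists_eq_sq_mul h.ne_left
  obtain ⟨c', d', hc', hd', rfl⟩ := OddLocalField.exists_eq_sq_mul h.ne_right
  have h' : ∃ i j : D, IsStandard (d : F) (d' : F) i j := by
    have h1 := ((h.smul (inv_ne_zero hc)).symm.smul (inv_ne_zero hc')).symm
    rw [← mul_assoc, ← mul_assoc, ← mul_pow, ← mul_pow, inv_mul_cancel₀ hc, inv_mul_cancel₀ hc',
      one_pow, one_mul, one_mul] at h1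
    exact ⟨_, _, h1⟩
  clear h
  obtain ⟨i, j, h⟩ := h'
  rcases hd with hd | hd <;> rcases hd' with hd' | hd'
  -- Two units: d x² + d' y² = 1 is solvable in the finite residue field. A lift of the solution
  -- makes the left side a square by Hensel, so that x i + y j would be a central square root.
  · exfalso
    let := Fintype.ofFinite 𝓀[F]
    have hd0 := (residue_ne_zero_iff_isUnit _).2 hd
    have hd0' := (residue_ne_zero_iff_isUnit _).2 hd'
    have hcard : Fintype.card 𝓀[F] % 2 = 1 := by
      refine FiniteField.odd_card_of_char_ne_two fun hchar => h2 ?_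
      have := CharP.cast_eq_zero 𝓀[F] (ringChar 𝓀[F])
      rw [hchar] at this
      exact_mod_cast this
    obtain ⟨x, y, hxy⟩ := FiniteField.exists_root_sum_quadratic
      (f := Polynomial.C (residue 𝒪[F] d) * Polynomial.X ^ 2 + Polynomial.C 0 * Polynomial.X +
        Polynomial.C (-1))
      (g := Polynomial.C (residue 𝒪[F] d') * Polynomial.X ^ 2 + Polynomial.C 0 * Polynomial.X +
        Polynomial.C 0)
      (Polynomial.degree_quadratic hd0) (Polynomial.degree_quadratic hd0') hcard
    obtain ⟨x, rfl⟩ := residue_surjective x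
    obtain ⟨y, rfl⟩ := residue_surjective y
    have hres : residue 𝒪[F] (d * x ^ 2 + d' * y ^ 2) = 1 := by
      simp only [Polynomial.eval_add, Polynomial.eval_mul, Polynomial.eval_C, Polynomial.eval_pow,
        Polynomial.eval_X] at hxy
      simp only [map_add, map_mul, map_pow]
      linear_combination hxy
    obtain ⟨s, hs⟩ := OddLocalField.isSquare_of_residue h2 (by rw [hres]; exact one_ne_zero)
      (by rw [hres]; exact ⟨1, (mul_one 1).symm⟩)
    refine h.not_square_add h2F (x := x) (y := y) ?_ s (congrArg Subtype.val hs)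
    by_contra! hxy0
    have hx : x = 0 := Subtype.ext hxy0.1
    have hy : y = 0 := Subtype.ext hxy0.2
    rw [hx, hy] at hres
    simp at hres
  · exact ⟨d, d', i, j, hns _ _ _ _ hd h, hd', h⟩
  · exact ⟨d', d, j, i, hns _ _ _ _ hd' h.symm, hd, h.symm⟩
  -- Two uniformizers: i is replaced by d⁻¹ i j, whose square -d'/d is a unit.
  · obtain ⟨w, hw⟩ := (IsDiscreteValuationRing.associated_of_irreducible _ hd' hd)
    have h1 := h.mul.smul (c := (d : F)⁻¹) (inv_ne_zero h.ne_left)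
    have h3 : ((d : F)⁻¹ ^ 2 * -(d * d')) = ((-w⁻¹ : 𝒪[F]ˣ) : 𝒪[F]) := by
      have hd'' : d' = d * (w⁻¹ : 𝒪[F]ˣ) := by rw [← hw, mul_assoc, Units.mul_inv, mul_one]
      have h0 := h.ne_left
      rw [hd'']
      push_cast
      field_simp
    rw [h3] at h1
    exact ⟨_, d', _, j, hns _ _ _ _ (Units.isUnit _) h1, hd', h1⟩

end QuaternionDivision

/-! ### The maximal order -/

namespace QuaternionOrder

open IsLocalRing Quaternion
open scoped QuadraticAlgebra

section Order

variable {R : Type*} [CommRing R] {u ϖ : R}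

/-- The reduced norm. -/
def nrd (x : ℍ[R,u,0,ϖ]) : R := x.re ^ 2 - u * x.imI ^ 2 - ϖ * x.imJ ^ 2 + u * ϖ * x.imK ^ 2

/-- The conjugate. -/
def conj (x : ℍ[R,u,0,ϖ]) : ℍ[R,u,0,ϖ] := ⟨x.re, -x.imI, -x.imJ, -x.imK⟩

theorem mul_conj (x : ℍ[R,u,0,ϖ]) : x * conj x = algebraMap R _ (nrd x) := by
  ext <;> simp [conj] <;> (try simp only [nrd]) <;> ring

theorem conj_mul (x : ℍ[R,u,0,ϖ]) : conj x * x = algebraMap R _ (nrd x) := by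
  ext <;> simp [conj] <;> (try simp only [nrd]) <;> ring

/-- Conjugation by the uniformizer, on the maximal order. -/
def twist (u ϖ : R) : ℍ[R,u,0,ϖ] ≃* ℍ[R,u,0,ϖ] where
  toFun x := ⟨x.re, -x.imI, x.imJ, -x.imK⟩
  invFun x := ⟨x.re, -x.imI, x.imJ, -x.imK⟩
  left_inv x := by ext <;> simp
  right_inv x := by ext <;> simp
  map_mul' x y := by ext <;> simp <;> ring

/-- Principal units of level `k`. -/
def levelUnits (u ϖ : R) (k : ℕ) : Subgroup ℍ[R,u,0,ϖ]ˣ where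
  carrier := {x | ∃ y, (x : ℍ[R,u,0,ϖ]) = 1 + algebraMap R _ (ϖ ^ k) * y}
  one_mem' := ⟨0, by simp⟩
  mul_mem' := by
    rintro a b ⟨y, hy⟩ ⟨z, hz⟩
    refine ⟨z + y * b, ?_⟩
    rw [Units.val_mul, hy, add_mul, one_mul, mul_assoc, mul_add, ← add_assoc, ← hz]
  inv_mem' := by
    rintro a ⟨y, hy⟩
    refine ⟨-(y * ↑a⁻¹), ?_⟩
    have h : (a : ℍ[R,u,0,ϖ]) * ↑a⁻¹ = 1 := a.mul_inv
    rw [hy, add_mul, one_mul, mul_assoc, ← eq_sub_iff_add_eq] at h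
    rw [mul_neg, ← sub_eq_add_neg]
    exact h

theorem conj_mem_levelUnits {k : ℕ} {x : ℍ[R,u,0,ϖ]ˣ} (hx : x ∈ levelUnits u ϖ k)
    (g : ℍ[R,u,0,ϖ]ˣ) : g * x * g⁻¹ ∈ levelUnits u ϖ k := by
  obtain ⟨y, hy⟩ := hx
  refine ⟨g * y * ↑g⁻¹, ?_⟩
  rw [Units.val_mul, Units.val_mul, hy, mul_add, add_mul, mul_one, Units.mul_inv, ← mul_assoc,
    ← Algebra.commutes, mul_assoc, mul_assoc, mul_assoc]

theorem twist_mem_levelUnits {k : ℕ} {x : ℍ[R,u,0,ϖ]ˣ} (hx : x ∈ levelUnits u ϖ k) :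
    Units.mapEquiv (twist u ϖ) x ∈ levelUnits u ϖ k := by
  obtain ⟨y, hy⟩ := hx
  refine ⟨twist u ϖ y, ?_⟩
  rw [Units.coe_mapEquiv, hy, ← Algebra.smul_def, ← Algebra.smul_def]
  ext <;> simp [twist]

variable [IsLocalRing R]

/-- The residue field of the maximal order. -/
abbrev Residue (u : R) : Type _ := QuadraticAlgebra (ResidueField R) (residue R u) 0

/-- Reduction of the maximal order modulo its maximal ideal. -/
noncomputable def res (hϖ : residue R ϖ = 0) : ℍ[R,u,0,ϖ] →+* Residue u where
  toFun x := ⟨residue R x.re, residue R x.imI⟩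
  map_one' := by ext <;> simp
  map_zero' := by ext <;> simp
  map_add' x y := by ext <;> simp
  map_mul' x y := by ext <;> simp [hϖ]

theorem res_surjective (hϖ : residue R ϖ = 0) :
    Function.Surjective (res hϖ : ℍ[R,u,0,ϖ] →+* Residue u) := by
  rintro ⟨a, b⟩
  obtain ⟨a, rfl⟩ := residue_surjective a
  obtain ⟨b, rfl⟩ := residue_surjective b
  exact ⟨⟨a, b, 0, 0⟩, rfl⟩

/-- Modulo ϖ the reduced norm is re² - u imI², which is anisotropic because u is a non-square. So x
is a unit as soon as its reduction is non-zero, with inverse its conjugate over its norm. -/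
theorem isUnit_iff (hϖ : residue R ϖ = 0) (hu : ¬ IsSquare (residue R u)) (x : ℍ[R,u,0,ϖ]) :
    IsUnit x ↔ res hϖ x ≠ 0 := by
  constructor
  · intro h
    exact (h.map (res hϖ)).ne_zero
  · intro h
    have hn : residue R (nrd x) ≠ 0 := by
      intro h0
      have h1 : residue R x.re ^ 2 = residue R u * residue R x.imI ^ 2 := by
        simp only [nrd, map_add, map_sub, map_mul, map_pow, hϖ] at h0
        linear_combination h0
      by_cases hI : residue R x.imI = 0
      · refine h ?_
        rw [hI] at h1
        have h2 : residue R x.re = 0 := by simpa using h1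
        ext
        · exact h2
        · exact hI
      · refine hu ⟨residue R x.re / residue R x.imI, ?_⟩
        field_simp
        exact h1.symm
    obtain ⟨w, hw⟩ := (residue_ne_zero_iff_isUnit _).1 hn
    have hw' : algebraMap R ℍ[R,u,0,ϖ] (nrd x) * algebraMap R _ (↑w⁻¹ : R) = 1 := by
      rw [← map_mul, ← hw, Units.mul_inv, map_one]
    refine ⟨⟨x, conj x * algebraMap R _ (↑w⁻¹ : R), ?_, ?_⟩, rfl⟩
    · rw [← mul_assoc, mul_conj, hw']
    · rw [mul_assoc, Algebra.commutes, ← mul_assoc, conj_mul, hw']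

/-- x² - 1 = (x - 1)(x + 1), and x + 1 reduces to 2, so it is a unit. -/
theorem mem_levelUnits_of_sq_mem (hϖ : residue R ϖ = 0) (hu : ¬ IsSquare (residue R u))
    (h2 : (2 : ResidueField R) ≠ 0) {k : ℕ} {x : ℍ[R,u,0,ϖ]ˣ} (hx : res hϖ (x : ℍ[R,u,0,ϖ]) = 1)
    (hsq : x ^ 2 ∈ levelUnits u ϖ k) : x ∈ levelUnits u ϖ k := by
  obtain ⟨y, hy⟩ := hsq
  have hunit : IsUnit ((x : ℍ[R,u,0,ϖ]) + 1) := by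
    rw [isUnit_iff hϖ hu, map_add, map_one, hx, one_add_one_eq_two]
    intro h
    have := congrArg QuadraticAlgebra.re h
    rw [← one_add_one_eq_two] at this
    simp [one_add_one_eq_two] at this
    exact h2 this
  obtain ⟨w, hw⟩ := hunit
  refine ⟨y * ↑w⁻¹, ?_⟩
  have h1 : ((x : ℍ[R,u,0,ϖ]) - 1) * w = algebraMap R _ (ϖ ^ k) * y := by
    rw [hw, sub_mul, mul_add, ← sq, mul_one, one_mul, ← Units.val_pow_eq_pow_val, hy]
    abel
  rw [← mul_assoc, ← h1, Units.mul_inv_cancel_right]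
  abel

theorem res_eq_one_of_mem (hϖ : residue R ϖ = 0) {k : ℕ} (hk : k ≠ 0) {x : ℍ[R,u,0,ϖ]ˣ}
    (hx : x ∈ levelUnits u ϖ k) : res hϖ (x : ℍ[R,u,0,ϖ]) = 1 := by
  obtain ⟨y, hy⟩ := hx
  rw [hy, ← Algebra.smul_def]
  ext <;> simp [res, hϖ, hk]

end Order

/-! ### Frobenius on a quadratic extension of a finite field -/

section FiniteField

variable {K : Type*} [Field K] {d : K}

theorem fact_of_not_isSquare (hd : ¬ IsSquare d) : Fact (∀ r : K, r ^ 2 ≠ d + 0 * r) :=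
  ⟨fun r h => hd ⟨r, by rw [← sq, h, zero_mul, add_zero]⟩⟩

theorem card_quadraticAlgebra (d : K) :
    Nat.card (QuadraticAlgebra K d 0) = Nat.card K ^ 2 := by
  rw [Nat.card_congr (QuadraticAlgebra.equivProd _ _), Nat.card_prod, sq]

theorem quadraticAlgebra_pow_card [Finite K] (hd : ¬ IsSquare d) (w : QuadraticAlgebra K d 0) :
    w ^ Nat.card K = ⟨w.re, -w.im⟩ := by
  have := fact_of_not_isSquare hd
  let := Fintype.ofFinite K
  have : Finite (QuadraticAlgebra K d 0) :=
    Finite.of_equiv _ (QuadraticAlgebra.equivProd _ _).symm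
  let := Fintype.ofFinite (QuadraticAlgebra K d 0)
  let q := Fintype.card K
  let φ : QuadraticAlgebra K d 0 →ₐ[K] QuadraticAlgebra K d 0 :=
    FiniteField.frobeniusAlgHom K _
  have hφ : ∀ w, φ w = w ^ q := fun w => rfl
  let η : QuadraticAlgebra K d 0 := ⟨0, 1⟩
  have hη2 : η * η = algebraMap K _ d := by
    ext <;> simp [η]
  have hdecomp : ∀ w : QuadraticAlgebra K d 0,
      w = algebraMap K _ w.re + algebraMap K _ w.im * η := by
    intro w
    ext <;> simp [η]
  have hφη : φ η = -η := by
    have h1 : φ η * φ η = η * η := by rw [← map_mul, hη2, AlgHom.commutes]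
    rcases mul_self_eq_mul_self_iff.1 h1 with h | h
    -- If Frobenius fixed √d, all q² elements would be roots of X ^ q - X.
    · exfalso
      have hid : ∀ w : QuadraticAlgebra K d 0, w ^ q = w := by
        intro w
        rw [← hφ, hdecomp w, map_add, map_mul, h, AlgHom.commutes, AlgHom.commutes]
      have hq : 1 < q := Fintype.one_lt_card
      have h3 := FiniteField.X_pow_card_sub_X_natDegree_eq (QuadraticAlgebra K d 0) hq
      have h4 := FiniteField.X_pow_card_sub_X_ne_zero (QuadraticAlgebra K d 0) hq
      have h5 : Fintype.card (QuadraticAlgebra K d 0) ≤ q := by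
        rw [← h3, ← Finset.card_univ]
        refine Polynomial.card_le_degree_of_subset_roots ?_
        intro w _
        rw [Polynomial.mem_roots h4]
        simp [Polynomial.IsRoot, hid w]
      have h6 := card_quadraticAlgebra d
      rw [Nat.card_eq_fintype_card, Nat.card_eq_fintype_card] at h6
      rw [h6] at h5
      nlinarith
    · exact h
  rw [Nat.card_eq_fintype_card]
  change w ^ q = _
  rw [← hφ]
  conv_lhs => rw [hdecomp w, map_add, map_mul, hφη, AlgHom.commutes, AlgHom.commutes]
  ext <;> simp [η]

end FiniteField

/-- This is where the action of P on ℤ/n by q originates: conjugation by j negates i, which is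
Frobenius on the residue field. -/
theorem res_twist {R : Type*} [CommRing R] [IsLocalRing R] {u ϖ : R} [Finite (ResidueField R)]
    (hϖ : residue R ϖ = 0) (hu : ¬ IsSquare (residue R u)) (x : ℍ[R,u,0,ϖ]) :
    res hϖ (twist u ϖ x) = res hϖ x ^ Nat.card (ResidueField R) := by
  rw [quadraticAlgebra_pow_card hu]
  ext <;> simp [res, twist]

end QuaternionOrder

/-! ### Valuation and leading coefficient in an extension by `ℤ` -/

/-- Every g is uniquely f(x) P ^ m; the valuation is m and the leading coefficient is θ(x). Moving P
^ m past f(y) applies τ ^ m to y, whence the factor q ^ m in the crossed law. -/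
theorem exists_valuation_leading {G K : Type*} [Group G] [Group K] {n q : ℕ} {f : K →* G}
    (hf : Function.Injective f) {P : G} {τ : MulAut K}
    (hτ : ∀ x, f (τ x) = P * f x * P⁻¹) (hsurj : ∀ g, ∃ (m : ℤ) (x : K), g = f x * P ^ m)
    (htriv : ∀ (m : ℤ) (x : K), P ^ m = f x → m = 0) {θ : K →* Multiplicative (ZMod n)}
    {qu : (ZMod n)ˣ} (hqu : (qu : ZMod n) = q) (hθ : ∀ x, θ (τ x) = θ x ^ q) :
    ∃ (v : G → ℤ) (lam : G → ZMod n), (∀ g h, v (g * h) = v g + v h) ∧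
      (∀ g h, lam (g * h) = lam g + ((qu ^ v g : (ZMod n)ˣ) : ZMod n) * lam h) ∧
      ∀ x m, v (f x * P ^ m) = m ∧ lam (f x * P ^ m) = Multiplicative.toAdd (θ x) := by
  have hτm : ∀ (m : ℤ) x, f ((τ ^ m) x) = P ^ m * f x * P ^ (-m) := by
    intro m
    induction m using Int.induction_on with
    | zero => simp
    | succ m ih =>
      intro x
      rw [zpow_add_one, MulAut.mul_apply, ih, hτ]
      group
    | pred m ih =>
      intro x
      have h := hτ (τ⁻¹ x)
      rw [MulAut.apply_inv_self] at h
      rw [zpow_sub_one, MulAut.mul_apply, ih, eq_comm, h]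
      group
  have hθm : ∀ (m : ℤ) x, Multiplicative.toAdd (θ ((τ ^ m) x)) =
      ((qu ^ m : (ZMod n)ˣ) : ZMod n) * Multiplicative.toAdd (θ x) := by
    have h1 : ∀ x, Multiplicative.toAdd (θ (τ x)) = qu * Multiplicative.toAdd (θ x) := fun x => by
      rw [hθ, toAdd_pow, hqu, nsmul_eq_mul]
    intro m
    induction m using Int.induction_on with
    | zero => simp
    | succ m ih =>
      intro x
      rw [zpow_add_one, MulAut.mul_apply, ih, h1, zpow_add_one, Units.val_mul, mul_assoc]
    | pred m ih =>
      intro x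
      have h := h1 (τ⁻¹ x)
      rw [MulAut.apply_inv_self] at h
      rw [zpow_sub_one, MulAut.mul_apply, ih, zpow_sub_one, Units.val_mul, mul_assoc, h,
        Units.inv_mul_cancel_left]
  have huniq : ∀ x y (m l : ℤ), f x * P ^ m = f y * P ^ l → m = l ∧ x = y := by
    intro x y m l h
    have h1 : P ^ (m - l) = f (x⁻¹ * y) := by
      rw [map_mul, map_inv, zpow_sub, eq_inv_mul_iff_mul_eq, ← mul_assoc, h, mul_inv_cancel_right]
    have h2 := htriv _ _ h1
    have h3 : m = l := by omega
    subst h3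
    exact ⟨rfl, hf (mul_right_cancel h)⟩
  choose v lead hlead using hsurj
  have hval : ∀ x m, v (f x * P ^ m) = m ∧ lead (f x * P ^ m) = x := fun x m => by
    have := huniq _ _ _ _ (hlead (f x * P ^ m))
    exact ⟨this.1.symm, this.2.symm⟩
  have hmul : ∀ g h, g * h = f (lead g * (τ ^ v g) (lead h)) * P ^ (v g + v h) := by
    intro g h
    conv_lhs => rw [hlead g, hlead h]
    rw [map_mul, hτm, zpow_add]
    group
  refine ⟨v, fun g => Multiplicative.toAdd (θ (lead g)), fun g h => ?_, fun g h => ?_,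
    fun x m => ⟨(hval x m).1, congrArg (fun y => Multiplicative.toAdd (θ y)) (hval x m).2⟩⟩
  · rw [hmul, (hval _ _).1]
  · change Multiplicative.toAdd (θ (lead (g * h))) = _
    rw [hmul, (hval _ _).2, map_mul, toAdd_mul, hθm]

/-- By Cauchy's theorem an even index would give an element of order two in the quotient. -/
theorem Subgroup.odd_relIndex {G : Type*} [Group G] {U V : Subgroup G} [V.Normal]
    [Finite (U ⧸ V.subgroupOf U)] (h : ∀ x ∈ U, x ^ 2 ∈ V → x ∈ V) : Odd (V.relIndex U) := by
  rw [← Nat.not_even_iff_odd, even_iff_two_dvd]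
  intro hdvd
  have : Fact (Nat.Prime 2) := ⟨Nat.prime_two⟩
  obtain ⟨x, hx⟩ := exists_prime_orderOf_dvd_card' (G := U ⧸ V.subgroupOf U) 2 hdvd
  obtain ⟨y, rfl⟩ := QuotientGroup.mk_surjective x
  rw [orderOf_eq_prime_iff] at hx
  refine hx.2 ((QuotientGroup.eq_one_iff _).2 (Subgroup.mem_subgroupOf.2 (h y y.2 ?_)))
  have := (QuotientGroup.eq_one_iff (y ^ 2)).1 hx.1
  exact Subgroup.mem_subgroupOf.1 this

/-! ### The maximal order in the division algebra -/

namespace QuaternionDivision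

open IsLocalRing Quaternion ValuativeRel QuaternionOrder

namespace IsStandard

section Field

variable {F : Type*} [Field F] {D : Type*} [DivisionRing D] [Algebra F D] {a b : F} {i j : D}

/-- The quaternionic basis given by `i` and `j`. -/
def basis (h : IsStandard a b i j) : QuaternionAlgebra.Basis D a 0 b where
  i := i
  j := j
  k := i * j
  i_mul_i := by rw [h.i_mul_i, zero_smul, add_zero, Algebra.algebraMap_eq_smul_one]
  j_mul_j := by rw [h.j_mul_j, Algebra.algebraMap_eq_smul_one]
  i_mul_j := rfl
  j_mul_i := by rw [zero_smul, zero_sub, h.i_mul_j, neg_neg]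

theorem eq_zero_of_add_smul (h2 : (2 : F) ≠ 0) (h : IsStandard a b i j) {p q : F}
    (hpq : algebraMap F D p + q • i = 0) : p = 0 ∧ q = 0 := by
  have hq : q = 0 := by
    by_contra hq
    refine h.i_notMem h2 ⟨-(q⁻¹ * p), ?_⟩
    have h1 : q • i = -algebraMap F D p := by rwa [eq_neg_iff_add_eq_zero, add_comm]
    rw [← inv_smul_smul₀ hq i, h1, map_neg, map_mul, smul_neg, Algebra.smul_def]
  subst hq
  simpa using hpq

/-- Write an element as X = L + M j with L, M in F + F i. Then i X + X i = 2 i L, so X = 0 forces L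
= 0 and then M = 0. -/
theorem liftHom_injective (h2 : (2 : F) ≠ 0) (h : IsStandard a b i j) :
    Function.Injective h.basis.liftHom := by
  rw [injective_iff_map_eq_zero]
  rintro ⟨p, q, r, s⟩ hx
  have hx' : (algebraMap F D p + q • i) + (algebraMap F D r + s • i) * j = 0 := by
    rw [add_mul, smul_mul_assoc, ← Algebra.smul_def, ← add_assoc]
    exact hx
  obtain ⟨L, hL⟩ : ∃ L, L = algebraMap F D p + q • i := ⟨_, rfl⟩
  obtain ⟨M, hM⟩ : ∃ M, M = algebraMap F D r + s • i := ⟨_, rfl⟩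
  rw [← hL, ← hM] at hx'
  have hcomm : ∀ p q : F, i * (algebraMap F D p + q • i) = (algebraMap F D p + q • i) * i := by
    intro p q
    rw [mul_add, add_mul, mul_smul_comm, smul_mul_assoc, Algebra.commutes]
  have h3 : 2 * (i * L) = 0 := by
    have h4 : i * (L + M * j) + (L + M * j) * i = 2 * (i * L) := by
      have h5 : i * M = M * i := by rw [hM, hcomm]
      have h6 : L * i = i * L := by rw [hL, hcomm]
      have h7 : M * j * i = -(i * (M * j)) := by
        rw [← mul_assoc, h5, mul_assoc, mul_assoc, h.i_mul_j, mul_neg, neg_neg]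
      rw [mul_add, add_mul, h6, h7, two_mul]
      abel
    rw [← h4, hx', mul_zero, zero_mul, add_zero]
  have h2D : (2 : D) ≠ 0 := by
    rw [← map_ofNat (algebraMap F D) 2]
    simpa using h2
  have hL0 : L = 0 := by simpa [h2D, h.i_ne_zero] using h3
  have hM0 : M = 0 := by
    rw [hL0, zero_add] at hx'
    simpa [h.symm.i_ne_zero] using hx'
  obtain ⟨rfl, rfl⟩ := h.eq_zero_of_add_smul h2 (hL.symm.trans hL0)
  obtain ⟨rfl, rfl⟩ := h.eq_zero_of_add_smul h2 (hM.symm.trans hM0)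
  rfl

/-- The division algebra as a quaternion algebra. -/
noncomputable def equiv (h : IsStandard a b i j) (h2 : (2 : F) ≠ 0)
    (hD : Module.finrank F D = 4) : ℍ[F,a,0,b] ≃ₐ[F] D :=
  have : Module.Finite F D := Module.finite_of_finrank_pos (by omega)
  AlgEquiv.ofBijective h.basis.liftHom ⟨h.liftHom_injective h2,
    (LinearMap.injective_iff_surjective_of_finrank_eq_finrank
      (f := h.basis.liftHom.toLinearMap)
      (by rw [hD, QuaternionAlgebra.finrank_eq_four])).1 (h.liftHom_injective h2)⟩

end Field

section LocalField

variable {F : Type*} [Field F] [ValuativeRel F] {D : Type*} [DivisionRing D] [Algebra F D]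
  {u ϖ : 𝒪[F]} {i j : D}

/-- The quaternionic basis over the ring of integers. -/
def integerBasis (h : IsStandard (u : F) (ϖ : F) i j) : QuaternionAlgebra.Basis D u 0 ϖ where
  i := i
  j := j
  k := i * j
  i_mul_i := by rw [zero_smul, add_zero, ← Algebra.algebraMap_eq_smul_one]; exact h.i_mul_i
  j_mul_j := by rw [← Algebra.algebraMap_eq_smul_one]; exact h.j_mul_j
  i_mul_j := rfl
  j_mul_i := by rw [zero_smul, zero_sub, h.i_mul_j, neg_neg]

/-- The inclusion of the maximal order. -/
noncomputable def orderHom (h : IsStandard (u : F) (ϖ : F) i j) : ℍ[𝒪[F],u,0,ϖ] →ₐ[𝒪[F]] D :=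
  h.integerBasis.liftHom

theorem orderHom_mk (h : IsStandard (u : F) (ϖ : F) i j) (h2 : (2 : F) ≠ 0)
    (hD : Module.finrank F D = 4) (x : ℍ[𝒪[F],u,0,ϖ]) :
    h.orderHom x = h.equiv h2 hD ⟨x.re, x.imI, x.imJ, x.imK⟩ := rfl

theorem orderHom_injective (h2 : (2 : F) ≠ 0) (h : IsStandard (u : F) (ϖ : F) i j) :
    Function.Injective h.orderHom := by
  intro x y hxy
  have h1 := h.liftHom_injective h2 (a₁ := ⟨x.re, x.imI, x.imJ, x.imK⟩)
    (a₂ := ⟨y.re, y.imI, y.imJ, y.imK⟩) hxy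
  rw [QuaternionAlgebra.mk.injEq] at h1
  ext
  · exact h1.1
  · exact h1.2.1
  · exact h1.2.2.1
  · exact h1.2.2.2

/-- The square root of the uniformizer in the maximal order. -/
noncomputable def unif (u ϖ : 𝒪[F]) : ℍ[𝒪[F],u,0,ϖ] := ⟨0, 0, 1, 0⟩

theorem orderHom_unif (h : IsStandard (u : F) (ϖ : F) i j) : h.orderHom (unif u ϖ) = j := by
  change algebraMap 𝒪[F] D 0 + (0 : 𝒪[F]) • i + (1 : 𝒪[F]) • j + (0 : 𝒪[F]) • (i * j) = j
  simp

theorem unif_sq (u ϖ : 𝒪[F]) : unif u ϖ ^ 2 = algebraMap _ _ ϖ := by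
  rw [sq]
  ext <;> simp [unif]

theorem orderHom_twist (h : IsStandard (u : F) (ϖ : F) i j) (x : ℍ[𝒪[F],u,0,ϖ]) :
    h.orderHom (twist u ϖ x) = j * h.orderHom x * j⁻¹ := by
  have h1 : twist u ϖ x * unif u ϖ = unif u ϖ * x := by
    ext <;> simp [twist, unif]
  have h2 := congrArg h.orderHom h1
  rwa [map_mul, map_mul, orderHom_unif, ← eq_mul_inv_iff_mul_eq₀ h.symm.i_ne_zero] at h2

/-- The units of the maximal order as elements of the multiplicative group. -/
noncomputable def unitsHom (h : IsStandard (u : F) (ϖ : F) i j) : ℍ[𝒪[F],u,0,ϖ]ˣ →* Dˣ :=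
  Units.map (h.orderHom : ℍ[𝒪[F],u,0,ϖ] →* D)

theorem unitsHom_injective (h2 : (2 : F) ≠ 0) (h : IsStandard (u : F) (ϖ : F) i j) :
    Function.Injective h.unitsHom :=
  Units.map_injective (h.orderHom_injective h2)

/-- The element `j` as a unit. -/
noncomputable def unifUnit (h : IsStandard (u : F) (ϖ : F) i j) : Dˣ :=
  Units.mk0 j h.symm.i_ne_zero

theorem unitsHom_twist (h : IsStandard (u : F) (ϖ : F) i j) (x : ℍ[𝒪[F],u,0,ϖ]ˣ) :
    h.unitsHom (Units.mapEquiv (twist u ϖ) x) = h.unifUnit * h.unitsHom x * h.unifUnit⁻¹ := by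
  ext
  rw [Units.val_mul, Units.val_mul, Units.val_inv_eq_inv_val]
  exact h.orderHom_twist x

variable [TopologicalSpace F] [IsNonarchimedeanLocalField F]

theorem exists_pow_mul_mem (hϖ : Irreducible ϖ) (f : F) :
    ∃ (k : ℕ) (r : 𝒪[F]), (ϖ : F) ^ k * f = r := by
  obtain ⟨a, b, hb, rfl⟩ := IsFractionRing.div_surjective (A := 𝒪[F]) f
  have hb0 : b ≠ 0 := nonZeroDivisors.ne_zero hb
  obtain ⟨k, w, hw⟩ := IsDiscreteValuationRing.associated_pow_irreducible hb0 hϖ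
  refine ⟨k, w * a, ?_⟩
  have hb' : (b : F) ≠ 0 := by simpa using hb0
  have hw' : (b : F) * ((w : 𝒪[F]) : F) = (ϖ : F) ^ k := congrArg Subtype.val hw
  change (ϖ : F) ^ k * ((a : F) / (b : F)) = ((w : 𝒪[F]) : F) * a
  rw [← hw']
  field_simp

theorem exists_pow_smul_mem (h : IsStandard (u : F) (ϖ : F) i j) (h2 : (2 : F) ≠ 0)
    (hD : Module.finrank F D = 4) (hϖ : Irreducible ϖ) (g : D) :
    ∃ (k : ℕ) (y : ℍ[𝒪[F],u,0,ϖ]), (ϖ : F) ^ k • g = h.orderHom y := by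
  obtain ⟨⟨x₀, x₁, x₂, x₃⟩, rfl⟩ := (h.equiv h2 hD).surjective g
  obtain ⟨k₀, r₀, h₀⟩ := exists_pow_mul_mem hϖ x₀
  obtain ⟨k₁, r₁, h₁⟩ := exists_pow_mul_mem hϖ x₁
  obtain ⟨k₂, r₂, h₂⟩ := exists_pow_mul_mem hϖ x₂
  obtain ⟨k₃, r₃, h₃⟩ := exists_pow_mul_mem hϖ x₃
  refine ⟨k₀ + k₁ + k₂ + k₃, ⟨ϖ ^ (k₁ + k₂ + k₃) * r₀, ϖ ^ (k₀ + k₂ + k₃) * r₁,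
    ϖ ^ (k₀ + k₁ + k₃) * r₂, ϖ ^ (k₀ + k₁ + k₂) * r₃⟩, ?_⟩
  rw [h.orderHom_mk h2 hD, ← map_smul]
  congr 1
  ext
  · change (ϖ : F) ^ _ * x₀ = (ϖ : F) ^ _ * r₀
    rw [← h₀]
    ring
  · change (ϖ : F) ^ _ * x₁ = (ϖ : F) ^ _ * r₁
    rw [← h₁]
    ring
  · change (ϖ : F) ^ _ * x₂ = (ϖ : F) ^ _ * r₂
    rw [← h₂]
    ring
  · change (ϖ : F) ^ _ * x₃ = (ϖ : F) ^ _ * r₃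
    rw [← h₃]
    ring

theorem residue_eq_zero (hϖ : Irreducible ϖ) : residue 𝒪[F] ϖ = 0 := by
  rw [residue_eq_zero_iff]
  exact hϖ.not_isUnit

theorem dvd_of_residue_eq_zero (hϖ : Irreducible ϖ) {r : 𝒪[F]} (hr : residue 𝒪[F] r = 0) :
    ϖ ∣ r := by
  rwa [residue_eq_zero_iff, hϖ.maximalIdeal_eq, Ideal.mem_span_singleton] at hr

theorem exists_eq_mul_unif (hϖ : Irreducible ϖ) {y : ℍ[𝒪[F],u,0,ϖ]}
    (hy : res (residue_eq_zero hϖ) y = 0) : ∃ x, y = x * unif u ϖ := by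
  obtain ⟨a, ha⟩ := dvd_of_residue_eq_zero hϖ (congrArg QuadraticAlgebra.re hy)
  obtain ⟨b, hb⟩ := dvd_of_residue_eq_zero hϖ (congrArg QuadraticAlgebra.im hy)
  -- Right multiplication by j shifts the coordinates, and j² = ϖ supplies the factor ϖ in the first
  -- two.
  refine ⟨⟨y.imJ, y.imK, a, b⟩, ?_⟩
  ext <;> simp [unif, ha, hb]

theorem exists_eq_mul_unif_pow (hϖ : Irreducible ϖ) {y : ℍ[𝒪[F],u,0,ϖ]} (hy : y ≠ 0) :
    ∃ (n : ℕ) (x : ℍ[𝒪[F],u,0,ϖ]), res (residue_eq_zero hϖ) x ≠ 0 ∧ y = x * unif u ϖ ^ n := by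
  by_contra! hcon
  have h1 : ∀ n : ℕ, ∃ x, y = x * unif u ϖ ^ n := by
    intro n
    induction n with
    | zero => exact ⟨y, by simp⟩
    | succ n ih =>
      obtain ⟨x, hx⟩ := ih
      obtain ⟨z, rfl⟩ := exists_eq_mul_unif hϖ (not_not.1 fun h0 => hcon n x h0 hx)
      exact ⟨z, by rw [hx, pow_succ', mul_assoc]⟩
  -- Divisibility by all powers of j gives divisibility of every coordinate by all powers of ϖ = j².
  have h2 : ∀ n : ℕ, ∃ x : ℍ[𝒪[F],u,0,ϖ], y = ϖ ^ n • x := by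
    intro n
    obtain ⟨x, hx⟩ := h1 (2 * n)
    refine ⟨x, ?_⟩
    rw [hx, pow_mul, unif_sq, ← map_pow, ← Algebra.commutes, Algebra.smul_def]
  have h3 : ∀ r : 𝒪[F], (∀ n, ϖ ^ n ∣ r) → r = 0 := by
    intro r hr
    by_contra h0
    exact (FiniteMultiplicity.of_not_isUnit hϖ.not_isUnit h0).not_pow_dvd_of_multiplicity_lt
      (Nat.lt_succ_self _) (hr _)
  refine hy ?_
  choose x hx using h2
  ext
  · exact congrArg Subtype.val <| h3 _ fun n => ⟨(x n).re, congrArg QuaternionAlgebra.re (hx n)⟩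
  · exact congrArg Subtype.val <| h3 _ fun n => ⟨(x n).imI, congrArg QuaternionAlgebra.imI (hx n)⟩
  · exact congrArg Subtype.val <| h3 _ fun n => ⟨(x n).imJ, congrArg QuaternionAlgebra.imJ (hx n)⟩
  · exact congrArg Subtype.val <| h3 _ fun n => ⟨(x n).imK, congrArg QuaternionAlgebra.imK (hx n)⟩

theorem exists_eq_unitsHom_mul_zpow (h : IsStandard (u : F) (ϖ : F) i j) (h2 : (2 : F) ≠ 0)
    (hD : Module.finrank F D = 4) (hϖ : Irreducible ϖ) (hu : ¬ IsSquare (residue 𝒪[F] u))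
    (g : Dˣ) : ∃ (m : ℤ) (x : ℍ[𝒪[F],u,0,ϖ]ˣ), g = h.unitsHom x * h.unifUnit ^ m := by
  obtain ⟨k, y, hy⟩ := h.exists_pow_smul_mem h2 hD hϖ (g : D)
  have hy0 : y ≠ 0 := by
    rintro rfl
    rw [map_zero] at hy
    exact smul_ne_zero (pow_ne_zero _ h.ne_right) g.ne_zero hy
  obtain ⟨n, x, hx, rfl⟩ := exists_eq_mul_unif_pow hϖ hy0
  obtain ⟨x, rfl⟩ := (isUnit_iff (residue_eq_zero hϖ) hu x).2 hx
  refine ⟨n - 2 * k, x, ?_⟩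
  -- The denominator ϖ ^ k is the power j ^ (2k), which accounts for the shift by 2k in the
  -- exponent.
  have hP : (h.unifUnit ^ (2 * k) : D) = algebraMap F D ((ϖ : F) ^ k) := by
    rw [pow_mul, map_pow, ← h.j_mul_j, ← sq]
    rfl
  have h1 : g * h.unifUnit ^ (2 * k) = h.unitsHom x * h.unifUnit ^ n := by
    ext
    rw [Units.val_mul, Units.val_pow_eq_pow_val, hP, ← Algebra.commutes, ← Algebra.smul_def, hy,
      map_mul, map_pow, h.orderHom_unif]
    rfl
  rw [zpow_sub, ← mul_assoc, eq_mul_inv_iff_mul_eq]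
  exact_mod_cast h1

/-- A positive power of j reduces to zero in the residue field, and a unit of the order does not. -/
theorem eq_zero_of_zpow_eq (h : IsStandard (u : F) (ϖ : F) i j) (h2 : (2 : F) ≠ 0)
    (hϖ : Irreducible ϖ) {m : ℤ} {x : ℍ[𝒪[F],u,0,ϖ]ˣ} (hm : h.unifUnit ^ m = h.unitsHom x) :
    m = 0 := by
  have key : ∀ (n : ℕ) (x : ℍ[𝒪[F],u,0,ϖ]ˣ), h.unifUnit ^ n = h.unitsHom x → n = 0 := by
    intro n x hn
    by_contra hn0
    have h1 : unif u ϖ ^ n = x := by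
      refine h.orderHom_injective h2 ?_
      rw [map_pow, orderHom_unif]
      exact congrArg Units.val hn
    have h3 := congrArg (res (residue_eq_zero hϖ)) h1
    have h4 : res (residue_eq_zero hϖ) (unif u ϖ) = 0 := by
      ext <;> simp [res, unif]
    rw [map_pow, h4, zero_pow hn0] at h3
    exact (x.isUnit.map (res (residue_eq_zero hϖ))).ne_zero h3.symm
  obtain ⟨n, rfl | rfl⟩ := m.eq_nat_or_neg
  · rw [zpow_natCast] at hm
    rw [key n x hm, Nat.cast_zero]
  · rw [zpow_neg, zpow_natCast, inv_eq_iff_eq_inv, ← map_inv] at hm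
    rw [key n _ hm, Nat.cast_zero, neg_zero]

end LocalField

end IsStandard

end QuaternionDivision

/-! ### Neighbourhoods of zero in a local field -/

namespace OddLocalField

open IsLocalRing ValuativeRel Topology

variable {F : Type*} [Field F] [ValuativeRel F] [TopologicalSpace F] [IsNonarchimedeanLocalField F]

theorem t2Space (F : Type*) [Field F] [ValuativeRel F] [TopologicalSpace F]
    [IsNonarchimedeanLocalField F] : T2Space F := by
  let := IsTopologicalAddGroup.rightUniformSpace F
  have := isUniformAddGroup_of_addCommGroup (G := F)
  infer_instance

theorem hasAntitoneBasis_nhds_zero {ϖ : 𝒪[F]} (hϖ : Irreducible ϖ) :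
    (𝓝 (0 : F)).HasAntitoneBasis fun k : ℕ => {f : F | ∃ r : 𝒪[F], f = (ϖ : F) ^ k * r} := by
  have h0 : (ϖ : F) ≠ 0 := by simpa using hϖ.ne_zero
  have hlt : valuation F ϖ < 1 := Valuation.Integer.not_isUnit_iff_valuation_lt_one.1 hϖ.not_isUnit
  refine ⟨⟨fun t => ⟨fun ht => ?_, ?_⟩⟩, ?_⟩
  · obtain ⟨γ, hγ, hsub⟩ := (IsValuativeTopology.hasBasis_nhds_zero' F).mem_iff.1 ht
    obtain ⟨k, hk⟩ := exists_pow_lt₀ hlt (Units.mk0 γ hγ)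
    refine ⟨k, trivial, ?_⟩
    rintro _ ⟨r, rfl⟩
    refine hsub ?_
    change valuation F ((ϖ : F) ^ k * r) < γ
    rw [map_mul, map_pow]
    exact lt_of_le_of_lt (mul_le_of_le_one_right' r.2) hk
  · rintro ⟨k, -, hsub⟩
    refine Filter.mem_of_superset ((IsValuativeTopology.hasBasis_nhds_zero' F).mem_of_mem
      (i := valuation F ((ϖ : F) ^ k)) ((Valuation.ne_zero_iff _).2 (pow_ne_zero _ h0))) ?_
    intro f hf
    refine hsub ⟨⟨((ϖ : F) ^ k)⁻¹ * f, ?_⟩, ?_⟩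
    · rw [Valuation.mem_integer_iff, map_mul, map_inv₀]
      refine inv_mul_le_one_of_le₀ (le_of_lt hf) zero_le
    · change f = (ϖ : F) ^ k * (((ϖ : F) ^ k)⁻¹ * f)
      rw [mul_inv_cancel_left₀ (pow_ne_zero _ h0)]
  · rintro k l hkl _ ⟨r, rfl⟩
    refine ⟨ϖ ^ (l - k) * r, ?_⟩
    change _ = (ϖ : F) ^ k * ((ϖ : F) ^ (l - k) * r)
    rw [← mul_assoc, ← pow_add, Nat.add_sub_cancel' hkl]

end OddLocalField

/-! ### Discrete logarithm on the residue field of the maximal order -/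

namespace QuaternionOrder

open IsLocalRing Quaternion

theorem exists_discreteLog {K : Type*} [Field K] [Finite K] {d : K} (hd : ¬ IsSquare d) :
    ∃ n, Nat.card K ^ 2 = n + 1 ∧
      Nonempty ((QuadraticAlgebra K d 0)ˣ ≃* Multiplicative (ZMod n)) := by
  have := fact_of_not_isSquare hd
  have : Finite (QuadraticAlgebra K d 0) :=
    Finite.of_equiv _ (QuadraticAlgebra.equivProd _ _).symm
  have hc : IsCyclic (QuadraticAlgebra K d 0)ˣ := inferInstance
  refine ⟨Nat.card (QuadraticAlgebra K d 0)ˣ, ?_, ⟨(zmodCyclicMulEquiv hc).symm⟩⟩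
  rw [← card_quadraticAlgebra d, Nat.card_units, Nat.sub_add_cancel Nat.card_pos]

theorem map_res_surjective {R : Type*} [CommRing R] [IsLocalRing R] {u ϖ : R}
    (hϖ : residue R ϖ = 0) (hu : ¬ IsSquare (residue R u)) :
    Function.Surjective (Units.map ((res hϖ : ℍ[R,u,0,ϖ] →+* Residue u) : ℍ[R,u,0,ϖ] →* Residue u)) := by
  intro w
  obtain ⟨x, hx⟩ := res_surjective hϖ (w : Residue u)
  obtain ⟨x, rfl⟩ := (isUnit_iff hϖ hu x).2 (by rw [hx]; exact w.ne_zero)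
  exact ⟨x, Units.ext hx⟩

end QuaternionOrder

/-! ### The topology of the division algebra in coordinates -/

namespace QuaternionDivision

open IsLocalRing Quaternion ValuativeRel QuaternionOrder Topology

namespace IsStandard

variable {F : Type*} [Field F] [ValuativeRel F] {D : Type*} [DivisionRing D] [Algebra F D]
  {u ϖ : 𝒪[F]} {i j : D}

/-- The coordinates on the division algebra. -/
noncomputable def coordEquiv (h : IsStandard (u : F) (ϖ : F) i j) (h2 : (2 : F) ≠ 0)
    (hD : Module.finrank F D = 4) : D ≃ₗ[F] (Fin 4 → F) :=
  (h.equiv h2 hD).symm.toLinearEquiv ≪≫ₗ QuaternionAlgebra.linearEquivTuple _ _ _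

theorem coordEquiv_symm_smul (h : IsStandard (u : F) (ϖ : F) i j) (h2 : (2 : F) ≠ 0)
    (hD : Module.finrank F D = 4) (c : F) (r : Fin 4 → 𝒪[F]) :
    (h.coordEquiv h2 hD).symm (fun l => c * r l) =
      c • h.orderHom ⟨r 0, r 1, r 2, r 3⟩ := by
  rw [h.orderHom_mk h2 hD, ← map_smul]
  rfl

theorem coordEquiv_orderHom (h : IsStandard (u : F) (ϖ : F) i j) (h2 : (2 : F) ≠ 0)
    (hD : Module.finrank F D = 4) (x : ℍ[𝒪[F],u,0,ϖ]) (l : Fin 4) :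
    ∃ r : 𝒪[F], h.coordEquiv h2 hD (h.orderHom x) l = r := by
  have h1 : h.coordEquiv h2 hD (h.orderHom x) =
      ![(x.re : F), (x.imI : F), (x.imJ : F), (x.imK : F)] := by
    rw [h.orderHom_mk h2 hD, coordEquiv, LinearEquiv.trans_apply, AlgEquiv.toLinearEquiv_apply,
      AlgEquiv.symm_apply_apply]
    rfl
  rw [h1]
  fin_cases l
  exacts [⟨_, rfl⟩, ⟨_, rfl⟩, ⟨_, rfl⟩, ⟨_, rfl⟩]

variable [TopologicalSpace F] [IsNonarchimedeanLocalField F] [TopologicalSpace D]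
  [IsModuleTopology F D]

/-- The coordinates as a homeomorphism. -/
noncomputable def coordHomeomorph (h : IsStandard (u : F) (ϖ : F) i j) (h2 : (2 : F) ≠ 0)
    (hD : Module.finrank F D = 4) : D ≃ₜ (Fin 4 → F) where
  toEquiv := (h.coordEquiv h2 hD).toEquiv
  continuous_toFun := IsModuleTopology.continuous_of_linearMap (h.coordEquiv h2 hD).toLinearMap
  continuous_invFun := by
    have : Module.Finite F D := Module.finite_of_finrank_pos (by omega)
    have := IsModuleTopology.isTopologicalRing F D
    exact IsModuleTopology.continuous_of_linearMap (h.coordEquiv h2 hD).symm.toLinearMap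

theorem t2Space (h : IsStandard (u : F) (ϖ : F) i j) (h2 : (2 : F) ≠ 0)
    (hD : Module.finrank F D = 4) : T2Space D := by
  have := OddLocalField.t2Space F
  exact T2Space.of_injective_continuous (h.coordHomeomorph h2 hD).injective
    (h.coordHomeomorph h2 hD).continuous

theorem isCompact_range_orderHom (h : IsStandard (u : F) (ϖ : F) i j) (h2 : (2 : F) ≠ 0)
    (hD : Module.finrank F D = 4) : IsCompact (Set.range h.orderHom) := by
  have h1 : IsCompact (Set.univ.pi fun _ : Fin 4 => (Set.range ((↑) : 𝒪[F] → F))) :=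
    isCompact_univ_pi fun _ => isCompact_range continuous_subtype_val
  convert! h1.image (h.coordHomeomorph h2 hD).symm.continuous using 1
  ext d
  constructor
  · rintro ⟨x, rfl⟩
    refine ⟨h.coordEquiv h2 hD (h.orderHom x), fun l _ => ?_,
      (h.coordEquiv h2 hD).symm_apply_apply _⟩
    obtain ⟨r, hr⟩ := h.coordEquiv_orderHom h2 hD x l
    exact ⟨r, hr.symm⟩
  · rintro ⟨f, hf, rfl⟩
    choose r hr using fun l => hf l trivial
    refine ⟨⟨r 0, r 1, r 2, r 3⟩, ?_⟩
    have h3 := h.coordEquiv_symm_smul h2 hD 1 r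
    simp only [one_mul, one_smul] at h3
    rw [← h3]
    exact congrArg _ (funext hr)

theorem smul_orderHom_mem_nhds (h : IsStandard (u : F) (ϖ : F) i j) (h2 : (2 : F) ≠ 0)
    (hD : Module.finrank F D = 4) (hϖ : Irreducible ϖ) (k : ℕ) :
    {d : D | ∃ y, d = (ϖ : F) ^ k • h.orderHom y} ∈ 𝓝 (0 : D) := by
  have h1 : (Set.univ.pi fun _ : Fin 4 => {f : F | ∃ r : 𝒪[F], f = (ϖ : F) ^ k * r}) ∈
      𝓝 (0 : Fin 4 → F) := set_pi_mem_nhds Set.finite_univ fun _ _ =>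
    (OddLocalField.hasAntitoneBasis_nhds_zero hϖ).mem k
  have h3 := (h.coordHomeomorph h2 hD).continuous.tendsto 0
  have h0 : h.coordHomeomorph h2 hD 0 = 0 := map_zero (h.coordEquiv h2 hD)
  rw [h0] at h3
  refine Filter.mem_of_superset (h3 h1) ?_
  intro d hd
  choose r hr using fun l => hd l trivial
  refine ⟨⟨r 0, r 1, r 2, r 3⟩, ?_⟩
  rw [← h.coordEquiv_symm_smul h2 hD, eq_comm, LinearEquiv.symm_apply_eq]
  exact (funext hr).symm

theorem exists_smul_orderHom_subset (h : IsStandard (u : F) (ϖ : F) i j) (h2 : (2 : F) ≠ 0)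
    (hD : Module.finrank F D = 4) (hϖ : Irreducible ϖ) {N : Set D} (hN : N ∈ 𝓝 (0 : D)) :
    ∃ k : ℕ, k ≠ 0 ∧ ∀ y, (ϖ : F) ^ k • h.orderHom y ∈ N := by
  have hb := OddLocalField.hasAntitoneBasis_nhds_zero hϖ
  have h3 := (h.coordHomeomorph h2 hD).symm.continuous.tendsto 0
  have h0 : (h.coordHomeomorph h2 hD).symm 0 = 0 := map_zero (h.coordEquiv h2 hD).symm
  rw [h0, nhds_pi] at h3
  obtain ⟨⟨I, k⟩, -, hk⟩ := (Filter.hasBasis_pi fun _ : Fin 4 => hb.toHasBasis).mem_iff.1 (h3 hN)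
  refine ⟨Finset.univ.sup k + 1, Nat.succ_ne_zero _, fun y => ?_⟩
  choose r hr using h.coordEquiv_orderHom h2 hD y
  have h4 : (ϖ : F) ^ (Finset.univ.sup k + 1) • h.orderHom y =
      (h.coordHomeomorph h2 hD).symm fun l => (ϖ : F) ^ (Finset.univ.sup k + 1) * r l := by
    refine ((h.coordEquiv h2 hD).symm_apply_eq.2 ?_).symm
    rw [map_smul]
    exact funext fun l => by rw [Pi.smul_apply, hr, smul_eq_mul]
  rw [h4]
  refine hk fun l _ => ?_
  exact hb.antitone ((Finset.le_sup (Finset.mem_univ l)).trans (Nat.le_succ _)) ⟨r l, rfl⟩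

theorem levelUnits_map_mem_nhds (h : IsStandard (u : F) (ϖ : F) i j) (h2 : (2 : F) ≠ 0)
    (hD : Module.finrank F D = 4) (hϖ : Irreducible ϖ) (hu : ¬ IsSquare (residue 𝒪[F] u))
    {k : ℕ} (hk : k ≠ 0) :
    (((levelUnits u ϖ k).map h.unitsHom : Subgroup Dˣ) : Set Dˣ) ∈ 𝓝 1 := by
  have : Module.Finite F D := Module.finite_of_finrank_pos (by omega)
  have := IsModuleTopology.isTopologicalRing F D
  have h1 : Filter.Tendsto (fun g : Dˣ => (g : D) - 1) (𝓝 1) (𝓝 0) := by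
    have : Continuous fun g : Dˣ => (g : D) - 1 := Units.continuous_val.sub continuous_const
    have := this.tendsto 1
    rwa [Units.val_one, sub_self] at this
  refine Filter.mem_of_superset (h1 (h.smul_orderHom_mem_nhds h2 hD hϖ k)) ?_
  rintro g ⟨y, hy⟩
  have h3 : IsUnit (1 + algebraMap _ _ (ϖ ^ k) * y : ℍ[𝒪[F],u,0,ϖ]) := by
    rw [isUnit_iff (residue_eq_zero hϖ) hu]
    have : res (residue_eq_zero hϖ) (1 + algebraMap _ _ (ϖ ^ k) * y : ℍ[𝒪[F],u,0,ϖ]) = 1 := by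
      rw [← Algebra.smul_def]
      ext <;> simp [res, residue_eq_zero hϖ, hk, QuadraticAlgebra.re_one, QuadraticAlgebra.im_one]
    rw [this]
    exact fun h0 => one_ne_zero (congrArg QuadraticAlgebra.re h0)
  obtain ⟨x, hx⟩ := h3
  refine ⟨x, ⟨y, hx⟩, ?_⟩
  ext
  change h.orderHom x = g
  rw [hx, map_add, map_one, ← Algebra.smul_def, map_smul, eq_comm, ← sub_eq_iff_eq_add']
  exact hy

/-- The topology of Dˣ also controls inverses. Because the level subgroups are closed under
inversion, one bound on 1 + ϖ ^ k y serves both coordinates. -/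
theorem exists_levelUnits_map_subset (h : IsStandard (u : F) (ϖ : F) i j) (h2 : (2 : F) ≠ 0)
    (hD : Module.finrank F D = 4) (hϖ : Irreducible ϖ) {W : Set Dˣ} (hW : W ∈ 𝓝 1) :
    ∃ k : ℕ, k ≠ 0 ∧ (((levelUnits u ϖ k).map h.unitsHom : Subgroup Dˣ) : Set Dˣ) ⊆ W := by
  have : Module.Finite F D := Module.finite_of_finrank_pos (by omega)
  have := IsModuleTopology.isTopologicalRing F D
  rw [Units.isInducing_embedProduct.nhds_eq_comap, Filter.mem_comap] at hW
  obtain ⟨N, hN, hNW⟩ := hW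
  rw [map_one] at hN
  obtain ⟨N₁, hN₁, N₂, hN₂, hN₁₂⟩ := mem_nhds_prod_iff.1 hN
  have hc : Continuous fun d : D => 1 + d := continuous_const.add continuous_id
  have h3 : Filter.Tendsto (fun d : D => 1 + d) (𝓝 0) (𝓝 1) := by
    have := hc.tendsto 0
    rwa [add_zero] at this
  have h4 : Filter.Tendsto (fun d : D => MulOpposite.op (1 + d)) (𝓝 0) (𝓝 1) := by
    have := (MulOpposite.continuous_op.comp hc).tendsto 0
    rwa [Function.comp_apply, add_zero] at this
  obtain ⟨k, hk0, hk⟩ := h.exists_smul_orderHom_subset h2 hD hϖ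
    (Filter.inter_mem (h3 hN₁) (h4 hN₂))
  have h5 : ∀ x ∈ levelUnits u ϖ k, ∃ y, (h.unitsHom x : D) = 1 + (ϖ : F) ^ k • h.orderHom y := by
    rintro x ⟨y, hy⟩
    refine ⟨y, ?_⟩
    change h.orderHom x = _
    rw [hy, map_add, map_one, ← Algebra.smul_def, map_smul]
    rfl
  refine ⟨k, hk0, ?_⟩
  rintro _ ⟨x, hx, rfl⟩
  refine hNW (hN₁₂ ⟨?_, ?_⟩)
  · obtain ⟨y, hy⟩ := h5 x hx
    change (h.unitsHom x : D) ∈ N₁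
    rw [hy]
    exact (hk y).1
  · obtain ⟨y, hy⟩ := h5 x⁻¹ (inv_mem hx)
    change MulOpposite.op (((h.unitsHom x)⁻¹ : Dˣ) : D) ∈ N₂
    rw [← map_inv, hy]
    exact (hk y).2

end IsStandard

end QuaternionDivision

/-! ### Principal units and the tame structure on Dˣ -/

namespace QuaternionDivision

open IsLocalRing Quaternion ValuativeRel QuaternionOrder Topology

namespace IsStandard

variable {F : Type*} [Field F] [ValuativeRel F] [TopologicalSpace F] [IsNonarchimedeanLocalField F]
  {D : Type*} [DivisionRing D] [Algebra F D] {u ϖ : 𝒪[F]} {i j : D}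

/-- The units of the maximal order which are congruent to one modulo the maximal ideal. -/
noncomputable def principalUnits (h : IsStandard (u : F) (ϖ : F) i j) (hϖ : Irreducible ϖ) :
    Subgroup Dˣ :=
  (Units.map ((res (residue_eq_zero hϖ) : ℍ[𝒪[F],u,0,ϖ] →+* Residue u) :
    ℍ[𝒪[F],u,0,ϖ] →* Residue u)).ker.map h.unitsHom

theorem levelUnits_map_le (h : IsStandard (u : F) (ϖ : F) i j) (hϖ : Irreducible ϖ) {k : ℕ}
    (hk : k ≠ 0) : (levelUnits u ϖ k).map h.unitsHom ≤ h.principalUnits hϖ := by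
  refine Subgroup.map_mono fun x hx => ?_
  exact Units.ext (res_eq_one_of_mem (residue_eq_zero hϖ) hk hx)

/-- Units of the order preserve the level because ϖ ^ k is central, and j preserves it because
conjugation by j is the involution `twist`. Together they generate Dˣ. -/
theorem normal_levelUnits_map (h : IsStandard (u : F) (ϖ : F) i j) (h2 : (2 : F) ≠ 0)
    (hD : Module.finrank F D = 4) (hϖ : Irreducible ϖ) (hu : ¬ IsSquare (residue 𝒪[F] u))
    (k : ℕ) : ((levelUnits u ϖ k).map h.unitsHom).Normal := by
  have hP : ∀ x ∈ (levelUnits u ϖ k).map h.unitsHom,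
      h.unifUnit * x * h.unifUnit⁻¹ ∈ (levelUnits u ϖ k).map h.unitsHom := by
    rintro _ ⟨x, hx, rfl⟩
    exact ⟨_, twist_mem_levelUnits hx, h.unitsHom_twist x⟩
  have hP' : ∀ x ∈ (levelUnits u ϖ k).map h.unitsHom,
      h.unifUnit⁻¹ * x * h.unifUnit ∈ (levelUnits u ϖ k).map h.unitsHom := by
    rintro _ ⟨x, hx, rfl⟩
    refine ⟨_, twist_mem_levelUnits hx, ?_⟩
    have h1 : Units.mapEquiv (twist u ϖ) (Units.mapEquiv (twist u ϖ) x) = x :=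
      Units.ext ((twist u ϖ).left_inv x)
    conv_rhs => rw [← h1, h.unitsHom_twist (Units.mapEquiv (twist u ϖ) x)]
    group
  have hPm : ∀ (m : ℤ), ∀ x ∈ (levelUnits u ϖ k).map h.unitsHom,
      h.unifUnit ^ m * x * (h.unifUnit ^ m)⁻¹ ∈ (levelUnits u ϖ k).map h.unitsHom := by
    intro m
    induction m using Int.induction_on with
    | zero => simp
    | succ m ih =>
      intro x hx
      have := ih _ (hP x hx)
      convert! this using 1
      group
    | pred m ih =>
      intro x hx
      have := ih _ (hP' x hx)
      convert! this using 1
      group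
  refine ⟨fun x hx g => ?_⟩
  obtain ⟨m, y, rfl⟩ := h.exists_eq_unitsHom_mul_zpow h2 hD hϖ hu g
  obtain ⟨z, hz, hz'⟩ := hPm m x hx
  refine ⟨_, conj_mem_levelUnits hz y, ?_⟩
  rw [map_mul, map_mul, map_inv, hz']
  group

variable [TopologicalSpace D] [IsModuleTopology F D]

theorem isCompactOdd_principalUnits (h : IsStandard (u : F) (ϖ : F) i j)
    (h2 : (2 : 𝓀[F]) ≠ 0) (hD : Module.finrank F D = 4) (hϖ : Irreducible ϖ)
    (hu : ¬ IsSquare (residue 𝒪[F] u)) : ContCoh.IsCompactOdd (h.principalUnits hϖ) := by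
  have h2F : (2 : F) ≠ 0 := OddLocalField.two_ne_zero_of_residue h2
  have : Module.Finite F D := Module.finite_of_finrank_pos (by omega)
  have := IsModuleTopology.isTopologicalRing F D
  have := h.t2Space h2F hD
  have hopen : ∀ k ≠ 0, IsOpen (((levelUnits u ϖ k).map h.unitsHom : Subgroup Dˣ) : Set Dˣ) :=
    fun k hk => Subgroup.isOpen_of_mem_nhds _ (h.levelUnits_map_mem_nhds h2F hD hϖ hu hk)
  have hUopen : IsOpen (h.principalUnits hϖ : Set Dˣ) :=
    Subgroup.isOpen_mono (h.levelUnits_map_le hϖ one_ne_zero) (hopen 1 one_ne_zero)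
  have hUcompact : IsCompact (h.principalUnits hϖ : Set Dˣ) := by
    have h1 := h.isCompact_range_orderHom h2F hD
    have h3 := Units.isClosedEmbedding_embedProduct.isCompact_preimage
      (h1.prod (h1.image MulOpposite.continuous_op))
    refine h3.of_isClosed_subset (Subgroup.isClosed_of_isOpen _ hUopen) ?_
    rintro _ ⟨x, -, rfl⟩
    refine ⟨⟨x, rfl⟩, ⟨_, ⟨(x⁻¹ : ℍ[𝒪[F],u,0,ϖ]ˣ), rfl⟩, ?_⟩⟩
    change _ = MulOpposite.op (((h.unitsHom x)⁻¹ : Dˣ) : D)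
    rw [← map_inv]
    rfl
  refine ⟨hUcompact, fun W hW => ?_⟩
  obtain ⟨k, hk, hkW⟩ := h.exists_levelUnits_map_subset h2F hD hϖ hW
  have hn := h.normal_levelUnits_map h2F hD hϖ hu k
  refine ⟨(levelUnits u ϖ k).map h.unitsHom, hn, hopen k hk, h.levelUnits_map_le hϖ hk, hkW, ?_⟩
  have : CompactSpace (h.principalUnits hϖ) := isCompact_iff_compactSpace.1 hUcompact
  have : Finite (h.principalUnits hϖ ⧸
      ((levelUnits u ϖ k).map h.unitsHom).subgroupOf (h.principalUnits hϖ)) :=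
    Subgroup.quotient_finite_of_isOpen _ ((hopen k hk).preimage continuous_subtype_val)
  refine Subgroup.odd_relIndex ?_
  rintro _ ⟨x, hx, rfl⟩ hsq
  rw [← map_pow] at hsq
  obtain ⟨y, hy, hxy⟩ := hsq
  obtain rfl := h.unitsHom_injective h2F hxy
  exact ⟨x, mem_levelUnits_of_sq_mem (residue_eq_zero hϖ) hu h2 (congrArg Units.val hx) hy, rfl⟩

end IsStandard

open IsStandard in
/-- The multiplicative group of a quaternion division algebra is a tame group. -/
theorem exists_tameGroup {F : Type*} [Field F] [ValuativeRel F] [TopologicalSpace F]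
    [IsNonarchimedeanLocalField F] {D : Type*} [DivisionRing D] [Algebra F D]
    [TopologicalSpace D] [IsModuleTopology F D] [Algebra.IsCentral F D]
    (hD : Module.finrank F D = 4) (h2 : (2 : 𝓀[F]) ≠ 0) :
    ∃ T : ContCoh.TameGroup Dˣ, (∃ a : F, ((T.P * T.P : Dˣ) : D) = algebraMap F D a) ∧
      ∀ (d : D) (w : 𝒪[F]ˣ), d * d = algebraMap F D ((w : 𝒪[F]) : F) →
        d ∉ (algebraMap F D).range → ∃ (s t : F) (m : Dˣ),
          (m : D) = algebraMap F D s + algebraMap F D t * d ∧ T.v m = 0 ∧ T.lam m = 1 := by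
  have h2F : (2 : F) ≠ 0 := OddLocalField.two_ne_zero_of_residue h2
  obtain ⟨u, ϖ, i, j, hu, hϖ, h⟩ := exists_isStandard_unit_uniformizer hD h2
  have hϖ0 := residue_eq_zero hϖ
  obtain ⟨n, hn, ⟨θ⟩⟩ := exists_discreteLog hu
  obtain ⟨q, hq⟩ : ∃ q, q = Nat.card 𝓀[F] := ⟨_, rfl⟩
  rw [← hq] at hn
  have hq1 : 1 < q := hq ▸ Finite.one_lt_card
  have hqodd : Odd q := by
    let := Fintype.ofFinite 𝓀[F]
    rw [hq, Nat.card_eq_fintype_card, Nat.odd_iff]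
    refine FiniteField.odd_card_of_char_ne_two fun h0 => h2 ?_
    have h3 := ringChar.Nat.cast_ringChar (R := 𝓀[F])
    rw [h0] at h3
    exact_mod_cast h3
  have hcop : q.Coprime n := by
    rw [← Nat.isCoprime_iff_coprime]
    refine ⟨q, -1, ?_⟩
    have : (q : ℤ) ^ 2 = n + 1 := by exact_mod_cast hn
    linear_combination this
  let ρ : ℍ[𝒪[F],u,0,ϖ]ˣ →* (Residue u)ˣ :=
    Units.map ((res hϖ0 : ℍ[𝒪[F],u,0,ϖ] →+* Residue u) : ℍ[𝒪[F],u,0,ϖ] →* Residue u)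
  have hρ : ∀ x, (ρ x : Residue u) = res hϖ0 (x : ℍ[𝒪[F],u,0,ϖ]) := fun _ => rfl
  have hρs : Function.Surjective ρ := map_res_surjective hϖ0 hu
  have hτθ : ∀ x, θ (ρ (Units.mapEquiv (twist u ϖ) x)) = θ (ρ x) ^ q := by
    intro x
    rw [← map_pow]
    congr 1
    ext1
    rw [Units.val_pow_eq_pow_val, hρ, hρ, hq]
    exact res_twist hϖ0 hu x
  obtain ⟨v, lam, hv, hlam, hvl⟩ := exists_valuation_leading (f := h.unitsHom)
    (h.unitsHom_injective h2F) (P := h.unifUnit) (τ := Units.mapEquiv (twist u ϖ))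
    h.unitsHom_twist (h.exists_eq_unitsHom_mul_zpow h2F hD hϖ hu)
    (fun m x => h.eq_zero_of_zpow_eq h2F hϖ) (θ := θ.toMonoidHom.comp ρ)
    (ZMod.coe_unitOfCoprime q hcop) hτθ
  have hv0 : ∀ x, v (h.unitsHom x) = 0 := fun x => by simpa using (hvl x 0).1
  have hl0 : ∀ x, lam (h.unitsHom x) = Multiplicative.toAdd (θ (ρ x)) := fun x => by
    simpa using (hvl x 0).2
  have hPP : ((h.unifUnit * h.unifUnit : Dˣ) : D) = algebraMap F D ϖ := h.j_mul_j
  have hof : ∀ g, v g = 0 → ∃ x, g = h.unitsHom x := by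
    intro g hg
    obtain ⟨m, x, rfl⟩ := h.exists_eq_unitsHom_mul_zpow h2F hD hϖ hu g
    rw [(hvl x m).1] at hg
    exact ⟨x, by rw [hg, zpow_zero, mul_one]⟩
  obtain ⟨z, hz⟩ := hρs (θ.symm (Multiplicative.ofAdd 1))
  refine ⟨⟨q, n, hqodd, hq1, hn, v, hv, ZMod.unitOfCoprime q hcop, ZMod.coe_unitOfCoprime q hcop,
    lam, hlam, h.unifUnit, ?_, ?_, ?_, h.unitsHom z, hv0 z, ?_, h.principalUnits hϖ, ?_,
    h.isCompactOdd_principalUnits h2 hD hϖ hu⟩, ⟨ϖ, hPP⟩, ?_⟩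
  · simpa using (hvl 1 1).1
  · simpa using (hvl 1 1).2
  · intro g
    ext
    rw [Units.val_mul _ g, Units.val_mul g, hPP, Algebra.commutes]
  · rw [hl0, hz, MulEquiv.apply_symm_apply, toAdd_ofAdd]
  · intro g
    constructor
    · rintro ⟨x, hx, rfl⟩
      refine ⟨hv0 x, ?_⟩
      rw [hl0, show ρ x = 1 from hx, map_one, toAdd_one]
    · rintro ⟨hg, hg'⟩
      obtain ⟨x, rfl⟩ := hof g hg
      refine ⟨x, ?_, rfl⟩
      rw [hl0] at hg'
      exact (map_eq_one_iff θ θ.injective).1 (Multiplicative.toAdd.injective hg')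
  · intro d w hd hdF
    change ∃ (s t : F) (m : Dˣ), _ ∧ v m = 0 ∧ lam m = 1
    have hd0 : d ≠ 0 := by
      rintro rfl
      exact hdF (zero_mem _)
    have hw : (Units.mk0 d hd0) * (Units.mk0 d hd0) =
        h.unitsHom (Units.map (algebraMap 𝒪[F] ℍ[𝒪[F],u,0,ϖ] : 𝒪[F] →* _) w) := by
      ext
      exact hd.trans (h.orderHom.commutes (w : 𝒪[F])).symm
    have hvd : v (Units.mk0 d hd0) = 0 := by
      have h3 := congrArg v hw
      rw [hv, hv0] at h3
      omega
    obtain ⟨x, hx⟩ := hof _ hvd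
    have hxd : h.orderHom x = d := (congrArg Units.val hx).symm
    have hxx : (x : ℍ[𝒪[F],u,0,ϖ]) * x = algebraMap _ _ (w : 𝒪[F]) := by
      refine h.orderHom_injective h2F ?_
      rw [map_mul, hxd, hd]
      exact (h.orderHom.commutes (w : 𝒪[F])).symm
    obtain ⟨b, hb⟩ : ∃ b, b = res hϖ0 (x : ℍ[𝒪[F],u,0,ϖ]) := ⟨_, rfl⟩
    -- If d reduced into the residue field of F, then w would be a square there, hence a square in
    -- 𝒪[F] by Hensel, and d would lie in F.
    have hb0 : b.im ≠ 0 := by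
      intro h0
      have h3 : b * b = res hϖ0 (algebraMap 𝒪[F] ℍ[𝒪[F],u,0,ϖ] (w : 𝒪[F])) := by
        rw [hb, ← map_mul, hxx]
      have h4 := congrArg QuadraticAlgebra.re h3
      rw [QuadraticAlgebra.re_mul, h0, mul_zero, add_zero] at h4
      obtain ⟨s, hs⟩ := OddLocalField.isSquare_of_residue h2
        ((residue_ne_zero_iff_isUnit _).2 w.isUnit) ⟨b.re, h4.symm⟩
      exact hdF (mem_range_of_mul_self (s := (s : F)) (by rw [hd, hs]; rfl))
    obtain ⟨c, hc⟩ : ∃ c : Residue u, c = ρ z := ⟨_, rfl⟩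
    -- So 1 and b span the residue field of D; s and t lift the coordinates of the generator c in
    -- this basis.
    obtain ⟨t, ht⟩ := residue_surjective (c.im / b.im)
    obtain ⟨s, hs⟩ := residue_surjective (c.re - c.im / b.im * b.re)
    have hm : res hϖ0 (algebraMap 𝒪[F] _ s + algebraMap 𝒪[F] _ t * (x : ℍ[𝒪[F],u,0,ϖ])) = c := by
      rw [map_add, map_mul, ← hb]
      have h3 : ∀ r : 𝒪[F], res hϖ0 (algebraMap 𝒪[F] ℍ[𝒪[F],u,0,ϖ] r) = ⟨residue _ r, 0⟩ := by
        intro r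
        ext <;> simp [res]
      rw [h3, h3, ht, hs]
      ext
      · simp
      · simp [hb0]
    obtain ⟨m, hm'⟩ := (isUnit_iff hϖ0 hu _).2 (by rw [hm, hc]; exact (ρ z).ne_zero)
    have hρm : ρ m = ρ z := by
      ext1
      rw [hρ, hm', hm, hc]
    refine ⟨s, t, h.unitsHom m, ?_, hv0 m, ?_⟩
    · change h.orderHom m = _
      rw [hm', map_add, map_mul, hxd, AlgHom.commutes, AlgHom.commutes]
      rfl
    · rw [hl0, hρm, hz, MulEquiv.apply_symm_apply, toAdd_ofAdd]

end QuaternionDivision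

/-! ### The unramified quadratic extension -/

namespace OddLocalField

open IsLocalRing ValuativeRel

/-- Modulo x² the maps id and σ agree up to the square-zero ideal (x), so formal unramifiedness
makes them equal modulo x². At x this says that x² divides x - σ x = 2 x. -/
theorem dvd_two_mul_of_formallyUnramified {R B : Type*} [CommRing R] [CommRing B] [Algebra R B]
    [Algebra.FormallyUnramified R B] {x : B} {σ : B →ₐ[R] B} (hσx : σ x = -x)
    (hσ : ∀ b, ∃ c, b - σ b = c * x) : x * x ∣ 2 * x := by
  let J : Ideal B := Ideal.span {x * x}
  let I : Ideal (B ⧸ J) := Ideal.span {Ideal.Quotient.mk J x}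
  have hI : IsNilpotent I := by
    refine ⟨2, ?_⟩
    rw [Ideal.span_singleton_pow, ← map_pow, sq, Ideal.zero_eq_bot,
      Ideal.span_singleton_eq_bot, Ideal.Quotient.eq_zero_iff_mem]
    exact Ideal.mem_span_singleton_self _
  have heq : Ideal.Quotient.mkₐ R J = (Ideal.Quotient.mkₐ R J).comp σ := by
    refine Algebra.FormallyUnramified.lift_unique I hI _ _ ?_
    ext b
    obtain ⟨c, hc⟩ := hσ b
    refine Ideal.Quotient.eq.2 ?_
    change Ideal.Quotient.mk J b - Ideal.Quotient.mk J (σ b) ∈ I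
    rw [← map_sub, hc, map_mul]
    exact Ideal.mul_mem_left _ _ (Ideal.mem_span_singleton_self _)
  have h3 := DFunLike.congr_fun heq x
  change Ideal.Quotient.mk J x = Ideal.Quotient.mk J (σ x) at h3
  rwa [hσx, Ideal.Quotient.eq, sub_neg_eq_add, ← two_mul, Ideal.mem_span_singleton] at h3

section Quadratic

variable {F : Type*} [Field F] {M : Type*} [Field M] [Algebra F M]

theorem bijective_lift (hM : Module.finrank F M = 2) {d : F} {x : M}
    (hx : x * x = d • (1 : M) + (0 : F) • x) (hxF : x ∉ (algebraMap F M).range) :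
    Function.Bijective (QuadraticAlgebra.lift ⟨x, hx⟩ : QuadraticAlgebra F d 0 →ₐ[F] M) := by
  have hfact : Fact (∀ r : F, r ^ 2 ≠ d + 0 * r) := ⟨fun r hr => by
    refine hxF (mem_range_of_mul_self (s := r) ?_)
    rw [hx, zero_smul, add_zero, ← Algebra.algebraMap_eq_smul_one, ← sq, hr, zero_mul, add_zero]⟩
  have : Module.Finite F M := Module.finite_of_finrank_pos (by omega)
  have hinj : Function.Injective
    (QuadraticAlgebra.lift ⟨x, hx⟩ : QuadraticAlgebra F d 0 →ₐ[F] M) :=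
    RingHom.injective (QuadraticAlgebra.lift ⟨x, hx⟩ : QuadraticAlgebra F d 0 →ₐ[F] M).toRingHom
  exact ⟨hinj, (LinearMap.injective_iff_surjective_of_finrank_eq_finrank
      (f := (QuadraticAlgebra.lift ⟨x, hx⟩ : QuadraticAlgebra F d 0 →ₐ[F] M).toLinearMap)
      (by rw [hM, QuadraticAlgebra.finrank_eq_two])).1 hinj⟩

/-- A quadratic extension has a conjugation. -/
theorem exists_conj (hM : Module.finrank F M = 2) {d : F} {x : M}
    (hx : x * x = algebraMap F M d) (hxF : x ∉ (algebraMap F M).range) :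
    ∃ σ : M →ₐ[F] M, σ x = -x ∧
      ∀ m, ∃ p q : F, m = algebraMap F M p + algebraMap F M q * x := by
  have hx' : x * x = d • (1 : M) + (0 : F) • x := by
    rw [hx, zero_smul, add_zero, Algebra.algebraMap_eq_smul_one]
  have hnx : -x * -x = d • (1 : M) + (0 : F) • -x := by
    rw [neg_mul_neg, hx', zero_smul, zero_smul]
  let e := AlgEquiv.ofBijective _ (bijective_lift hM hx' hxF)
  have he : ∀ p q : F, e ⟨p, q⟩ = algebraMap F M p + algebraMap F M q * x := by
    intro p q
    change QuadraticAlgebra.lift ⟨x, hx'⟩ _ = _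
    simp [QuadraticAlgebra.lift, Algebra.smul_def]
  have hex : e.symm x = ⟨0, 1⟩ := by
    rw [AlgEquiv.symm_apply_eq, he]
    simp
  refine ⟨(QuadraticAlgebra.lift ⟨-x, hnx⟩).comp (e.symm : M →ₐ[F] QuadraticAlgebra F d 0), ?_,
    fun m => ?_⟩
  · rw [AlgHom.comp_apply]
    change QuadraticAlgebra.lift ⟨-x, hnx⟩ (e.symm x) = _
    rw [hex]
    simp [QuadraticAlgebra.lift]
  · obtain ⟨⟨p, q⟩, rfl⟩ := e.surjective m
    exact ⟨p, q, he p q⟩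

end Quadratic

variable {F : Type*} [Field F] [ValuativeRel F] {M : Type*} [Field M] [Algebra F M]

theorem exists_eq_of_isIntegral {f : F}
    (hf : IsIntegral 𝒪[F] (algebraMap F M f)) : ∃ r : 𝒪[F], (r : F) = f := by
  have h1 : IsIntegral 𝒪[F] f := (isIntegral_algebraMap_iff (algebraMap F M).injective).1 hf
  exact IsIntegrallyClosed.isIntegral_iff.1 h1

variable [TopologicalSpace F] [IsNonarchimedeanLocalField F]

/-- In additive terms the valuation of f² ϖ is 2 v(f) + 1; if this is non-negative, so is v(f). -/
theorem exists_eq_of_sq_mul_uniformizer {ϖ r : 𝒪[F]} (hϖ : Irreducible ϖ) {f : F}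
    (hf : f ^ 2 * ϖ = r) : ∃ s : 𝒪[F], (s : F) = f := by
  by_contra hcon
  have h1 : ¬ valuation F f ≤ 1 := fun h => hcon ⟨⟨f, h⟩, rfl⟩
  have hf0 : f ≠ 0 := by
    rintro rfl
    exact h1 (by simp)
  have h2 : valuation F f⁻¹ < 1 := by
    rw [map_inv₀]
    exact inv_lt_one_of_one_lt₀ (not_le.1 h1)
  obtain ⟨g, hg⟩ : ∃ g : 𝒪[F], (g : F) = f⁻¹ := ⟨⟨f⁻¹, h2.le⟩, rfl⟩
  have h3 : ϖ ∣ g := by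
    rw [← Ideal.mem_span_singleton, ← hϖ.maximalIdeal_eq, mem_maximalIdeal, mem_nonunits_iff,
      Valuation.Integer.not_isUnit_iff_valuation_lt_one, hg]
    exact h2
  obtain ⟨s, rfl⟩ := h3
  refine hϖ.not_isUnit (IsUnit.of_mul_eq_one (r * s ^ 2) (Subtype.ext ?_))
  change (ϖ : F) * (r * (s : F) ^ 2) = 1
  have hg' : (ϖ : F) * s = f⁻¹ := hg
  rw [← hf]
  calc (ϖ : F) * (f ^ 2 * ϖ * s ^ 2) = f ^ 2 * (ϖ * s) ^ 2 := by ring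
    _ = 1 := by rw [hg', ← mul_pow, mul_inv_cancel₀ hf0, one_pow]

/-- A quadratic extension generated by a square root of a uniformizer is ramified. -/
theorem not_formallyUnramified (h2 : (2 : 𝓀[F]) ≠ 0) (hM : Module.finrank F M = 2) {ϖ : 𝒪[F]}
    (hϖ : Irreducible ϖ) {x : M} (hx : x * x = algebraMap F M ϖ)
    (hxF : x ∉ (algebraMap F M).range) :
    ¬ Algebra.FormallyUnramified 𝒪[F] (integralClosure 𝒪[F] M) := by
  intro hunr
  have h2F := two_ne_zero_of_residue h2
  obtain ⟨σ, hσx, hdec⟩ := exists_conj hM hx hxF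
  have hxint : IsIntegral 𝒪[F] x := by
    refine IsIntegral.of_pow (n := 2) two_pos ?_
    rw [sq, hx]
    exact isIntegral_algebraMap (x := ϖ)
  let B := integralClosure 𝒪[F] M
  let X : B := ⟨x, hxint⟩
  have hXX : X * X = algebraMap 𝒪[F] B ϖ := Subtype.ext hx
  let σB : B →ₐ[𝒪[F]] B := (σ.restrictScalars 𝒪[F]).mapIntegralClosure
  have hσX : σB X = -X := Subtype.ext hσx
  -- For b = p + q x the difference is 2 q x. Its square (2q)² ϖ is integral and lies in F, which
  -- forces 2q into 𝒪[F].
  have hcong : ∀ b : B, ∃ c : B, b - σB b = c * X := by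
    intro b
    obtain ⟨p, q, hpq⟩ := hdec b
    have hσb : ((b - σB b : B) : M) = algebraMap F M (2 * q) * x := by
      change (b : M) - σ b = _
      rw [hpq, map_add, map_mul, AlgHom.commutes, AlgHom.commutes, hσx, map_mul, map_ofNat]
      ring
    obtain ⟨r, hr⟩ : ∃ r : 𝒪[F], (r : F) = (2 * q) ^ 2 * ϖ := by
      refine exists_eq_of_isIntegral (M := M) ?_
      have h3 : algebraMap F M ((2 * q) ^ 2 * ϖ) = ((b - σB b : B) : M) ^ 2 := by
        rw [hσb, mul_pow (algebraMap F M (2 * q)) x, sq x, hx, map_mul, map_pow]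
      rw [h3]
      exact (b - σB b).2.pow 2
    obtain ⟨s, hs⟩ := exists_eq_of_sq_mul_uniformizer hϖ hr.symm
    refine ⟨algebraMap 𝒪[F] B s, Subtype.ext ?_⟩
    rw [hσb, ← hs]
    rfl
  obtain ⟨c, hc⟩ := dvd_two_mul_of_formallyUnramified hσX hcong
  have hX0 : X ≠ 0 := by
    intro h0
    refine hxF ?_
    rw [show x = 0 from congrArg Subtype.val h0]
    exact zero_mem _
  have hc2 : (2 : B) = X * c := by
    rw [mul_assoc, mul_comm 2 X] at hc
    exact mul_left_cancel₀ hX0 hc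
  -- From 2 = x c, the element c² = 4 / ϖ is integral over 𝒪[F], so ϖ divides 4, which is impossible
  -- in odd residue characteristic.
  have hc4 : ((c : B) : M) ^ 2 = algebraMap F M (4 / ϖ) := by
    have h5 : (algebraMap F M ϖ) * (c : M) ^ 2 = 4 := by
      have h6 : (2 : M) = x * c := congrArg Subtype.val hc2
      calc algebraMap F M ϖ * (c : M) ^ 2 = (x * c) * (x * c) := by rw [← hx]; ring
        _ = 4 := by rw [← h6]; norm_num
    have h0 : (ϖ : F) ≠ 0 := by simpa using hϖ.ne_zero
    rw [map_div₀, map_ofNat, eq_div_iff (by simpa using h0), mul_comm, h5]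
  obtain ⟨r, hr⟩ := exists_eq_of_isIntegral (M := M) (f := 4 / (ϖ : F))
    (by rw [← hc4]; exact c.2.pow 2)
  have h0 : (ϖ : F) ≠ 0 := by simpa using hϖ.ne_zero
  have h7 : (4 : 𝒪[F]) = r * ϖ := by
    refine Subtype.ext ?_
    change (4 : F) = r * ϖ
    rw [hr, div_mul_cancel₀ _ h0]
  have h8 := congrArg (residue 𝒪[F]) h7
  rw [map_mul, (residue_eq_zero_iff ϖ).2 hϖ.not_isUnit, mul_zero, map_ofNat] at h8
  exact h2 (mul_self_eq_zero.1 (by rw [← h8]; norm_num))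

/-- The unramified quadratic extension is generated by a square root of a unit. -/
theorem exists_mul_self_eq_unit (h2 : (2 : 𝓀[F]) ≠ 0) (hM : Module.finrank F M = 2)
    (hunr : Algebra.FormallyUnramified 𝒪[F] (integralClosure 𝒪[F] M)) :
    ∃ (x : M) (w : 𝒪[F]ˣ), x * x = algebraMap F M ((w : 𝒪[F]) : F) ∧
      x ∉ (algebraMap F M).range := by
  have h2F := two_ne_zero_of_residue h2
  have : Module.Finite F M := Module.finite_of_finrank_pos (by omega)
  obtain ⟨y, hy⟩ : ∃ y : M, y ∉ (algebraMap F M).range := by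
    by_contra! hcon
    have h3 : Module.finrank F M = 1 := by
      rw [← Subalgebra.bot_eq_top_iff_finrank_eq_one, eq_top_iff]
      exact fun y _ => Algebra.mem_bot.2 (hcon y)
    omega
  have hint : IsIntegral F y := IsIntegral.of_finite F y
  have hdeg : (minpoly F y).natDegree = 2 := by
    have h3 := minpoly.natDegree_le (A := F) y
    have h4 := minpoly.natDegree_pos hint
    have h5 : (minpoly F y).natDegree ≠ 1 := fun h => hy (minpoly.natDegree_eq_one_iff.1 h)
    omega
  obtain ⟨t, d, htd⟩ := exists_sub_sq_eq h2F hint hdeg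
  have hyt : y - algebraMap F M t ∉ (algebraMap F M).range := by
    rintro ⟨s, hs⟩
    exact hy ⟨s + t, by rw [map_add, hs, sub_add_cancel]⟩
  have hd0 : d ≠ 0 := by
    rintro rfl
    rw [map_zero, mul_self_eq_zero] at htd
    exact hyt (by rw [htd]; exact zero_mem _)
  obtain ⟨c, d, hc, hd, rfl⟩ := exists_eq_sq_mul hd0
  obtain ⟨x, hx⟩ : ∃ x, x = algebraMap F M c⁻¹ * (y - algebraMap F M t) := ⟨_, rfl⟩
  have hxx : x * x = algebraMap F M d := by
    rw [hx, mul_mul_mul_comm, htd, ← map_mul, ← map_mul]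
    congr 1
    field_simp
  have hxF : x ∉ (algebraMap F M).range := by
    rintro ⟨s, hs⟩
    refine hyt ⟨c * s, ?_⟩
    rw [map_mul, hs, hx, ← mul_assoc, ← map_mul, mul_inv_cancel₀ hc, map_one, one_mul]
  rcases hd with ⟨w, rfl⟩ | hd
  · exact ⟨x, w, hxx, hxF⟩
  · exact absurd hunr (not_formallyUnramified h2 hM hd hxx hxF)

end OddLocalField
-- The main theorem
theorem mainTheorem11
    (F : Type*) [Field F] [ValuativeRel F] [TopologicalSpace F] [IsNonarchimedeanLocalField F]
    (hF : ringChar 𝓀[F] ≠ 2)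
    (D : Type*) [DivisionRing D] [Algebra F D] [Algebra.IsCentral F D]
    (hD : Module.finrank F D = 4) [TopologicalSpace D] [IsModuleTopology F D] :
    Nonempty (ContCoh.H2 Dˣ (ZMod 2) ≃+ ZMod 2 × ZMod 2) ∧
    Nonempty (AddSubgroup.torsionBy (ContCoh.H2 Dˣ (Additive ℂˣ)) 2 ≃+ ZMod 2) ∧
    (∃ δ : ContCoh.H1 Dˣ (Additive ℂˣ) ⧸ (nsmulAddMonoidHom 2 :
          ContCoh.H1 Dˣ (Additive ℂˣ) →+ ContCoh.H1 Dˣ (Additive ℂˣ)).range →+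
        ContCoh.H2 Dˣ (ZMod 2),
      (∀ χ : ContCoh.H1 Dˣ (Additive ℂˣ),
        ContCoh.IsConnectingImage χ (δ (QuotientAddGroup.mk χ))) ∧
      Function.Injective δ ∧
      Function.Exact δ (ContCoh.H2.map Dˣ ContCoh.signHom) ∧
      (ContCoh.H2.map Dˣ ContCoh.signHom).range =
        AddSubgroup.torsionBy (ContCoh.H2 Dˣ (Additive ℂˣ)) 2) ∧
    Nonempty (ContCoh.H1 Dˣ (Additive ℂˣ) ⧸ (nsmulAddMonoidHom 2 :
        ContCoh.H1 Dˣ (Additive ℂˣ) →+ ContCoh.H1 Dˣ (Additive ℂˣ)).range ≃+ ZMod 2) ∧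
    (∀ (M : Type*) [Field M] [Algebra F M] (j : M →ₐ[F] D), Module.finrank F M = 2 →
      Algebra.FormallyUnramified 𝒪[F] (integralClosure 𝒪[F] M) →
      ∀ (E : Type*) [Group E] [TopologicalSpace E] (ι : Multiplicative (ZMod 2) →* E)
        (p : E →* Dˣ) (hE : IsTwofoldCover ι p),
        ¬ SplitsOver (ComplexCover.proj hE) ⊤ →
        ¬ SplitsOver p (Units.map (j : M →* D)).range ∧
        ¬ SplitsOver (ComplexCover.proj hE) (Units.map (j : M →* D)).range) := by
  have h2 : (2 : 𝓀[F]) ≠ 0 := Ring.two_ne_zero hF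
  have : Module.Finite F D := Module.finite_of_finrank_pos (by omega)
  have : IsTopologicalRing D := IsModuleTopology.isTopologicalRing F D
  obtain ⟨_, _, _, _, -, -, h⟩ := QuaternionDivision.exists_isStandard_unit_uniformizer hD h2
  have : T2Space D := h.t2Space (OddLocalField.two_ne_zero_of_residue h2) hD
  obtain ⟨T, ⟨a, ha⟩, hT⟩ := QuaternionDivision.exists_tameGroup hD h2
  obtain ⟨h₁, h₂, h₃, h₄⟩ := T.cohomology
  refine ⟨h₁, h₂, h₃, h₄, ?_⟩
  intro M _ _ j hM hunr E _ _ ι p hE hns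
  obtain ⟨x, w, hxx, hxF⟩ := OddLocalField.exists_mul_self_eq_unit h2 hM hunr
  -- M is generated by a square root x of a unit, so a unit with the leading coefficient of z exists
  -- in F + F x, the image of M.
  obtain ⟨s, t, m, hm, hvm, hlm⟩ := hT (j x) w (by rw [← map_mul, hxx, AlgHom.commutes]) (by
    rintro ⟨r, hr⟩
    rw [← AlgHom.commutes j] at hr
    exact hxF ⟨r, j.injective hr⟩)
  have hrange : ∀ (g : Dˣ) (y : M), (g : D) = j y → g ∈ (Units.map (j : M →* D)).range := by
    intro g y hy
    have hy0 : y ≠ 0 := by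
      rintro rfl
      exact g.ne_zero (hy.trans (map_zero j))
    exact ⟨Units.mk0 y hy0, Units.ext hy.symm⟩
  refine T.not_splitsOver hE (hrange _ (algebraMap F M a) ?_)
    (hrange m (algebraMap F M s + algebraMap F M t * x) ?_) hvm hlm hns
  · rw [ha, AlgHom.commutes]
  · rw [hm, map_add, map_mul, AlgHom.commutes, AlgHom.commutes]
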